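/- **Theorem (well-posedness of the homogeneous nonlocal MGT equation).** Let $n\ge 1$, let $\Omega\subset\mathbb R^n$ be a bounded open set (for example a bounded Lipschitz domain), $T>0$, $s>0$, $b>0$ and $\alpha,c\in\mathbb R$. Let $2\le p\le\infty$ with $p\ge n/s$ if $2s<n$ and $p>2$ if $2s=n$. Here $H^r(\mathbb R^n)$, $r\in\mathbb R$, is the $L^2$-based Bessel potential space (of complex-valued functions or distributions), $\widetilde H^r(\Omega)$ is the closure of $C_c^\infty(\Omega)$ in $H^r(\mathbb R^n)$, $\widetilde L^2(\Omega)=\widetilde H^0(\Omega)$, $H^r(\Omega)=\{U|_\Omega: U\in H^r(\mathbb R^n)\}$ with the quotient norm, and $(-\Delta)^{\sigma}$, $\sigma\geq 0$, is the Fourier multiplier $|\xi|^{2\sigma}$ (angular frequency). For every $M\ge 0$ there is a constant $C>0$, depending only on $\Omega,n,T,s,p,\alpha,b,c$ and $M$, such that the following holds for every real-valued $q\in L^\infty(0,T;L^p(\Omega))$ with $\|q\|_{L^\infty(0,T;L^p(\Omega))}\le M$ and all $$(u_0,u_1,u_2,F)\in \widetilde H^s(\Omega)\times\widetilde H^s(\Omega)\times\widetilde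 L^2(\Omega)\times L^2(0,T;\widetilde L^2(\Omega)).$$ There is a unique weak solution $u\in W^{1,\infty}(0,T;\widetilde H^s(\Omega))\cap W^{2,\infty}(0,T;\widetilde L^2(\Omega))$ of $$\begin{cases}(\partial_t^3+\alpha\partial_t^2+b(-\Delta)^s\partial_t+c(-\Delta)^s+q)u=F &\text{in }\Omega\times(0,T),\\ u=0&\text{in }(\mathbb R^n\setminus\overline\Omega)\times(0,T),\\ u(0)=u_0,\ \partial_tu(0)=u_1,\ \partial_t^2u(0)=u_2&\text{in }\Omega,\end{cases}$$ meaning that $u(0)=u_0$, $\partial_tu(0)=u_1$ and, for all $\varphi\in C_c^\infty(\Omega\times[0,T))$, $$-\int_0^T\!\!\int_\Omega \partial_t^2u\,\partial_t\varphi\,dx\,dt+\int_0^T\big\langle (\alpha\partial_t^2+b(-\Delta)^s\partial_t+c(-\Delta)^s+q)u,\varphi\big\rangle\,dt=\int_0^T\langle F,\varphi\rangle\,dt+\int_\Omega u_2\,\varphi(0)\,dx .$$ Moreover $u\in H^3(0,T;H^{-s}(\Omega))$ and $$\|\partial_t^2u\|_{L^\infty(0,T;L^2(\Omega))}+\|u\|_{W^{1,\infty}(0,T;\widetilde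 H^s(\Omega))}\le C\big(\|(-\Delta)^{s/2}u_0\|_{L^2(\mathbb R^n)}+\|(-\Delta)^{s/2}u_1\|_{L^2(\mathbb R^n)}+\|u_2\|_{L^2(\Omega)}+\|F\|_{L^2(0,T;L^2(\Omega))}\big),$$ where $\|u\|_{W^{1,\infty}(0,T;\widetilde H^s(\Omega))}=\|(-\Delta)^{s/2}u\|_{L^\infty(0,T;L^2(\mathbb R^n))}+\|(-\Delta)^{s/2}\partial_tu\|_{L^\infty(0,T;L^2(\mathbb R^n))}$. -/

import Mathlib

open MeasureTheory TemperedDistribution FourierTransform Set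
open scoped SchwartzMap ENNReal NNReal ContDiff

noncomputable section

namespace MGT

section SobolevSpaces

/-! Here `E` stands for `ℝⁿ`; all functions and distributions are complex valued. -/

variable (E : Type*) [NormedAddCommGroup E] [InnerProductSpace ℝ E] [FiniteDimensional ℝ E]
  [MeasurableSpace E] [BorelSpace E]

/-- `L²(ℝⁿ)`. -/
abbrev L2Rn : Type _ := Lp ℂ 2 (volume : Measure E)

/-- The tempered distributions `u` with `⟨D⟩^r u ∈ L²(ℝⁿ)`, as a linear subspace of `𝓢'(ℝⁿ)`. -/
def sobolevSubmodule (r : ℝ) : Submodule ℂ 𝓢'(E, ℂ) where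
  carrier := {u | MemSobolev r 2 u}
  add_mem' := fun hu hv => MemSobolev.add hu hv
  zero_mem' := memSobolev_fun_zero E ℂ r 2
  smul_mem' := fun a _ hu => MemSobolev.smul a hu

/-- The fractional Sobolev space `H^r(ℝⁿ)`, `r ∈ ℝ`: tempered distributions `u` with
`⟨D⟩^r u ∈ L²(ℝⁿ)`. It carries the norm `‖⟨D⟩^r u‖_{L²}` (instance below). -/
def Hs (r : ℝ) : Type _ := sobolevSubmodule E r

variable {E} {r t σ : ℝ}

instance : AddCommGroup (Hs E r) := inferInstanceAs (AddCommGroup (sobolevSubmodule E r))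
instance : Module ℂ (Hs E r) := inferInstanceAs (Module ℂ (sobolevSubmodule E r))

/-- The tempered distribution underlying an element of `H^r(ℝⁿ)`. -/
def Hs.toDist : Hs E r →ₗ[ℂ] 𝓢'(E, ℂ) := (sobolevSubmodule E r).subtype

theorem Hs.toDist_injective : Function.Injective (Hs.toDist : Hs E r →ₗ[ℂ] 𝓢'(E, ℂ)) :=
  Subtype.val_injective

theorem Hs.memSobolev (u : Hs E r) : MemSobolev r 2 u.toDist := u.2

/-- The element of `H^r(ℝⁿ)` given by a tempered distribution `f` with `⟨D⟩^r f ∈ L²(ℝⁿ)`. -/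
def Hs.ofDist (f : 𝓢'(E, ℂ)) (hf : MemSobolev r 2 f) : Hs E r := ⟨f, hf⟩

theorem Hs.toDist_ofDist (f : 𝓢'(E, ℂ)) (hf : MemSobolev r 2 f) :
    (Hs.ofDist f hf).toDist = f := rfl

theorem memSobolev_besselPotential_neg (f : L2Rn E) :
    MemSobolev r 2 (besselPotential E ℂ (-r) (f : 𝓢'(E, ℂ))) := by
  rw [memSobolev_besselPotential_iff, neg_add_cancel, memSobolev_zero_iff]
  exact ⟨f, rfl⟩

theorem toDist_L2_injective :
    Function.Injective (fun f : L2Rn E => (f : 𝓢'(E, ℂ))) := by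
  have h := Lp.ker_toTemperedDistributionCLM_eq_bot (E := E) (F := ℂ) (p := 2)
    (μ := (volume : Measure E))
  exact LinearMap.ker_eq_bot.mp h

/-- The `L²` function `⟨D⟩^r u` for `u ∈ H^r(ℝⁿ)`. -/
def Hs.besselFun (u : Hs E r) : L2Rn E := Exists.choose u.memSobolev

/-- `⟨D⟩^r u` is indeed the Bessel potential of the tempered distribution `u`. -/
theorem Hs.besselFun_spec (u : Hs E r) :
    besselPotential E ℂ r u.toDist = (u.besselFun : 𝓢'(E, ℂ)) :=
  Exists.choose_spec u.memSobolev

/-- The Bessel potential `⟨D⟩^r : H^r(ℝⁿ) → L²(ℝⁿ)`, a linear bijection. -/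
def Hs.bessel : Hs E r ≃ₗ[ℂ] L2Rn E where
  toFun u := u.besselFun
  map_add' u v := by
    apply toDist_L2_injective
    change ((u + v).besselFun : 𝓢'(E, ℂ)) =
      (Lp.toTemperedDistributionCLM ℂ volume 2) (u.besselFun + v.besselFun)
    rw [map_add, Lp.toTemperedDistributionCLM_apply, Lp.toTemperedDistributionCLM_apply,
      ← Hs.besselFun_spec, ← Hs.besselFun_spec, ← Hs.besselFun_spec, map_add, map_add]
  map_smul' a u := by
    apply toDist_L2_injective
    change ((a • u).besselFun : 𝓢'(E, ℂ)) =
      (Lp.toTemperedDistributionCLM ℂ volume 2) (a • u.besselFun)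
    rw [map_smul, Lp.toTemperedDistributionCLM_apply,
      ← Hs.besselFun_spec, ← Hs.besselFun_spec, map_smul, map_smul]
  invFun f := Hs.ofDist (besselPotential E ℂ (-r) (f : 𝓢'(E, ℂ)))
    (memSobolev_besselPotential_neg f)
  left_inv u := by
    apply Hs.toDist_injective
    beta_reduce
    rw [Hs.toDist_ofDist, ← Hs.besselFun_spec]
    simp
  right_inv f := by
    apply toDist_L2_injective
    beta_reduce
    rw [← Hs.besselFun_spec, Hs.toDist_ofDist]
    simp

theorem Hs.bessel_spec (u : Hs E r) :
    besselPotential E ℂ r u.toDist = (Hs.bessel u : 𝓢'(E, ℂ)) :=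
  u.besselFun_spec

instance : NormedAddCommGroup (Hs E r) :=
  NormedAddCommGroup.induced (Hs E r) (L2Rn E) Hs.bessel.toLinearMap Hs.bessel.injective

theorem Hs.norm_eq (u : Hs E r) : ‖u‖ = ‖Hs.bessel u‖ := rfl

instance : NormedSpace ℂ (Hs E r) :=
  NormedSpace.induced ℂ (Hs E r) (L2Rn E) Hs.bessel.toLinearMap

/-- The Bessel potential as an isometric isomorphism `H^r(ℝⁿ) ≅ L²(ℝⁿ)`. -/
def Hs.besselIso : Hs E r ≃ₗᵢ[ℂ] L2Rn E where
  toLinearEquiv := Hs.bessel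
  norm_map' _ := rfl

instance : CompleteSpace (Hs E r) :=
  (Hs.besselIso (E := E) (r := r)).isometry.isUniformInducing.completeSpace_congr
    Hs.besselIso.surjective |>.mpr inferInstance

/-- The duality pairing `⟨u, ψ⟩ = u(ψ)` of `u ∈ H^r(ℝⁿ) ⊂ 𝓢'(ℝⁿ)` with a Schwartz function. -/
def Hs.pair (u : Hs E r) (ψ : 𝓢(E, ℂ)) : ℂ := u.toDist ψ

theorem Hs.continuous_pair (ψ : 𝓢(E, ℂ)) : Continuous (fun u : Hs E r => u.pair ψ) := by
  have h : (fun u : Hs E r => u.pair ψ) = fun u =>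
      (besselPotential E ℂ (-r) (Lp.toTemperedDistributionCLM ℂ volume 2
        (Hs.besselIso u))) ψ := by
    funext u
    have := Hs.bessel_spec u
    show u.toDist ψ = (besselPotential E ℂ (-r) (Hs.bessel u : 𝓢'(E, ℂ))) ψ
    rw [← this]; simp
  rw [h]
  have h1 : Continuous (fun f : 𝓢'(E, ℂ) => f ψ) :=
    (PointwiseConvergenceCLM.evalCLM (RingHom.id ℂ) ℂ ψ).continuous
  exact h1.comp ((besselPotential E ℂ (-r)).continuous.comp
    ((Lp.toTemperedDistributionCLM ℂ volume 2).continuous.comp Hs.besselIso.continuous))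

/-- Multiplication by an `L^∞` function on `L²(ℝⁿ)`. -/
def mulL2 (m : Lp ℂ ∞ (volume : Measure E)) : L2Rn E →L[ℂ] L2Rn E :=
  LinearMap.mkContinuous
    { toFun := fun f => m • f
      map_add' := fun f g => Lp.add_smul m f g
      map_smul' := fun a f => (Lp.smul_comm a m f).symm }
    ‖m‖ (fun f => Lp.norm_smul_le m f)

/-- The function representing the Fourier transform of `u ∈ H^r(ℝⁿ)`, that is
`û(ξ) = ⟨ξ⟩^{-r} 𝓕(⟨D⟩^r u)(ξ)`. -/
def Hs.fourierFun (u : Hs E r) (ξ : E) : ℂ :=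
  (((1 + ‖ξ‖ ^ 2) ^ (-r / 2) : ℝ) : ℂ) * (𝓕 (Hs.bessel u) : L2Rn E) ξ

/-- `û` represents the Fourier transform of the tempered distribution `u`. -/
theorem Hs.fourier_toDist_apply (u : Hs E r) (ψ : 𝓢(E, ℂ)) :
    (𝓕 u.toDist) ψ = ∫ ξ, ψ ξ * u.fourierFun ξ := by
  have h0 : u.toDist = besselPotential E ℂ (-r) (Hs.bessel u : 𝓢'(E, ℂ)) := by
    rw [← Hs.bessel_spec]; simp
  rw [h0, fourier_besselPotential_eq_smulLeftCLM_fourier_apply,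
    Lp.fourier_toTemperedDistribution_eq, smulLeftCLM_apply_apply, Lp.toTemperedDistribution_apply]
  refine integral_congr_ae (Filter.Eventually.of_forall fun ξ => ?_)
  simp only [Hs.fourierFun]
  rw [SchwartzMap.smulLeftCLM_apply_apply (by fun_prop)]
  simp only [smul_eq_mul]
  ring

/-- The weight `⟨ξ⟩^{t-r} |2πξ|^{2σ}`: the symbol of `(-Δ)^σ : H^r → H^t` after conjugation with
Bessel potentials. Mathlib's Fourier transform is `∫ e^{-2πi x·ξ} u(x) dx`, so that the symbol of
`-Δ` is `|2πξ|²`. -/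
def fracLapWeight (E : Type*) [NormedAddCommGroup E] (r t σ : ℝ) (ξ : E) : ℂ :=
  (((1 + ‖ξ‖ ^ 2) ^ ((t - r) / 2) * (2 * Real.pi * ‖ξ‖) ^ (2 * σ) : ℝ) : ℂ)

theorem fracLapWeight_memLp (hσ : 0 ≤ σ) (h : t + 2 * σ ≤ r) :
    MemLp (fracLapWeight E r t σ) ∞ (volume : Measure E) := by
  refine memLp_top_of_bound (C := (2 * Real.pi) ^ (2 * σ)) ?_ ?_
  · apply Measurable.aestronglyMeasurable
    unfold fracLapWeight
    fun_prop
  · refine Filter.Eventually.of_forall fun ξ => ?_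
    rw [fracLapWeight, Complex.norm_real, Real.norm_eq_abs, abs_of_nonneg (by positivity),
      Real.mul_rpow (by positivity) (by positivity)]
    have h1 : ‖ξ‖ ^ (2 * σ) ≤ (1 + ‖ξ‖ ^ 2) ^ σ := by
      rw [Real.rpow_mul (norm_nonneg _)]
      refine Real.rpow_le_rpow (by positivity) ?_ hσ
      norm_cast
      linarith
    have h2 : (1 + ‖ξ‖ ^ 2) ^ ((t - r) / 2) * (1 + ‖ξ‖ ^ 2) ^ σ ≤ (1 : ℝ) := by
      rw [← Real.rpow_add (by positivity)]
      exact Real.rpow_le_one_of_one_le_of_nonpos (by nlinarith [sq_nonneg ‖ξ‖]) (by linarith)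
    have h3 : (0 : ℝ) ≤ (2 * Real.pi) ^ (2 * σ) := by positivity
    have h4 : (0 : ℝ) ≤ (1 + ‖ξ‖ ^ 2) ^ ((t - r) / 2) := by positivity
    calc (1 + ‖ξ‖ ^ 2) ^ ((t - r) / 2) * ((2 * Real.pi) ^ (2 * σ) * ‖ξ‖ ^ (2 * σ))
        = (2 * Real.pi) ^ (2 * σ) * ((1 + ‖ξ‖ ^ 2) ^ ((t - r) / 2) * ‖ξ‖ ^ (2 * σ)) := by ring
      _ ≤ (2 * Real.pi) ^ (2 * σ) * ((1 + ‖ξ‖ ^ 2) ^ ((t - r) / 2) * (1 + ‖ξ‖ ^ 2) ^ σ) := by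
          gcongr
      _ ≤ (2 * Real.pi) ^ (2 * σ) * 1 := by gcongr
      _ = _ := mul_one _

/-- The fractional Laplacian `(-Δ)^σ = 𝓕⁻¹ |2πξ|^{2σ} 𝓕`, `σ ≥ 0`, as a continuous linear map
`H^r(ℝⁿ) → H^t(ℝⁿ)`, `t ≤ r - 2σ`; see `fracLap_spec`. -/
def fracLap (σ : ℝ) (hσ : 0 ≤ σ) (h : t + 2 * σ ≤ r) : Hs E r →L[ℂ] Hs E t :=
  (Hs.besselIso (E := E) (r := t)).symm.toContinuousLinearEquiv.toContinuousLinearMap ∘L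
  (Lp.fourierTransformₗᵢ E ℂ).symm.toContinuousLinearEquiv.toContinuousLinearMap ∘L
  mulL2 ((fracLapWeight_memLp (E := E) hσ h).toLp (fracLapWeight E r t σ)) ∘L
  (Lp.fourierTransformₗᵢ E ℂ).toContinuousLinearEquiv.toContinuousLinearMap ∘L
  (Hs.besselIso (E := E) (r := r)).toContinuousLinearEquiv.toContinuousLinearMap

theorem fracLap_fourierFun (hσ : 0 ≤ σ) (h : t + 2 * σ ≤ r) (u : Hs E r) :
    (fracLap σ hσ h u).fourierFun =ᵐ[volume]
      fun ξ => (((2 * Real.pi * ‖ξ‖) ^ (2 * σ) : ℝ) : ℂ) * u.fourierFun ξ := by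
  have e : (𝓕 (Hs.bessel (fracLap σ hσ h u)) : L2Rn E) =
      (fracLapWeight_memLp (E := E) hσ h).toLp (fracLapWeight E r t σ) •
        (𝓕 (Hs.bessel u) : L2Rn E) := by
    change (Lp.fourierTransformₗᵢ E ℂ) (Hs.besselIso ((Hs.besselIso).symm
      ((Lp.fourierTransformₗᵢ E ℂ).symm _))) = _
    rw [LinearIsometryEquiv.apply_symm_apply, LinearIsometryEquiv.apply_symm_apply]
    rfl
  have h1 := Lp.coeFn_lpSMul (r := 2) ((fracLapWeight_memLp (E := E) hσ h).toLp
    (fracLapWeight E r t σ)) (𝓕 (Hs.bessel u) : L2Rn E)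
  filter_upwards [h1, (fracLapWeight_memLp (E := E) hσ h).coeFn_toLp] with ξ h1 h2
  simp only [Hs.fourierFun]
  rw [e, h1, Pi.smul_apply', h2, fracLapWeight, smul_eq_mul]
  have h3 : (1 + ‖ξ‖ ^ 2 : ℝ) ^ (-t / 2) * (1 + ‖ξ‖ ^ 2) ^ ((t - r) / 2) =
      (1 + ‖ξ‖ ^ 2) ^ (-r / 2) := by
    rw [← Real.rpow_add (by positivity)]
    ring_nf
  rw [← h3]
  push_cast
  ring

/-- On the level of tempered distributions, `𝓕 ((-Δ)^σ u) = |2πξ|^{2σ} 𝓕 u`. -/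
theorem fracLap_spec (hσ : 0 ≤ σ) (h : t + 2 * σ ≤ r) (u : Hs E r) (ψ : 𝓢(E, ℂ)) :
    (𝓕 (fracLap σ hσ h u).toDist) ψ =
      ∫ ξ, ψ ξ * ((((2 * Real.pi * ‖ξ‖) ^ (2 * σ) : ℝ) : ℂ) * u.fourierFun ξ) := by
  rw [Hs.fourier_toDist_apply]
  refine integral_congr_ae ?_
  filter_upwards [fracLap_fourierFun hσ h u] with ξ hξ
  rw [hξ]

/-- The inclusion `H^r(ℝⁿ) ⊂ H^t(ℝⁿ)`, `t ≤ r`, as a linear map. -/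
def Hs.embedLin (h : t ≤ r) : Hs E r →ₗ[ℂ] Hs E t where
  toFun u := Hs.ofDist u.toDist (u.memSobolev.mono h)
  map_add' u v := by
    apply Hs.toDist_injective
    rw [Hs.toDist_ofDist, LinearMap.map_add Hs.toDist, LinearMap.map_add Hs.toDist,
      Hs.toDist_ofDist, Hs.toDist_ofDist]
  map_smul' a u := by
    apply Hs.toDist_injective
    rw [Hs.toDist_ofDist, RingHom.id_apply, LinearMap.map_smul Hs.toDist,
      LinearMap.map_smul Hs.toDist, Hs.toDist_ofDist]

theorem Hs.toDist_embedLin (h : t ≤ r) (u : Hs E r) : (Hs.embedLin h u).toDist = u.toDist :=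
  Hs.toDist_ofDist _ _

theorem Hs.embedLin_eq (h : t ≤ r) (u : Hs E r) :
    Hs.embedLin h u = fracLap 0 le_rfl (by simpa using h) u := by
  apply Hs.toDist_injective
  rw [Hs.toDist_embedLin]
  apply (FourierTransform.fourierEquiv ℂ 𝓢'(E, ℂ)).injective
  change 𝓕 u.toDist = 𝓕 (fracLap 0 le_rfl _ u).toDist
  ext ψ
  rw [fracLap_spec, Hs.fourier_toDist_apply]
  simp

theorem Hs.continuous_embedLin (h : t ≤ r) : Continuous (Hs.embedLin h : Hs E r → Hs E t) := by
  rw [funext (Hs.embedLin_eq h)]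
  exact (fracLap 0 le_rfl (by simpa using h)).continuous

/-- The continuous embedding `H^r(ℝⁿ) ⊂ H^t(ℝⁿ)`, `t ≤ r`. -/
def Hs.embed (h : t ≤ r) : Hs E r →L[ℂ] Hs E t :=
  ⟨Hs.embedLin h, Hs.continuous_embedLin h⟩

theorem Hs.toDist_embed (h : t ≤ r) (u : Hs E r) : (Hs.embed h u).toDist = u.toDist :=
  Hs.toDist_embedLin h u

/-- The identification `H^0(ℝⁿ) = L²(ℝⁿ)`. -/
def Hs.toL2 (u : Hs E 0) : L2Rn E := Hs.bessel u

theorem Hs.toL2_spec (u : Hs E 0) : ((u.toL2 : L2Rn E) : 𝓢'(E, ℂ)) = u.toDist := by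
  rw [Hs.toL2, ← Hs.bessel_spec]; simp

theorem Hs.norm_toL2 (u : Hs E 0) : ‖u.toL2‖ = ‖u‖ := rfl

/-- The elements of `H^r(ℝⁿ)` given by functions in `C_c^∞(Ω)`. -/
def testSubmodule (Ω : Set E) (r : ℝ) : Submodule ℂ (Hs E r) where
  carrier := {u | ∃ φ : 𝓢(E, ℂ), HasCompactSupport φ ∧ tsupport φ ⊆ Ω ∧
    u.toDist = (φ : 𝓢'(E, ℂ))}
  add_mem' := by
    rintro u v ⟨φ, h1, h2, h3⟩ ⟨ψ, k1, k2, k3⟩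
    refine ⟨φ + ψ, h1.add k1, (tsupport_add (φ : E → ℂ) ψ).trans (union_subset h2 k2), ?_⟩
    rw [map_add, h3, k3, map_add]
  zero_mem' := ⟨0, HasCompactSupport.zero, by
    have : ((0 : 𝓢(E, ℂ)) : E → ℂ) = 0 := rfl
    rw [this, tsupport_zero]; exact empty_subset _, by simp⟩
  smul_mem' := by
    rintro a u ⟨φ, h1, h2, h3⟩
    refine ⟨a • φ, h1.smul_left (f := fun _ => a),
      (tsupport_smul_subset_right (fun _ => a) (φ : E → ℂ)).trans h2, ?_⟩
    rw [map_smul, h3, map_smul]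

/-- `H̃^r(Ω)`: the closure of `C_c^∞(Ω)` in `H^r(ℝⁿ)`. In particular `L̃²(Ω) = H̃^0(Ω)`. -/
def Htilde (Ω : Set E) (r : ℝ) : Submodule ℂ (Hs E r) :=
  (testSubmodule Ω r).topologicalClosure

instance (Ω : Set E) : CompleteSpace (Htilde Ω r) :=
  (Submodule.isClosed_topologicalClosure _).completeSpace_coe

theorem embed_mem_Htilde {Ω : Set E} (h : t ≤ r) (u : Htilde Ω r) :
    Hs.embed h (u : Hs E r) ∈ Htilde Ω t := by
  refine map_mem_closure (Hs.embed h).continuous u.2 ?_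
  rintro v ⟨φ, h1, h2, h3⟩
  exact ⟨φ, h1, h2, (Hs.toDist_embed h v).trans h3⟩

/-- The embedding `H̃^r(Ω) ⊂ L̃²(Ω)`, `r ≥ 0`. -/
def Htilde.embed {Ω : Set E} (h : 0 ≤ r) : Htilde Ω r →L[ℂ] Htilde Ω 0 :=
  ((Hs.embed h) ∘L (Htilde Ω r).subtypeL).codRestrict _ (embed_mem_Htilde h)

/-- The elements `U ∈ H^r(ℝⁿ)` with `U|_Ω = 0` as a distribution on `Ω`. -/
def vanishingOn (Ω : Set E) (r : ℝ) : Submodule ℂ (Hs E r) where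
  carrier := {u | ∀ φ : 𝓢(E, ℂ), HasCompactSupport φ → tsupport φ ⊆ Ω → u.pair φ = 0}
  add_mem' := by
    intro u v hu hv φ h1 h2
    have : (u + v).pair φ = u.pair φ + v.pair φ := by simp [Hs.pair]
    rw [this, hu φ h1 h2, hv φ h1 h2, add_zero]
  zero_mem' := by intro φ _ _; simp [Hs.pair]
  smul_mem' := by
    intro a u hu φ h1 h2
    have : (a • u).pair φ = a • u.pair φ := by simp [Hs.pair]
    rw [this, hu φ h1 h2, smul_zero]

instance (Ω : Set E) : IsClosed (vanishingOn Ω r : Set (Hs E r)) := by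
  have : (vanishingOn Ω r : Set (Hs E r)) = ⋂ φ : 𝓢(E, ℂ), ⋂ (_ : HasCompactSupport φ),
      ⋂ (_ : tsupport φ ⊆ Ω), {u | u.pair φ = 0} := by
    ext u; simp [vanishingOn]
  rw [this]
  exact isClosed_iInter fun φ => isClosed_iInter fun _ => isClosed_iInter fun _ =>
    isClosed_eq (Hs.continuous_pair φ) continuous_const

/-- `H^r(Ω) = {U|_Ω ; U ∈ H^r(ℝⁿ)}` with the quotient norm: `H^r(ℝⁿ)` modulo the elements whose
restriction to `Ω` vanishes. -/
abbrev HsOn (Ω : Set E) (r : ℝ) : Type _ := Hs E r ⧸ vanishingOn Ω r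

/-- The map `H̃^s(Ω) → H^{-s}(Ω)`, `u ↦ u|_Ω`, for `s ≥ 0`. -/
def restrictNeg {Ω : Set E} {s : ℝ} (hs : 0 ≤ s) (u : Htilde Ω s) : HsOn Ω (-s) :=
  (vanishingOn Ω (-s)).mkQ (Hs.embed (by linarith) (u : Hs E s))

end SobolevSpaces

section TimeDependent

variable {X : Type*} [NormedAddCommGroup X] [NormedSpace ℝ X]

/-- Lebesgue measure on the time interval `(0,T)`. -/
abbrev timeMeasure (T : ℝ) : Measure ℝ := volume.restrict (Ioo 0 T)

/-- `v` is the distributional derivative `∂_t u ∈ 𝓓'((0,T); X)` of `u`, both locally integrable. -/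
def HasTimeDeriv (T : ℝ) (u v : ℝ → X) : Prop :=
  LocallyIntegrableOn u (Ioo 0 T) ∧ LocallyIntegrableOn v (Ioo 0 T) ∧
  ∀ η : ℝ → ℝ, ContDiff ℝ ∞ η → HasCompactSupport η → tsupport η ⊆ Ioo 0 T →
    ∫ t in Ioo 0 T, deriv η t • u t = - ∫ t in Ioo 0 T, η t • v t

open Classical in
/-- The distributional time derivative `∂_t u`, when it is a (locally integrable) function; it is
unique up to equality almost everywhere. -/
def timeDeriv (T : ℝ) (u : ℝ → X) : ℝ → X :=
  if h : ∃ v, HasTimeDeriv T u v then h.choose else 0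

/-- `u ∈ W^{k,p}(0,T;X)`. -/
def MemW (T : ℝ) : ℕ → ℝ≥0∞ → (ℝ → X) → Prop
  | 0, p, u => MemLp u p (timeMeasure T)
  | k + 1, p, u => MemLp u p (timeMeasure T) ∧ ∃ v, HasTimeDeriv T u v ∧ MemW T k p v

/-- `u(0) = a` for the continuous representative of `u` on `[0,T]`. -/
def HasInitialValue (T : ℝ) (u : ℝ → X) (a : X) : Prop :=
  ∃ w : ℝ → X, ContinuousOn w (Icc 0 T) ∧ w =ᵐ[timeMeasure T] u ∧ w 0 = a

end TimeDependent

section WeakSolutions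

variable {E : Type*} [NormedAddCommGroup E] [InnerProductSpace ℝ E] [FiniteDimensional ℝ E]
  [MeasurableSpace E] [BorelSpace E]

/-- The test functions `C_c^∞(Ω × [0,T))`, as restrictions to times `t ≥ 0` of smooth functions on
`ℝ × ℝⁿ` with compact support in `(-∞,T) × Ω`. -/
structure TestFun (Ω : Set E) (T : ℝ) where
  toFun : ℝ × E → ℂ
  smooth : ContDiff ℝ ∞ toFun
  compact : HasCompactSupport toFun
  supp : tsupport toFun ⊆ Iio T ×ˢ Ω

namespace TestFun

variable {Ω : Set E} {T : ℝ}

/-- The time derivative `∂_t φ` of a test function. -/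
def dt (φ : TestFun Ω T) : TestFun Ω T where
  toFun := fun z => fderiv ℝ φ.toFun z (1, 0)
  smooth := (φ.smooth.fderiv_right (m := ∞) (by simp)).clm_apply contDiff_const
  compact := φ.compact.fderiv_apply ℝ (1, 0)
  supp := (tsupport_fderiv_apply_subset ℝ (1, 0)).trans φ.supp

/-- `φ(t) ∈ C_c^∞(Ω)`, regarded as a Schwartz function. -/
def slice (φ : TestFun Ω T) (t : ℝ) : 𝓢(E, ℂ) :=
  HasCompactSupport.toSchwartzMap (f := fun x => φ.toFun (t, x))
    (by
      have hc : IsCompact (Prod.snd '' tsupport φ.toFun) := φ.compact.image continuous_snd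
      refine HasCompactSupport.intro hc fun x hx => ?_
      by_contra h
      exact hx ⟨(t, x), subset_tsupport _ h, rfl⟩)
    (φ.smooth.comp (by fun_prop))

end TestFun

/-- `u ∈ W^{1,∞}(0,T;H̃^s(Ω)) ∩ W^{2,∞}(0,T;L̃²(Ω))` is a weak solution of
`(∂_t³ + α∂_t² + b(-Δ)^s∂_t + c(-Δ)^s + q)u = F` in `Ω × (0,T)`, `u = 0` outside `Ω`,
`u(0) = u₀`, `∂_t u(0) = u₁`, `∂_t² u(0) = u₂`. -/
structure IsWeakSolution (Ω : Set E) (T : ℝ) {s : ℝ} (hs : 0 < s) (α b c : ℝ)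
    {p : ℝ≥0∞} [Fact (1 ≤ p)] (q : ℝ → Lp ℝ p (volume.restrict Ω))
    (u₀ u₁ : Htilde Ω s) (u₂ : Htilde Ω 0) (F : ℝ → Htilde Ω 0) (u : ℝ → Htilde Ω s) : Prop where
  memW_one : MemW T 1 ∞ u
  memW_two : MemW T 2 ∞ (fun t => Htilde.embed hs.le (u t))
  initial_zero : HasInitialValue T u u₀
  initial_one : HasInitialValue T (timeDeriv T (fun t => Htilde.embed hs.le (u t)))
    (Htilde.embed hs.le u₁)
  /-- `-∫_{Ω_T} ∂_t²u ∂_tφ + ∫_0^T ⟨(α∂_t² + b(-Δ)^s∂_t + c(-Δ)^s + q)u, φ⟩ dt`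
  `= ∫_0^T ⟨F, φ⟩ dt + ∫_Ω u₂ φ(0)` -/
  weak : ∀ φ : TestFun Ω T,
    - (∫ t in Ioo 0 T,
        ((timeDeriv T (timeDeriv T fun τ => Htilde.embed hs.le (u τ)) t : Htilde Ω 0) : Hs E 0).pair
          (φ.dt.slice t))
    + (α * (∫ t in Ioo 0 T,
        ((timeDeriv T (timeDeriv T fun τ => Htilde.embed hs.le (u τ)) t : Htilde Ω 0) : Hs E 0).pair (φ.slice t))
      + b * (∫ t in Ioo 0 T,
          (fracLap s hs.le (t := -s) (by linarith) ((timeDeriv T u t : Htilde Ω s) : Hs E s)).pair (φ.slice t))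
      + c * (∫ t in Ioo 0 T,
          (fracLap s hs.le (t := -s) (by linarith) (u t : Hs E s)).pair (φ.slice t))
      + ∫ t in Ioo 0 T, ∫ x in Ω,
          ((q t x : ℝ) : ℂ) * (Htilde.embed hs.le (u t) : Hs E 0).toL2 x * φ.toFun (t, x))
    = (∫ t in Ioo 0 T, (F t : Hs E 0).pair (φ.slice t)) + (u₂ : Hs E 0).pair (φ.slice 0)

/-- `(-Δ)^{s/2} u ∈ H^0(ℝⁿ) = L²(ℝⁿ)` for `u ∈ H̃^s(Ω)`. For bounded `Ω` its `L²` norm is the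
norm `‖u‖_{H̃^s(Ω)}`. -/
def halfLap {Ω : Set E} {s : ℝ} (hs : 0 < s) (u : Htilde Ω s) : Hs E 0 :=
  fracLap (s / 2) (by positivity) (by linarith) (u : Hs E s)

end WeakSolutions

end MGT

end

/-!
# Well-posedness of the nonlocal Moore-Gibson-Thompson equation

Write `A = (-Δ)^s`, `V = H̃^s(Ω)` with the energy inner product `⟨(-Δ)^{s/2} u, (-Δ)^{s/2} v⟩`, and
`H = L̃²(Ω)`. As `Ω` is bounded, the fractional Poincaré inequality (`exists_norm_le_halfLap`)
makes the energy norm equivalent to that of `H^s(ℝⁿ)`, so that `V` is a Hilbert space with a dense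
injective embedding `J : V → H`, whose adjoint `J†` is the inverse of `A`. Applying `J†` to the
equation gives an identity between functions with values in `V`, free of unbounded operators
(`IsEnergySolution`).

The function `w = u' + (c/b) u` satisfies the wave equation
`w'' + b A w = F - q u - (α - c/b) u''`, coupled to the ordinary differential equation
`u' = w - (c/b) u`. For the state `(u, √b w, w')` this is a first-order system, whose unbounded part
is the skew-adjoint generator of the wave equation and whose remaining part is bounded
(`lowerOrder`). The generator enters only through its bounded inverse (`waveInv`), from which the
group of isometries is obtained by regularisation (`exists_group_of_skewAdjoint`). The Duhamel
formula turns the system into a Volterra equation. Picard iteration and Gronwall's inequality give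
existence, with a bound that depends on `q` only through the norm of its multiplication operator
(`exists_energySolution`), and uniqueness
(`IsEnergySolution.ae_unique`).

Multiplication by `q ∈ L^p(Ω)` is a bounded operator from `V` to `H`, by Hölder's inequality and
the Sobolev embedding `H^s(ℝⁿ) ⊂ L^r(Ω)` with `1/r = 1/2 - 1/p` (`exists_potentialOperator`). This
is where the conditions on `p` are used. The embedding itself is proved by splitting frequencies
(`exists_frequency_split`, `measure_lt_norm_le`).

The weak formulation, tested with `φ`, is an identity in the energy space tested with the conjugate
of `φ` (`weak_iff`). Energy solutions are therefore weak solutions by integration by parts in time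
(`IsEnergySolution.isWeakSolution`). Conversely, test functions `η(t) ψ(x)`, the density of
`C_c^∞(Ω)` in `V` and the lemma of du Bois-Reymond show that weak solutions are energy solutions
(`IsWeakSolution.isEnergySolution`), which transfers uniqueness. Finally, `u ∈ H³(0,T;H^{-s}(Ω))`
because `(-Δ)^s`, followed by restriction to `Ω`, undoes `J†`
(`IsEnergyEquiv.restrictFracLap_symm_adjoint`).
-/

noncomputable section

namespace MGT

open Filter Topology
open scoped InnerProduct

/-! ### Integration by parts and the lemma of du Bois-Reymond -/

section TimeCalculus

variable {X Z G : Type*} [NormedAddCommGroup X] [NormedSpace ℝ X] [CompleteSpace X]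
  [NormedAddCommGroup Z] [NormedSpace ℝ Z] [CompleteSpace Z]
  [NormedAddCommGroup G] [NormedSpace ℝ G] [CompleteSpace G]

/-- Fubini's theorem on the two triangles that make up the square `(a, b]²`. -/
theorem setIntegral_bilin_primitive (B : X →L[ℝ] Z →L[ℝ] G) {f : ℝ → X} {g : ℝ → Z} {a b : ℝ}
    (hf : IntegrableOn f (Ioc a b)) (hg : IntegrableOn g (Ioc a b)) :
    (∫ τ in Ioc a b, B (f τ) (∫ σ in Ioc a τ, g σ)) +
      ∫ τ in Ioc a b, B (∫ σ in Ioc a τ, f σ) (g τ) =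
      B (∫ τ in Ioc a b, f τ) (∫ τ in Ioc a b, g τ) := by
  set μ : Measure ℝ := volume.restrict (Ioc a b) with hμ
  have hF : Integrable (fun z : ℝ × ℝ => B (f z.1) (g z.2)) (μ.prod μ) :=
    hf.op_fst_snd (by fun_prop) ⟨‖B‖, B.le_opNorm₂⟩ hg
  have hS : MeasurableSet {z : ℝ × ℝ | z.2 ≤ z.1} := measurableSet_le measurable_snd measurable_fst
  rw [← integral_prod_bilin B hf hg, ← integral_add_compl hS hF]
  congr 1
  · rw [← integral_indicator hS, integral_prod _ (hF.indicator hS)]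
    refine setIntegral_congr_fun measurableSet_Ioc fun τ hτ => ?_
    have e1 : (fun y => {z : ℝ × ℝ | z.2 ≤ z.1}.indicator (fun z : ℝ × ℝ => B (f z.1) (g z.2))
        (τ, y)) = (Iic τ).indicator (fun y => B (f τ) (g y)) := by
      ext y; simp [indicator]
    rw [e1, integral_indicator measurableSet_Iic, hμ, Measure.restrict_restrict measurableSet_Iic]
    have e2 : Iic τ ∩ Ioc a b = Ioc a τ := by
      ext y; simp only [mem_inter_iff, mem_Iic, mem_Ioc]
      exact ⟨fun h => ⟨h.2.1, h.1⟩, fun h => ⟨h.2, h.1, h.2.trans hτ.2⟩⟩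
    rw [e2]
    exact ((B (f τ)).integral_comp_comm (hg.mono_set (Ioc_subset_Ioc_right hτ.2))).symm
  · rw [← integral_indicator hS.compl, integral_prod_symm _ (hF.indicator hS.compl)]
    refine setIntegral_congr_fun measurableSet_Ioc fun τ hτ => ?_
    have e1 : (fun x => {z : ℝ × ℝ | z.2 ≤ z.1}ᶜ.indicator (fun z : ℝ × ℝ => B (f z.1) (g z.2))
        (x, τ)) = (Iio τ).indicator (fun x => B (f x) (g τ)) := by
      ext y; simp [indicator]
    rw [e1, integral_indicator measurableSet_Iio, hμ, Measure.restrict_restrict measurableSet_Iio]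
    have e2 : Iio τ ∩ Ioc a b = Ioo a τ := by
      ext y; simp only [mem_inter_iff, mem_Iio, mem_Ioc, mem_Ioo]
      exact ⟨fun h => ⟨h.2.1, h.1⟩, fun h => ⟨h.2, h.1, h.2.le.trans hτ.2⟩⟩
    rw [e2, ← integral_Ioc_eq_integral_Ioo]
    exact ((B.flip (g τ)).integral_comp_comm (hf.mono_set (Ioc_subset_Ioc_right hτ.2))).symm

/-- Integration by parts for primitives of integrable functions. -/
theorem integral_bilin_eq_sub (B : X →L[ℝ] Z →L[ℝ] G) {p p' : ℝ → X} {r r' : ℝ → Z} {a b : ℝ}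
    (hab : a ≤ b) (hp' : IntegrableOn p' (Ioc a b)) (hr' : IntegrableOn r' (Ioc a b))
    (hp : ∀ t ∈ Icc a b, p t = p a + ∫ τ in a..t, p' τ)
    (hr : ∀ t ∈ Icc a b, r t = r a + ∫ τ in a..t, r' τ) :
    (∫ τ in Ioc a b, (B (p' τ) (r τ) + B (p τ) (r' τ))) = B (p b) (r b) - B (p a) (r a) := by
  have cp : ContinuousOn (fun t => ∫ τ in Ioc a t, p' τ) (Icc a b) :=
    intervalIntegral.continuousOn_primitive (by rwa [integrableOn_Icc_iff_integrableOn_Ioc])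
  have cr : ContinuousOn (fun t => ∫ τ in Ioc a t, r' τ) (Icc a b) :=
    intervalIntegral.continuousOn_primitive (by rwa [integrableOn_Icc_iff_integrableOn_Ioc])
  have ip : ∀ y : ℝ → Z, ContinuousOn y (Icc a b) →
      IntegrableOn (fun τ => B (p' τ) (y τ)) (Ioc a b) := by
    intro y hy
    obtain ⟨C, hC⟩ := isCompact_Icc.exists_bound_of_continuousOn hy
    refine Integrable.mono' (hp'.norm.const_mul (‖B‖ * C)) ?_ ?_
    · exact (ContinuousLinearMap.aestronglyMeasurable_comp₂ B hp'.aestronglyMeasurable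
        ((hy.mono Ioc_subset_Icc_self).aestronglyMeasurable measurableSet_Ioc))
    · filter_upwards [ae_restrict_mem measurableSet_Ioc] with τ hτ
      calc _ ≤ ‖B‖ * ‖p' τ‖ * ‖y τ‖ := B.le_opNorm₂ _ _
        _ ≤ ‖B‖ * ‖p' τ‖ * C := by gcongr; exact hC _ (Ioc_subset_Icc_self hτ)
        _ = _ := by ring
  have ir : ∀ y : ℝ → X, ContinuousOn y (Icc a b) →
      IntegrableOn (fun τ => B (y τ) (r' τ)) (Ioc a b) := by
    intro y hy
    obtain ⟨C, hC⟩ := isCompact_Icc.exists_bound_of_continuousOn hy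
    refine Integrable.mono' (hr'.norm.const_mul (‖B‖ * C)) ?_ ?_
    · exact (ContinuousLinearMap.aestronglyMeasurable_comp₂ B
        ((hy.mono Ioc_subset_Icc_self).aestronglyMeasurable measurableSet_Ioc)
        hr'.aestronglyMeasurable)
    · filter_upwards [ae_restrict_mem measurableSet_Ioc] with τ hτ
      calc _ ≤ ‖B‖ * ‖y τ‖ * ‖r' τ‖ := B.le_opNorm₂ _ _
        _ ≤ ‖B‖ * C * ‖r' τ‖ := by gcongr; exact hC _ (Ioc_subset_Icc_self hτ)
  have key := setIntegral_bilin_primitive B hp' hr'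
  have e : ∀ τ ∈ Ioc a b, B (p' τ) (r τ) + B (p τ) (r' τ) =
      (B (p' τ) (∫ σ in Ioc a τ, r' σ) + B (∫ σ in Ioc a τ, p' σ) (r' τ)) +
      (B.flip (r a) (p' τ) + B (p a) (r' τ)) := by
    intro τ hτ
    rw [hp τ (Ioc_subset_Icc_self hτ), hr τ (Ioc_subset_Icc_self hτ),
      intervalIntegral.integral_of_le hτ.1.le, intervalIntegral.integral_of_le hτ.1.le]
    simp only [map_add, add_apply, ContinuousLinearMap.flip_apply]
    abel
  rw [setIntegral_congr_fun measurableSet_Ioc e, integral_add, integral_add (ip _ cr) (ir _ cp),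
    key, integral_add, ContinuousLinearMap.integral_comp_comm _ hp',
    ContinuousLinearMap.integral_comp_comm _ hr', hp b (right_mem_Icc.mpr hab),
    hr b (right_mem_Icc.mpr hab), intervalIntegral.integral_of_le hab,
    intervalIntegral.integral_of_le hab]
  · simp only [map_add, add_apply, ContinuousLinearMap.flip_apply]
    abel
  · exact ContinuousLinearMap.integrable_comp _ hp'
  · exact ContinuousLinearMap.integrable_comp _ hr'
  · exact (ip _ cr).add (ir _ cp)
  · exact (ContinuousLinearMap.integrable_comp _ hp').add
      (ContinuousLinearMap.integrable_comp _ hr')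

/-- A smooth function of mean zero with compact support in `(a, b)` is the derivative of another
one. -/
theorem exists_primitive_of_integral_eq_zero {a b : ℝ} {g : ℝ → ℝ}
    (hg : ContDiff ℝ ∞ g) (hc : HasCompactSupport g) (hs : tsupport g ⊆ Ioo a b)
    (h0 : ∫ t, g t = 0) :
    ∃ η : ℝ → ℝ, ContDiff ℝ ∞ η ∧ HasCompactSupport η ∧ tsupport η ⊆ Ioo a b ∧ deriv η = g := by
  rcases (tsupport g).eq_empty_or_nonempty with he | hne
  · refine ⟨0, contDiff_const, HasCompactSupport.zero, by simp, ?_⟩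
    rw [tsupport_eq_empty_iff] at he
    rw [he]; ext; simp
  obtain ⟨m, hm, hm'⟩ := hc.exists_isMinOn hne continuousOn_id
  obtain ⟨M, hM, hM'⟩ := hc.exists_isMaxOn hne continuousOn_id
  have hsupp : tsupport g ⊆ Icc m M := fun x hx => ⟨hm' hx, hM' hx⟩
  have hi : Integrable g := hg.continuous.integrable_of_hasCompactSupport hc
  have hz : ∀ x, x ∉ Icc m M → g x = 0 := fun x hx =>
    image_eq_zero_of_notMem_tsupport fun h => hx (hsupp h)
  have hd : ∀ t, HasDerivAt (fun t => ∫ τ in m..t, g τ) (g t) t := fun t =>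
    intervalIntegral.integral_hasDerivAt_right hi.intervalIntegrable
      hg.continuous.stronglyMeasurable.stronglyMeasurableAtFilter hg.continuous.continuousAt
  have hη : ∀ t, t ∉ Icc m M → ∫ τ in m..t, g τ = 0 := by
    intro t ht
    rcases lt_or_ge t m with h | h
    · rw [intervalIntegral.integral_symm, intervalIntegral.integral_of_le h.le,
        integral_Ioc_eq_integral_Ioo,
        setIntegral_congr_fun (g := fun _ => (0 : ℝ)) measurableSet_Ioo, integral_zero, neg_zero]
      exact fun x hx => hz _ fun h' => absurd h'.1 (not_le.mpr hx.2)
    · have hMt : M < t := by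
        by_contra hcon; exact ht ⟨h, not_lt.mp hcon⟩
      rw [← h0, intervalIntegral.integral_of_le h, ← integral_Icc_eq_integral_Ioc]
      refine setIntegral_eq_integral_of_forall_compl_eq_zero fun x hx => hz x fun h' => hx ?_
      exact ⟨h'.1, h'.2.trans hMt.le⟩
  have hcl : tsupport (fun t => ∫ τ in m..t, g τ) ⊆ Icc m M :=
    closure_minimal (fun t ht => by_contra fun h => ht (hη t h)) isClosed_Icc
  refine ⟨fun t => ∫ τ in m..t, g τ, ?_, ?_, ?_, ?_⟩
  · rw [contDiff_infty_iff_deriv]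
    refine ⟨fun t => (hd t).differentiableAt, ?_⟩
    rwa [funext fun t => (hd t).deriv]
  · exact HasCompactSupport.of_support_subset_isCompact isCompact_Icc
      ((subset_tsupport _).trans hcl)
  · exact hcl.trans (Icc_subset_Ioo (hs hm).1 (hs hM).2)
  · exact funext fun t => (hd t).deriv

/-- The lemma of du Bois-Reymond: a function with zero distributional derivative is constant. -/
theorem ae_eq_const_of_integral_deriv_smul_eq_zero {a b : ℝ} (hab : a < b) {f : ℝ → X}
    (hf : LocallyIntegrableOn f (Ioo a b))
    (h : ∀ η : ℝ → ℝ, ContDiff ℝ ∞ η → HasCompactSupport η → tsupport η ⊆ Ioo a b →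
      ∫ t in Ioo a b, deriv η t • f t = 0) :
    ∃ c : X, ∀ᵐ t ∂(volume.restrict (Ioo a b)), f t = c := by
  have hset : ∀ (g : ℝ → ℝ) (y : ℝ → X), tsupport g ⊆ Ioo a b →
      ∫ t in Ioo a b, g t • y t = ∫ t, g t • y t := fun g y hg =>
    setIntegral_eq_integral_of_forall_compl_eq_zero fun x hx => by
      rw [image_eq_zero_of_notMem_tsupport fun h' => hx (hg h'), zero_smul]
  have hint : ∀ (g : ℝ → ℝ) (y : ℝ → X), LocallyIntegrableOn y (Ioo a b) → Continuous g →
      HasCompactSupport g → tsupport g ⊆ Ioo a b → Integrable (fun t => g t • y t) := by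
    intro g y hy hgc hcs hg
    have h1 : IntegrableOn y (tsupport g) := hy.integrableOn_compact_subset hg hcs
    have h2 : IntegrableOn (fun t => g t • y t) (tsupport g) :=
      h1.continuousOn_smul hgc.continuousOn hcs
    refine h2.integrable_of_forall_notMem_eq_zero fun x hx => ?_
    rw [image_eq_zero_of_notMem_tsupport hx, zero_smul]
  let bump : ContDiffBump ((a + b) / 2) := ⟨(b - a) / 8, (b - a) / 4, by linarith, by linarith⟩
  set θ : ℝ → ℝ := bump.normed volume with hθ
  have hθs : ContDiff ℝ ∞ θ := bump.contDiff_normed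
  have hθc : HasCompactSupport θ := bump.hasCompactSupport_normed
  have hθt : tsupport θ ⊆ Ioo a b := by
    rw [hθ, bump.tsupport_normed_eq, Real.closedBall_eq_Icc]
    apply Icc_subset_Ioo <;> simp [bump] <;> linarith
  have hθ1 : ∫ t, θ t = 1 := bump.integral_normed
  refine ⟨∫ t, θ t • f t, ?_⟩
  have key := isOpen_Ioo.ae_eq_zero_of_integral_contDiff_smul_eq_zero (U := Ioo a b)
    (μ := volume) (f := fun t => f t - ∫ τ, θ τ • f τ)
    (hf.sub ((locallyIntegrable_const _).locallyIntegrableOn _)) ?_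
  · rw [ae_restrict_iff' measurableSet_Ioo]
    filter_upwards [key] with t ht h'
    exact sub_eq_zero.mp (ht h')
  intro g hg hgc hgs
  have hgi : Integrable g := hg.continuous.integrable_of_hasCompactSupport hgc
  have hθi : Integrable θ := hθs.continuous.integrable_of_hasCompactSupport hθc
  -- `g - (∫ g) θ` has mean zero, so it is the derivative of an admissible test function.
  set I := ∫ t, g t with hI
  have hsub : tsupport (fun t => g t - I * θ t) ⊆ Ioo a b := by
    refine (tsupport_sub (g : ℝ → ℝ) (fun t => I * θ t)).trans (union_subset hgs ?_)
    exact (tsupport_mul_subset_right (f := fun _ => I) (g := θ)).trans hθt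
  obtain ⟨η, h1, h2, h3, h4⟩ := exists_primitive_of_integral_eq_zero (a := a) (b := b)
    (g := fun t => g t - I * θ t) (hg.sub (contDiff_const.mul hθs))
    (hgc.sub (hθc.mul_left (f := fun _ => I))) hsub
    (by rw [integral_sub hgi (hθi.const_mul I), integral_const_mul, hθ1, mul_one, sub_self])
  have h5 := h η h1 h2 h3
  rw [h4, hset _ _ hsub] at h5
  have i1 := hint g f hf hg.continuous hgc hgs
  have i2 := hint θ f hf hθs.continuous hθc hθt
  simp only [sub_smul, mul_smul] at h5
  rw [integral_sub i1 (g := fun t => I • θ t • f t) (i2.smul I), integral_smul] at h5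
  simp only [smul_sub]
  rw [integral_sub i1 (hgi.smul_const _), integral_smul_const]
  exact h5

end TimeCalculus

/-! ### Distributional derivatives in time, and Volterra equations -/

section TimeDerivatives

variable {X Z : Type*} [NormedAddCommGroup X] [NormedSpace ℝ X]
  [NormedAddCommGroup Z] [NormedSpace ℝ Z] {T : ℝ}

theorem integrableOn_cutoff_smul {u : ℝ → X} (hu : LocallyIntegrableOn u (Ioo 0 T))
    {η : ℝ → ℝ} (hη : Continuous η) (hc : HasCompactSupport η) (hs : tsupport η ⊆ Ioo 0 T) :
    IntegrableOn (fun t => η t • u t) (Ioo 0 T) := by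
  have h1 : IntegrableOn u (tsupport η) := hu.integrableOn_compact_subset hs hc
  have h2 : IntegrableOn (fun t => η t • u t) (tsupport η) :=
    h1.continuousOn_smul hη.continuousOn hc
  refine (h2.integrable_of_forall_notMem_eq_zero fun x hx => ?_).integrableOn
  rw [image_eq_zero_of_notMem_tsupport hx, zero_smul]

theorem HasTimeDeriv.ae_unique [CompleteSpace X] {u v v' : ℝ → X} (h : HasTimeDeriv T u v)
    (h' : HasTimeDeriv T u v') : v =ᵐ[timeMeasure T] v' := by
  have key := isOpen_Ioo.ae_eq_zero_of_integral_contDiff_smul_eq_zero (U := Ioo 0 T)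
    (μ := volume) (f := fun t => v t - v' t) (h.2.1.sub h'.2.1) ?_
  · rw [EventuallyEq, ae_restrict_iff' measurableSet_Ioo]
    filter_upwards [key] with t ht h'
    exact sub_eq_zero.mp (ht h')
  intro η h1 h2 h3
  have e1 := h.2.2 η h1 h2 h3
  have e2 := h'.2.2 η h1 h2 h3
  have : ∫ t in Ioo 0 T, η t • (v t - v' t) = ∫ t, η t • (v t - v' t) :=
    setIntegral_eq_integral_of_forall_compl_eq_zero fun x hx => by
      rw [image_eq_zero_of_notMem_tsupport fun h' => hx (h3 h'), zero_smul]
  rw [← this]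
  simp only [smul_sub]
  rw [integral_sub (integrableOn_cutoff_smul h.2.1 h1.continuous h2 h3)
    (integrableOn_cutoff_smul h'.2.1 h1.continuous h2 h3), ← neg_inj, ← sub_eq_zero]
  rw [e1, neg_inj] at e2
  rw [e2]; simp

theorem HasTimeDeriv.timeDeriv_ae_eq [CompleteSpace X] {u v : ℝ → X} (h : HasTimeDeriv T u v) :
    timeDeriv T u =ᵐ[timeMeasure T] v := by
  have hex : ∃ v, HasTimeDeriv T u v := ⟨v, h⟩
  have : timeDeriv T u = hex.choose := by rw [timeDeriv, dif_pos hex]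
  rw [this]
  exact hex.choose_spec.ae_unique h

theorem HasTimeDeriv.hasTimeDeriv_timeDeriv {u v : ℝ → X} (h : HasTimeDeriv T u v) :
    HasTimeDeriv T u (timeDeriv T u) := by
  have hex : ∃ v, HasTimeDeriv T u v := ⟨v, h⟩
  have : timeDeriv T u = hex.choose := by rw [timeDeriv, dif_pos hex]
  rw [this]
  exact hex.choose_spec

theorem locallyIntegrableOn_congr {Y : Type*} [NormedAddCommGroup Y] {u u' : ℝ → Y}
    (h : u =ᵐ[timeMeasure T] u') (hu : LocallyIntegrableOn u (Ioo 0 T)) :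
    LocallyIntegrableOn u' (Ioo 0 T) := by
  rw [locallyIntegrableOn_iff (isOpen_Ioo.isLocallyClosed)] at hu ⊢
  intro k hk hkc
  exact (hu k hk hkc).congr (ae_restrict_of_ae_restrict_of_subset hk h)

theorem HasTimeDeriv.congr {u u' v v' : ℝ → X} (h : HasTimeDeriv T u v)
    (hu : u =ᵐ[timeMeasure T] u') (hv : v =ᵐ[timeMeasure T] v') : HasTimeDeriv T u' v' := by
  refine ⟨locallyIntegrableOn_congr hu h.1, locallyIntegrableOn_congr hv h.2.1, ?_⟩
  intro η h1 h2 h3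
  have e1 : ∫ t in Ioo 0 T, deriv η t • u' t = ∫ t in Ioo 0 T, deriv η t • u t :=
    integral_congr_ae (by filter_upwards [hu] with t ht; rw [ht])
  have e2 : ∫ t in Ioo 0 T, η t • v' t = ∫ t in Ioo 0 T, η t • v t :=
    integral_congr_ae (by filter_upwards [hv] with t ht; rw [ht])
  rw [e1, e2, h.2.2 η h1 h2 h3]

theorem HasTimeDeriv.clm [CompleteSpace X] [CompleteSpace Z] {u v : ℝ → X}
    (h : HasTimeDeriv T u v) (L : X →L[ℝ] Z) :
    HasTimeDeriv T (fun t => L (u t)) (fun t => L (v t)) := by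
  have hl : ∀ u : ℝ → X, LocallyIntegrableOn u (Ioo 0 T) →
      LocallyIntegrableOn (fun t => L (u t)) (Ioo 0 T) := fun u hu t ht => by
    obtain ⟨s, hs, hi⟩ := hu t ht
    exact ⟨s, hs, L.integrable_comp hi⟩
  refine ⟨hl u h.1, hl v h.2.1, fun η h1 h2 h3 => ?_⟩
  have hd : tsupport (deriv η) ⊆ Ioo 0 T := (tsupport_deriv_subset).trans h3
  have e1 := L.integral_comp_comm
    (integrableOn_cutoff_smul h.1 (h1.continuous_deriv (by simp)) h2.deriv hd)
  have e2 := L.integral_comp_comm (integrableOn_cutoff_smul h.2.1 h1.continuous h2 h3)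
  simp only [map_smul] at e1 e2
  rw [e1, e2, h.2.2 η h1 h2 h3, map_neg]

theorem integrableOn_Ioo_iff_Ioc {Y : Type*} [NormedAddCommGroup Y] {u : ℝ → Y} :
    IntegrableOn u (Ioo 0 T) ↔ IntegrableOn u (Ioc 0 T) :=
  (integrableOn_Ioc_iff_integrableOn_Ioo).symm

/-- Integration by parts against a smooth scalar function. -/
theorem integral_deriv_smul_primitive [CompleteSpace X] {T : ℝ} (hT : 0 ≤ T) {v : ℝ → X}
    (hv : IntegrableOn v (Ioo 0 T)) (a : X) {η : ℝ → ℝ} (hη : ContDiff ℝ ∞ η) :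
    ∫ t in Ioo 0 T, deriv η t • (a + ∫ τ in 0..t, v τ) =
      η T • (a + ∫ τ in 0..T, v τ) - η 0 • a - ∫ t in Ioo 0 T, η t • v t := by
  have hd : Continuous (deriv η) := hη.continuous_deriv (by simp)
  have hv' : IntegrableOn v (Ioc 0 T) := integrableOn_Ioo_iff_Ioc.mp hv
  have cu : ContinuousOn (fun t => a + ∫ τ in 0..t, v τ) (Icc 0 T) := by
    refine continuousOn_const.add ?_
    have := intervalIntegral.continuousOn_primitive_interval (a := 0) (b := T) (f := v)
      (μ := volume) (by rwa [uIcc_of_le hT, integrableOn_Icc_iff_integrableOn_Ioc])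
    rwa [uIcc_of_le hT] at this
  have key := integral_bilin_eq_sub (ContinuousLinearMap.lsmul ℝ ℝ : ℝ →L[ℝ] X →L[ℝ] X)
    (p := η) (p' := deriv η) (r := fun t => a + ∫ τ in 0..t, v τ) (r' := v) hT
    (hd.integrableOn_Icc.mono_set Ioc_subset_Icc_self) hv' (fun t _ => by
      rw [intervalIntegral.integral_deriv_eq_sub
        (fun x _ => (hη.differentiable (by simp)).differentiableAt)
        (hd.intervalIntegrable _ _)]
      ring) (fun t _ => by simp)
  simp only [ContinuousLinearMap.lsmul_apply, intervalIntegral.integral_same, add_zero] at key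
  rw [integral_add] at key
  · rw [← integral_Ioc_eq_integral_Ioo, ← integral_Ioc_eq_integral_Ioo, ← key]; abel
  · exact ((hd.continuousOn.smul cu).integrableOn_Icc).mono_set Ioc_subset_Icc_self
  · have : IntegrableOn v (Icc 0 T) := by rwa [integrableOn_Icc_iff_integrableOn_Ioc]
    exact (this.continuousOn_smul hη.continuous.continuousOn isCompact_Icc).mono_set
      Ioc_subset_Icc_self

theorem continuousOn_add_primitive {T : ℝ} (hT : 0 ≤ T) {v : ℝ → X}
    (hv : IntegrableOn v (Ioo 0 T)) (a : X) :
    ContinuousOn (fun t => a + ∫ τ in 0..t, v τ) (Icc 0 T) := by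
  refine continuousOn_const.add ?_
  have := intervalIntegral.continuousOn_primitive_interval (a := 0) (b := T) (f := v)
    (μ := volume) (by
      rwa [uIcc_of_le hT, integrableOn_Icc_iff_integrableOn_Ioc, ← integrableOn_Ioo_iff_Ioc])
  rwa [uIcc_of_le hT] at this

theorem hasTimeDeriv_primitive [CompleteSpace X] {T : ℝ} (hT : 0 ≤ T) {u v : ℝ → X}
    (hv : IntegrableOn v (Ioo 0 T)) (a : X)
    (hu : ∀ t ∈ Ioo 0 T, u t = a + ∫ τ in 0..t, v τ) : HasTimeDeriv T u v := by
  have e : (fun t => a + ∫ τ in 0..t, v τ) =ᵐ[timeMeasure T] u := by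
    filter_upwards [ae_restrict_mem measurableSet_Ioo] with t ht using (hu t ht).symm
  refine HasTimeDeriv.congr (u := fun t => a + ∫ τ in 0..t, v τ) (v := v) ?_ e EventuallyEq.rfl
  refine ⟨?_, hv.locallyIntegrableOn, fun η h1 h2 h3 => ?_⟩
  · exact ((continuousOn_add_primitive hT hv a).mono Ioo_subset_Icc_self).locallyIntegrableOn
      measurableSet_Ioo
  · have h0 : η 0 = 0 := image_eq_zero_of_notMem_tsupport fun h => lt_irrefl _ (h3 h).1
    have h0' : η T = 0 := image_eq_zero_of_notMem_tsupport fun h => lt_irrefl _ (h3 h).2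
    rw [integral_deriv_smul_primitive hT hv a h1, h0, h0']
    simp

theorem HasTimeDeriv.exists_eq_primitive [CompleteSpace X] {T : ℝ} (hT : 0 < T) {u v : ℝ → X}
    (h : HasTimeDeriv T u v) (hv : IntegrableOn v (Ioo 0 T)) :
    ∃ a : X, u =ᵐ[timeMeasure T] fun t => a + ∫ τ in 0..t, v τ := by
  have h' : HasTimeDeriv T (fun t => 0 + ∫ τ in 0..t, v τ) v :=
    hasTimeDeriv_primitive hT.le hv 0 fun t _ => rfl
  obtain ⟨a, ha⟩ := ae_eq_const_of_integral_deriv_smul_eq_zero hT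
    (f := fun t => u t - (0 + ∫ τ in 0..t, v τ)) (h.1.sub h'.1) fun η h1 h2 h3 => by
      have hd : tsupport (deriv η) ⊆ Ioo 0 T := (tsupport_deriv_subset).trans h3
      have hc : Continuous (deriv η) := h1.continuous_deriv (by simp)
      simp only [smul_sub]
      rw [integral_sub (integrableOn_cutoff_smul h.1 hc h2.deriv hd)
        (integrableOn_cutoff_smul h'.1 hc h2.deriv hd), h.2.2 η h1 h2 h3,
        h'.2.2 η h1 h2 h3, sub_self]
  refine ⟨a, ?_⟩
  filter_upwards [ha] with t ht
  rw [← ht]; abel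

theorem eqOn_of_ae_eq_of_continuousOn {T : ℝ} (hT : 0 < T) {Y : Type*}
    [NormedAddCommGroup Y] {u v : ℝ → Y} (hu : ContinuousOn u (Icc 0 T))
    (hv : ContinuousOn v (Icc 0 T)) (h : u =ᵐ[timeMeasure T] v) : EqOn u v (Icc 0 T) := by
  refine MeasureTheory.Measure.eqOn_Icc_of_ae_eq volume hT.ne ?_ hu hv
  exact (restrict_Ioo_eq_restrict_Icc (μ := (volume : Measure ℝ)) ▸ h)

theorem HasTimeDeriv.eq_primitive_of_hasInitialValue [CompleteSpace X] {T : ℝ} (hT : 0 < T)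
    {u v : ℝ → X} (h : HasTimeDeriv T u v) (hv : IntegrableOn v (Ioo 0 T)) {a : X}
    (ha : HasInitialValue T u a) : u =ᵐ[timeMeasure T] fun t => a + ∫ τ in 0..t, v τ := by
  obtain ⟨a', ha'⟩ := h.exists_eq_primitive hT hv
  obtain ⟨w, hw, hwu, rfl⟩ := ha
  have := eqOn_of_ae_eq_of_continuousOn hT hw (continuousOn_add_primitive hT.le hv a')
    (hwu.trans ha') (left_mem_Icc.mpr hT.le)
  simp only [intervalIntegral.integral_same, add_zero] at this
  rwa [this]

/-- A function whose distributional derivative on `(-∞, T)`, after extension by zero to negative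
times, is the integrable function `-s`, is a primitive of `-s` that vanishes at time zero. -/
theorem ae_eq_neg_primitive_of_integral_deriv_smul [CompleteSpace X] {T : ℝ} (hT : 0 < T)
    {z s : ℝ → X} (hz : IntegrableOn z (Ioo 0 T)) (hs : IntegrableOn s (Ioo 0 T))
    (h : ∀ η : ℝ → ℝ, ContDiff ℝ ∞ η → HasCompactSupport η → tsupport η ⊆ Iio T →
      ∫ t in Ioo 0 T, deriv η t • z t = ∫ t in Ioo 0 T, η t • s t) :
    z =ᵐ[timeMeasure T] fun t => - ∫ τ in 0..t, s τ := by
  set P : ℝ → X := fun t => 0 + ∫ τ in 0..t, s τ with hP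
  have hPi : IntegrableOn P (Ioo 0 T) :=
    (continuousOn_add_primitive hT.le hs 0).integrableOn_Icc.mono_set Ioo_subset_Icc_self
  have hsub : Ioo 0 T ⊆ Ioo (-1) T := Ioo_subset_Ioo_left (by norm_num)
  have hF : Integrable ((Ioo 0 T).indicator fun t => z t + P t) :=
    (integrable_indicator_iff measurableSet_Ioo).mpr (hz.add hPi)
  obtain ⟨c, hc⟩ := ae_eq_const_of_integral_deriv_smul_eq_zero (a := -1) (b := T) (by linarith)
    (f := (Ioo 0 T).indicator fun t => z t + P t)
    (hF.integrableOn.locallyIntegrableOn) fun η h1 h2 h3 => by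
      have hd : Continuous (deriv η) := h1.continuous_deriv (by simp)
      have e : (fun t => deriv η t • (Ioo 0 T).indicator (fun t => z t + P t) t) =
          (Ioo 0 T).indicator (fun t => deriv η t • z t + deriv η t • P t) := by
        ext t; by_cases ht : t ∈ Ioo 0 T <;> simp [ht]
      have hη : η T = 0 := image_eq_zero_of_notMem_tsupport fun h => lt_irrefl _ (h3 h).2
      have hi : ∀ y : ℝ → X, IntegrableOn y (Ioo 0 T) →
          IntegrableOn (fun t => deriv η t • y t) (Ioo 0 T) := fun y hy => by
        have : IntegrableOn y (Icc 0 T) := by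
          rwa [integrableOn_Icc_iff_integrableOn_Ioo]
        exact (this.continuousOn_smul hd.continuousOn isCompact_Icc).mono_set Ioo_subset_Icc_self
      rw [e, setIntegral_indicator measurableSet_Ioo, inter_eq_right.mpr hsub,
        integral_add (hi z hz) (hi P hPi), h η h1 h2 (h3.trans fun x hx => hx.2),
        integral_deriv_smul_primitive hT.le hs 0 h1, hη]
      simp
  -- The extension by zero vanishes on `(-1, 0)`, which forces the constant to be zero.
  have hc0 : c = 0 := by
    have h1 : ∀ᵐ t ∂(volume.restrict (Ioo (-1 : ℝ) 0)),
        (Ioo 0 T).indicator (fun t => z t + P t) t = c :=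
      ae_restrict_of_ae_restrict_of_subset (Ioo_subset_Ioo_right hT.le) hc
    have h2 : ∀ᵐ t ∂(volume.restrict (Ioo (-1 : ℝ) 0)), (0 : X) = c := by
      filter_upwards [h1, ae_restrict_mem measurableSet_Ioo] with t ht ht'
      rwa [indicator_of_notMem fun h => absurd h.1 (not_lt.mpr ht'.2.le)] at ht
    have h3 : volume.restrict (Ioo (-1 : ℝ) 0) ≠ 0 := by
      rw [Ne, Measure.restrict_eq_zero]; simp
    have : (ae (volume.restrict (Ioo (-1 : ℝ) 0))).NeBot := ae_neBot.mpr h3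
    obtain ⟨t, ht⟩ := h2.exists
    exact ht.symm
  have h1 := ae_restrict_of_ae_restrict_of_subset hsub hc
  filter_upwards [h1, ae_restrict_mem measurableSet_Ioo] with t ht ht'
  rw [indicator_of_mem ht', hc0, hP] at ht
  simp only [zero_add] at ht
  exact eq_neg_of_add_eq_zero_left ht

end TimeDerivatives

section Volterra

/-- Gronwall's inequality in integral form. -/
theorem le_mul_exp_of_le_add_integral {φ : ℝ → ℝ} (hφ : Continuous φ) {a β T : ℝ} (hβ : 0 ≤ β)
    (h : ∀ t ∈ Icc 0 T, φ t ≤ a + β * ∫ τ in 0..t, φ τ) :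
    ∀ t ∈ Icc 0 T, φ t ≤ a * Real.exp (β * t) := by
  intro t ht
  have hd : ∀ t, HasDerivAt (fun t => a + β * ∫ τ in 0..t, φ τ) (β * φ t) t := fun t =>
    ((intervalIntegral.integral_hasDerivAt_right (hφ.intervalIntegrable _ _)
      hφ.stronglyMeasurable.stronglyMeasurableAtFilter hφ.continuousAt).const_mul β).const_add a
  have key := le_gronwallBound_of_liminf_deriv_right_le (a := 0) (b := T)
    (f := fun t => a + β * ∫ τ in 0..t, φ τ) (f' := fun t => β * φ t) (δ := a) (K := β) (ε := 0)
    (fun t _ => (hd t).continuousAt.continuousWithinAt)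
    (fun x _ r hr => (hd x).hasDerivWithinAt.liminf_right_slope_le hr)
    (by simp) (fun x hx => by
      have := h x ⟨hx.1, hx.2.le⟩
      simpa using mul_le_mul_of_nonneg_left this hβ) t ht
  rw [sub_zero, gronwallBound_ε0] at key
  exact (h t ht).trans key

/-- The homogeneous Gronwall inequality for functions which are merely integrable: it is applied
to the continuous function `t ↦ ∫₀ᵗ ‖m‖`. -/
theorem ae_eq_zero_of_norm_le_integral {Y : Type*} [NormedAddCommGroup Y] {m : ℝ → Y} {β T : ℝ}
    (hβ : 0 ≤ β) (hm : IntegrableOn m (Ioo 0 T))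
    (h : ∀ᵐ t ∂(timeMeasure T), ‖m t‖ ≤ β * ∫ τ in 0..t, ‖m τ‖) : m =ᵐ[timeMeasure T] 0 := by
  set k : ℝ → ℝ := (Ioo 0 T).indicator fun t => ‖m t‖ with hk
  have hki : Integrable k := (integrable_indicator_iff measurableSet_Ioo).mpr hm.norm
  have hkm : ∀ t ∈ Icc 0 T, ∫ τ in 0..t, ‖m τ‖ = ∫ τ in 0..t, k τ := by
    intro t ht
    rw [intervalIntegral.integral_of_le ht.1, intervalIntegral.integral_of_le ht.1,
      integral_Ioc_eq_integral_Ioo, integral_Ioc_eq_integral_Ioo]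
    refine setIntegral_congr_fun measurableSet_Ioo fun x hx => ?_
    rw [hk, indicator_of_mem (show x ∈ Ioo 0 T from ⟨hx.1, hx.2.trans_le ht.2⟩)]
  have hc : Continuous fun t => ∫ τ in 0..t, k τ :=
    intervalIntegral.continuous_primitive (fun _ _ => hki.intervalIntegrable) 0
  have key := le_mul_exp_of_le_add_integral hc (a := 0) (T := T) hβ fun t ht => by
    rw [zero_add, ← intervalIntegral.integral_const_mul, intervalIntegral.integral_of_le ht.1,
      intervalIntegral.integral_of_le ht.1, integral_Ioc_eq_integral_Ioo,
      integral_Ioc_eq_integral_Ioo]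
    refine setIntegral_mono_ae_restrict hki.integrableOn
      ((hc.const_mul β).integrableOn_Icc.mono_set Ioo_subset_Icc_self) ?_
    have hsub : Ioo 0 t ⊆ Ioo 0 T := Ioo_subset_Ioo_right ht.2
    filter_upwards [ae_restrict_of_ae_restrict_of_subset hsub h,
      ae_restrict_mem measurableSet_Ioo] with x hx hx'
    rw [hk, indicator_of_mem (hsub hx')]
    rwa [hkm x ⟨hx'.1.le, (hsub hx').2.le⟩] at hx
  filter_upwards [h, ae_restrict_mem measurableSet_Ioo] with t ht ht'
  rw [hkm t ⟨ht'.1.le, ht'.2.le⟩] at ht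
  have h1 := key t ⟨ht'.1.le, ht'.2.le⟩
  rw [zero_mul] at h1
  exact norm_le_zero_iff.mp (ht.trans (mul_nonpos_of_nonneg_of_nonpos hβ h1))

variable {Y : Type*} [NormedAddCommGroup Y] [NormedSpace ℝ Y]

theorem integrableOn_clm_apply {N : ℝ → Y →L[ℝ] Y} {β T : ℝ}
    (hN : ∀ ζ : ℝ → Y, Continuous ζ → AEStronglyMeasurable (fun τ => N τ (ζ τ)) (timeMeasure T))
    (hβ : ∀ᵐ τ ∂(timeMeasure T), ‖N τ‖ ≤ β) {ζ : ℝ → Y} (hζ : Continuous ζ) :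
    IntegrableOn (fun τ => N τ (ζ τ)) (Ioo 0 T) := by
  refine Integrable.mono' ((hζ.norm.const_mul β).integrableOn_Icc.mono_set Ioo_subset_Icc_self)
    (hN ζ hζ) ?_
  filter_upwards [hβ] with τ hτ
  exact (N τ).le_of_opNorm_le hτ _

/-- Solvability of the linear integral equation `ζ(t) = ζ₀ + ∫₀ᵗ (N(τ) ζ(τ) + f(τ)) dτ`. In the
weighted unknown `e^{-λt} ζ(t)`, `λ = 2β + 1`, the integral operator is a contraction. -/
theorem exists_volterra_solution [CompleteSpace Y] {N : ℝ → Y →L[ℝ] Y} {f : ℝ → Y} {β T : ℝ}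
    (hT : 0 ≤ T) (hβ0 : 0 ≤ β)
    (hN : ∀ ζ : ℝ → Y, Continuous ζ → AEStronglyMeasurable (fun τ => N τ (ζ τ)) (timeMeasure T))
    (hβ : ∀ᵐ τ ∂(timeMeasure T), ‖N τ‖ ≤ β) (hf : IntegrableOn f (Ioo 0 T)) (ζ₀ : Y) :
    ∃ ζ : ℝ → Y, Continuous ζ ∧
      (∀ t ∈ Icc 0 T, ζ t = ζ₀ + ∫ τ in 0..t, (N τ (ζ τ) + f τ)) ∧
      ∀ t ∈ Icc 0 T, ‖ζ t‖ ≤ (‖ζ₀‖ + ∫ τ in Ioo 0 T, ‖f τ‖) * Real.exp (β * T) := by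
  set l : ℝ := 2 * β + 1 with hl
  have hl0 : 0 < l := by linarith
  let ex : C(Icc 0 T, Y) → ℝ → Y := fun ξ τ => Real.exp (l * τ) • ξ (projIcc 0 T hT τ)
  have hex : ∀ ξ, Continuous (ex ξ) := fun ξ => by
    refine Continuous.smul (by fun_prop) (ξ.continuous.comp continuous_projIcc)
  have hint : ∀ ξ, IntegrableOn (fun τ => N τ (ex ξ τ) + f τ) (Ioo 0 T) := fun ξ =>
    (integrableOn_clm_apply hN hβ (hex ξ)).add hf
  let Φ : C(Icc 0 T, Y) → C(Icc 0 T, Y) := fun ξ =>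
    ⟨(Icc 0 T).domRestrict fun t => Real.exp (-(l * t)) •
      (ζ₀ + ∫ τ in 0..t, (N τ (ex ξ τ) + f τ)), by
      rw [← continuousOn_iff_continuous_domRestrict]
      exact ContinuousOn.smul (by fun_prop) (continuousOn_add_primitive hT (hint ξ) ζ₀)⟩
  have hΦ : ∀ ξ (t : Icc 0 T), Φ ξ t = Real.exp (-(l * t)) •
      (ζ₀ + ∫ τ in 0..(t : ℝ), (N τ (ex ξ τ) + f τ)) := fun ξ t => rfl
  have hcontr : ContractingWith (1 / 2) Φ := by
    refine ⟨by norm_num, LipschitzWith.of_dist_le_mul fun ξ ξ' => ?_⟩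
    rw [ContinuousMap.dist_le (by positivity)]
    rintro ⟨t, ht⟩
    rw [dist_eq_norm, hΦ, hΦ, ← smul_sub, norm_smul, Real.norm_eq_abs, abs_of_pos (Real.exp_pos _)]
    have hii : ∀ ξ, IntervalIntegrable (fun τ => N τ (ex ξ τ) + f τ) volume 0 t := fun ξ => by
      rw [intervalIntegrable_iff_integrableOn_Ioo_of_le ht.1]
      exact (hint ξ).mono_set (Ioo_subset_Ioo_right ht.2)
    rw [add_sub_add_left_eq_sub, ← intervalIntegral.integral_sub (hii ξ) (hii ξ')]
    have hb : ‖∫ τ in 0..t, (N τ (ex ξ τ) + f τ - (N τ (ex ξ' τ) + f τ))‖ ≤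
        ∫ τ in 0..t, β * (Real.exp (l * τ) * dist ξ ξ') := by
      refine intervalIntegral.norm_integral_le_of_norm_le ht.1 ?_
        (Continuous.intervalIntegrable (by fun_prop) _ _)
      rw [← ae_restrict_iff' measurableSet_Ioc, Measure.restrict_congr_set Ioo_ae_eq_Ioc.symm]
      filter_upwards [ae_restrict_of_ae_restrict_of_subset (Ioo_subset_Ioo_right ht.2) hβ]
        with τ hτ
      rw [add_sub_add_right_eq_sub, ← map_sub]
      refine ((N τ).le_of_opNorm_le hτ _).trans ?_
      gcongr
      simp only [ex]
      rw [← smul_sub, norm_smul, Real.norm_eq_abs, abs_of_pos (Real.exp_pos _), ← dist_eq_norm]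
      gcongr
      exact ContinuousMap.dist_apply_le_dist _
    have hI : ∫ τ in 0..t, β * (Real.exp (l * τ) * dist ξ ξ') =
        β * dist ξ ξ' * ((Real.exp (l * t) - 1) / l) := by
      have : ∫ τ in 0..t, Real.exp (l * τ) = (Real.exp (l * t) - 1) / l := by
        rw [intervalIntegral.integral_comp_mul_left (fun x => Real.exp x) hl0.ne', integral_exp]
        simp [div_eq_inv_mul]
      rw [intervalIntegral.integral_const_mul, intervalIntegral.integral_mul_const, this]; ring
    rw [hI] at hb
    have h1 : Real.exp (-(l * t)) * Real.exp (l * t) = 1 := by rw [← Real.exp_add]; simp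
    have hle : β / l ≤ 1 / 2 := by rw [div_le_div_iff₀ hl0 two_pos]; linarith
    calc Real.exp (-(l * t)) * _ ≤ Real.exp (-(l * t)) *
          (β * dist ξ ξ' * ((Real.exp (l * t) - 1) / l)) := by gcongr
      _ = β / l * dist ξ ξ' * (1 - Real.exp (-(l * t))) := by
          linear_combination (β / l * dist ξ ξ') * h1
      _ ≤ 1 / 2 * dist ξ ξ' * 1 := by
          gcongr
          · linarith [Real.exp_le_one_iff.mpr (show -(l * t) ≤ 0 by
              have := mul_nonneg hl0.le ht.1; linarith)]
          · linarith [Real.exp_pos (-(l * t))]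
      _ = _ := by norm_num
  set ξ := hcontr.fixedPoint with hξ
  have hfix : Φ ξ = ξ := hcontr.fixedPoint_isFixedPt
  have heq : ∀ t ∈ Icc 0 T, ex ξ t = ζ₀ + ∫ τ in 0..t, (N τ (ex ξ τ) + f τ) := by
    intro t ht
    have h1 : ξ ⟨t, ht⟩ = Real.exp (-(l * t)) •
        (ζ₀ + ∫ τ in 0..t, (N τ (ex ξ τ) + f τ)) := by
      conv_lhs => rw [← hfix]
      exact hΦ ξ ⟨t, ht⟩
    have h2 : ex ξ t = Real.exp (l * t) • ξ ⟨t, ht⟩ := by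
      simp only [ex]; rw [projIcc_of_mem hT ht]
    rw [h2, h1, smul_smul, ← Real.exp_add]; simp
  refine ⟨ex ξ, hex ξ, heq, fun t ht => ?_⟩
  have key := le_mul_exp_of_le_add_integral (hex ξ).norm
    (a := ‖ζ₀‖ + ∫ τ in Ioo 0 T, ‖f τ‖) (T := T) hβ0 (fun t ht => ?_) t ht
  · refine key.trans ?_
    have : 0 ≤ ∫ τ in Ioo 0 T, ‖f τ‖ := integral_nonneg fun _ => norm_nonneg _
    gcongr
    exact ht.2
  · have hsub : Ioo 0 t ⊆ Ioo 0 T := Ioo_subset_Ioo_right ht.2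
    have hfn : IntegrableOn (fun τ => ‖f τ‖) (Ioo 0 T) := hf.norm
    have i1 : IntegrableOn (fun τ => β * ‖ex ξ τ‖) (Ioo 0 t) :=
      ((hex ξ).norm.const_mul β).integrableOn_Icc.mono_set Ioo_subset_Icc_self
    rw [heq t ht, intervalIntegral.integral_of_le ht.1, integral_Ioc_eq_integral_Ioo,
      intervalIntegral.integral_of_le ht.1, integral_Ioc_eq_integral_Ioo]
    calc _ ≤ ‖ζ₀‖ + ‖∫ τ in Ioo 0 t, (N τ (ex ξ τ) + f τ)‖ := norm_add_le _ _
      _ ≤ ‖ζ₀‖ + ∫ τ in Ioo 0 t, (β * ‖ex ξ τ‖ + ‖f τ‖) := by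
          gcongr
          refine norm_integral_le_of_norm_le (i1.add (hfn.mono_set hsub)) ?_
          filter_upwards [ae_restrict_of_ae_restrict_of_subset hsub hβ] with τ hτ
          exact (norm_add_le _ _).trans (add_le_add ((N τ).le_of_opNorm_le hτ _) le_rfl)
      _ = ‖ζ₀‖ + (∫ τ in Ioo 0 t, ‖f τ‖) + β * ∫ τ in Ioo 0 t, ‖ex ξ τ‖ := by
          rw [integral_add i1 (hfn.mono_set hsub), integral_const_mul]; ring
      _ ≤ _ := by
          have : ∫ τ in Ioo 0 t, ‖f τ‖ ≤ ∫ τ in Ioo 0 T, ‖f τ‖ :=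
            setIntegral_mono_set hf.norm (Eventually.of_forall fun _ => norm_nonneg _)
              hsub.eventuallyLE
          gcongr

end Volterra

/-! ### The unitary group generated by the inverse of a bounded skew-adjoint operator -/

section UnitaryGroup

/-- Uniformly bounded operators that converge to zero on a dense range converge to zero
everywhere. -/
theorem tendsto_zero_of_denseRange {ι X Z Y : Type*} [NormedAddCommGroup X] [NormedSpace ℂ X]
    [NormedAddCommGroup Z] [NormedSpace ℂ Z] {l : Filter ι} {S : ι → X →L[ℂ] Z} {C : ℝ}
    (hS : ∀ n, ‖S n‖ ≤ C) {D : Y → X} (hD : DenseRange D)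
    (h : ∀ y, Tendsto (fun n => S n (D y)) l (𝓝 0)) (x : X) :
    Tendsto (fun n => S n x) l (𝓝 0) := by
  rcases l.eq_or_neBot with rfl | hl
  · exact tendsto_bot
  have hC : 0 ≤ C := (norm_nonneg _).trans (hS (hl.nonempty_of_mem univ_mem).some)
  rw [Metric.tendsto_nhds]
  intro ε hε
  obtain ⟨y, hy⟩ := hD.exists_dist_lt x (show 0 < ε / (2 * (C + 1)) by positivity)
  have := Metric.tendsto_nhds.mp (h y) (ε / 2) (by positivity)
  filter_upwards [this] with n hn
  rw [dist_zero_right] at hn ⊢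
  calc ‖S n x‖ = ‖S n (x - D y) + S n (D y)‖ := by rw [← map_add, sub_add_cancel]
    _ ≤ ‖S n (x - D y)‖ + ‖S n (D y)‖ := norm_add_le _ _
    _ < ε / 2 + ε / 2 := by
        refine add_lt_add_of_le_of_lt ?_ hn
        calc ‖S n (x - D y)‖ ≤ (C + 1) * ‖x - D y‖ :=
              (S n).le_of_opNorm_le ((hS n).trans (by linarith)) _
          _ ≤ (C + 1) * (ε / (2 * (C + 1))) := by
              rw [dist_eq_norm] at hy; gcongr
          _ = ε / 2 := by field_simp
    _ = ε := by ring

variable {X : Type*} [NormedAddCommGroup X] [InnerProductSpace ℂ X] [CompleteSpace X]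

theorem exp_smul_mem_unitary {S : X →L[ℂ] X} (hS : S ∈ skewAdjoint (X →L[ℂ] X)) (t : ℝ) :
    NormedSpace.exp (t • S) ∈ unitary (X →L[ℂ] X) := by
  let +nondep : NormedAlgebra ℚ (X →L[ℂ] X) := .restrictScalars ℚ ℝ (X →L[ℂ] X)
  exact NormedSpace.exp_mem_unitary_of_mem_skewAdjoint (skewAdjoint.smul_mem t hS)

theorem hasDerivAt_exp_smul_apply (S : X →L[ℂ] X) (x : X) (t : ℝ) :
    HasDerivAt (fun t : ℝ => NormedSpace.exp (t • S) x) (NormedSpace.exp (t • S) (S x)) t := by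
  have h1 := hasDerivAt_exp_smul_const S t
  have h2 := ((ContinuousLinearMap.apply ℂ X x).restrictScalars ℝ).hasFDerivAt.comp_hasDerivAt t h1
  exact h2

theorem norm_exp_smul_apply_sub_le {S : X →L[ℂ] X} (hS : S ∈ skewAdjoint (X →L[ℂ] X))
    (x : X) (s t : ℝ) :
    ‖NormedSpace.exp (t • S) x - NormedSpace.exp (s • S) x‖ ≤ ‖S x‖ * ‖t - s‖ := by
  refine Convex.norm_image_sub_le_of_norm_hasDerivWithin_le (s := univ)
    (f := fun t : ℝ => NormedSpace.exp (t • S) x)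
    (f' := fun t : ℝ => NormedSpace.exp (t • S) (S x))
    (fun t _ => (hasDerivAt_exp_smul_apply S x t).hasDerivWithinAt) (fun t _ => ?_) convex_univ
    (mem_univ s) (mem_univ t)
  rw [ContinuousLinearMap.norm_map_of_mem_unitary (exp_smul_mem_unitary hS t)]

/-- For commuting skew-adjoint generators, `e^{tS} - e^{tS'} = e^{tS'} (e^{t(S - S')} - 1)` with
`e^{tS'}` unitary. -/
theorem norm_exp_smul_sub_exp_smul_le {S S' : X →L[ℂ] X} (hS : S ∈ skewAdjoint (X →L[ℂ] X))
    (hS' : S' ∈ skewAdjoint (X →L[ℂ] X)) (hc : Commute S S') (x : X) (t : ℝ) :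
    ‖NormedSpace.exp (t • S) x - NormedSpace.exp (t • S') x‖ ≤ ‖(S - S') x‖ * |t| := by
  let +nondep : NormedAlgebra ℚ (X →L[ℂ] X) := .restrictScalars ℚ ℝ (X →L[ℂ] X)
  have h0 : S - S' ∈ skewAdjoint (X →L[ℂ] X) := sub_mem hS hS'
  have e : NormedSpace.exp (t • S) = NormedSpace.exp (t • S') * NormedSpace.exp (t • (S - S')) := by
    rw [← NormedSpace.exp_add_of_commute, ← smul_add, add_sub_cancel]
    exact ((hc.symm.sub_right (Commute.refl S')).smul_left t).smul_right t
  have h1 := norm_exp_smul_apply_sub_le h0 x 0 t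
  rw [e, mul_apply_eq_comp, ← map_sub,
    ContinuousLinearMap.norm_map_of_mem_unitary (exp_smul_mem_unitary hS' t)]
  simpa using h1

/-- The bounded regularisation `-i A (A² + (n+1)⁻¹)⁻¹` of `-i A⁻¹`. -/
def regInv (A : X →L[ℂ] X) (n : ℕ) : X →L[ℂ] X :=
  (-Complex.I) • cfc (fun a : ℝ => a / (a ^ 2 + 1 / ((n : ℝ) + 1))) A

theorem continuous_regInv_symbol (n : ℕ) :
    Continuous fun a : ℝ => a / (a ^ 2 + 1 / ((n : ℝ) + 1)) := by
  refine continuous_id.div (by fun_prop) fun a => ?_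
  have : (0 : ℝ) < 1 / ((n : ℝ) + 1) := by positivity
  positivity

theorem regInv_mem_skewAdjoint (A : X →L[ℂ] X) (n : ℕ) :
    regInv A n ∈ skewAdjoint (X →L[ℂ] X) := by
  have : IsSelfAdjoint (cfc (fun a : ℝ => a / (a ^ 2 + 1 / ((n : ℝ) + 1))) A) := cfc_predicate _ _
  rw [skewAdjoint.mem_iff, regInv, star_smul, this.star_eq]
  simp

theorem commute_regInv (A : X →L[ℂ] X) (n m : ℕ) : Commute (regInv A n) (regInv A m) :=
  ((cfc_commute_cfc _ _ A).smul_left _).smul_right _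

theorem regInv_mul (A : X →L[ℂ] X) (hA : IsSelfAdjoint A) (n : ℕ) (k : ℕ) :
    regInv A n * A ^ k =
      (-Complex.I) • cfc (fun a : ℝ => a / (a ^ 2 + 1 / ((n : ℝ) + 1)) * a ^ k) A := by
  rw [regInv, smul_mul_assoc, cfc_mul _ _ A (continuous_regInv_symbol n).continuousOn
    (by fun_prop), cfc_pow_id A k]

theorem commute_regInv_self (A : X →L[ℂ] X) (hA : IsSelfAdjoint A) (n : ℕ) :
    Commute (regInv A n) A := by
  have h := cfc_commute_cfc (fun a : ℝ => a / (a ^ 2 + 1 / ((n : ℝ) + 1))) (id : ℝ → ℝ) A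
  rw [cfc_id ℝ A] at h
  exact h.smul_left _

theorem norm_regInv_mul_le (A : X →L[ℂ] X) (hA : IsSelfAdjoint A) (n : ℕ) :
    ‖regInv A n * A‖ ≤ 1 := by
  have h := regInv_mul A hA n 1
  rw [pow_one] at h
  rw [h, norm_smul, norm_neg, Complex.norm_I, one_mul]
  refine norm_cfc_le zero_le_one fun a _ => ?_
  have hn : (0 : ℝ) < 1 / ((n : ℝ) + 1) := by positivity
  have : a / (a ^ 2 + 1 / ((n : ℝ) + 1)) * a ^ 1 = a ^ 2 / (a ^ 2 + 1 / ((n : ℝ) + 1)) := by ring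
  rw [this, Real.norm_eq_abs, abs_of_nonneg (by positivity), div_le_one (by positivity)]
  linarith

/-- On the range of `A³` the regularisations converge in norm: the difference of the symbols `a⁴
/ (a² + ε)` is bounded by the difference of the `ε`, uniformly in `a`. -/
theorem norm_regInv_sub_mul_le (A : X →L[ℂ] X) (hA : IsSelfAdjoint A) (n m : ℕ) :
    ‖(regInv A n - regInv A m) * A ^ 3‖ ≤ |1 / ((m : ℝ) + 1) - 1 / ((n : ℝ) + 1)| := by
  have c1 : Continuous fun a : ℝ => a / (a ^ 2 + 1 / ((n : ℝ) + 1)) * a ^ 3 :=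
    (continuous_regInv_symbol n).mul (by fun_prop)
  have c2 : Continuous fun a : ℝ => a / (a ^ 2 + 1 / ((m : ℝ) + 1)) * a ^ 3 :=
    (continuous_regInv_symbol m).mul (by fun_prop)
  rw [sub_mul, regInv_mul A hA, regInv_mul A hA, ← smul_sub, norm_smul, norm_neg, Complex.norm_I,
    one_mul, ← cfc_sub _ _ A c1.continuousOn c2.continuousOn]
  refine norm_cfc_le (abs_nonneg _) fun a _ => ?_
  have hn : (0 : ℝ) < 1 / ((n : ℝ) + 1) := by positivity
  have hm : (0 : ℝ) < 1 / ((m : ℝ) + 1) := by positivity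
  generalize 1 / ((n : ℝ) + 1) = e at *
  generalize 1 / ((m : ℝ) + 1) = d at *
  have e1 : a / (a ^ 2 + e) * a ^ 3 - a / (a ^ 2 + d) * a ^ 3 =
      (d - e) * (a ^ 2 / (a ^ 2 + e) * (a ^ 2 / (a ^ 2 + d))) := by
    have h1 : a ^ 2 + e ≠ 0 := by positivity
    have h2 : a ^ 2 + d ≠ 0 := by positivity
    field_simp
    ring
  have l1 : a ^ 2 / (a ^ 2 + e) ≤ 1 := by rw [div_le_one (by positivity)]; linarith
  have l2 : a ^ 2 / (a ^ 2 + d) ≤ 1 := by rw [div_le_one (by positivity)]; linarith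
  have l3 : 0 ≤ a ^ 2 / (a ^ 2 + e) := by positivity
  have l4 : 0 ≤ a ^ 2 / (a ^ 2 + d) := by positivity
  rw [e1, Real.norm_eq_abs, abs_mul]
  refine mul_le_of_le_one_right (abs_nonneg _) ?_
  rw [abs_of_nonneg (mul_nonneg l3 l4)]
  exact mul_le_one₀ l1 l4 l2

theorem norm_regInv_mul_sub_one_mul_le (A : X →L[ℂ] X) (hA : IsSelfAdjoint A) (n : ℕ) :
    ‖Complex.I • (regInv A n * A ^ 3) - A ^ 2‖ ≤ 1 / ((n : ℝ) + 1) := by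
  have c1 : Continuous fun a : ℝ => a / (a ^ 2 + 1 / ((n : ℝ) + 1)) * a ^ 3 :=
    (continuous_regInv_symbol n).mul (by fun_prop)
  have hn : (0 : ℝ) < 1 / ((n : ℝ) + 1) := by positivity
  rw [regInv_mul A hA, smul_smul, mul_neg, Complex.I_mul_I, neg_neg, one_smul,
    ← cfc_pow_id (R := ℝ) A 2, ← cfc_sub _ _ A c1.continuousOn (by fun_prop)]
  refine norm_cfc_le hn.le fun a _ => ?_
  generalize 1 / ((n : ℝ) + 1) = e at *
  have e1 : a / (a ^ 2 + e) * a ^ 3 - a ^ 2 = -(e * (a ^ 2 / (a ^ 2 + e))) := by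
    have h1 : a ^ 2 + e ≠ 0 := by positivity
    field_simp
    ring
  have l1 : a ^ 2 / (a ^ 2 + e) ≤ 1 := by rw [div_le_one (by positivity)]; linarith
  rw [e1, norm_neg, Real.norm_eq_abs, abs_of_nonneg (by positivity)]
  exact mul_le_of_le_one_right hn.le l1

/-- Stone's theorem for the inverse of a bounded operator: an injective skew-adjoint operator `K`
with dense range has an inverse that generates a strongly continuous group of isometries. The group
is the limit of the groups generated by bounded skew-adjoint regularisations of `K⁻¹`; on the range
of `K³` the convergence is locally uniform in time. The generator is described by
`d/dt U(t) K x = U(t) x`. -/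
theorem exists_group_of_skewAdjoint {K : X →L[ℂ] X} (hK : K ∈ skewAdjoint (X →L[ℂ] X))
    (hr : DenseRange K) :
    ∃ U : ℝ → X →L[ℂ] X, (∀ t x, ‖U t x‖ = ‖x‖) ∧ (U 0 = 1) ∧
      (∀ s t x, U (s + t) x = U s (U t x)) ∧ (∀ x, Continuous fun t => U t x) ∧
      (∀ t x, U t (K x) = K (U t x)) ∧
      ∀ x t, HasDerivAt (fun t => U t (K x)) (U t x) t := by
  let +nondep : NormedAlgebra ℚ (X →L[ℂ] X) := .restrictScalars ℚ ℝ (X →L[ℂ] X)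
  set A : X →L[ℂ] X := (-Complex.I) • K with hAdef
  have hA : IsSelfAdjoint A := by
    rw [IsSelfAdjoint, hAdef, star_smul, skewAdjoint.mem_iff.mp hK]; simp
  have hKA : K = Complex.I • A := by rw [hAdef, smul_smul]; simp
  have hrA : DenseRange A := by
    have h1 : DenseRange ((fun x : X => (-Complex.I) • x) ∘ K) := by
      refine DenseRange.comp (Function.Surjective.denseRange fun x =>
        ⟨Complex.I • x, ?_⟩) hr (by fun_prop)
      simp [smul_smul]
    exact h1
  have hrA2 : DenseRange (A ^ 2 : X →L[ℂ] X) := by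
    rw [pow_two]; exact hrA.comp hrA A.continuous
  have hrA3 : DenseRange (A ^ 3 : X →L[ℂ] X) := by
    rw [pow_succ]; exact hrA2.comp hrA (A ^ 2).continuous
  set L : ℕ → X →L[ℂ] X := regInv A with hL
  have hLs := regInv_mem_skewAdjoint A
  set V : ℕ → ℝ → X →L[ℂ] X := fun n t => NormedSpace.exp (t • L n) with hV
  have hVn : ∀ n t x, ‖V n t x‖ = ‖x‖ := fun n t x =>
    ContinuousLinearMap.norm_map_of_mem_unitary (exp_smul_mem_unitary (hLs n) t) x
  have hVop : ∀ n t, ‖V n t‖ ≤ 1 := fun n t =>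
    ContinuousLinearMap.opNorm_le_bound _ zero_le_one fun x => by rw [hVn, one_mul]
  have hz : Tendsto (fun n : ℕ => 1 / ((n : ℝ) + 1)) atTop (𝓝 0) :=
    tendsto_one_div_add_atTop_nhds_zero_nat
  have hcauchy : ∀ t x, CauchySeq fun n => V n t x := by
    intro t x
    rw [cauchySeq_iff_tendsto_dist_atTop_0]
    simp only [dist_eq_norm]
    refine tendsto_zero_iff_norm_tendsto_zero.mp ?_
    refine tendsto_zero_of_denseRange (S := fun n : ℕ × ℕ => V n.1 t - V n.2 t) (C := 2)
      (fun n => (norm_sub_le _ _).trans (by linarith [hVop n.1 t, hVop n.2 t])) hrA3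
      (fun y => ?_) x
    have h0 : Tendsto (fun n : ℕ × ℕ => |1 / ((n.2 : ℝ) + 1) - 1 / ((n.1 : ℝ) + 1)| * ‖y‖ * |t|)
        atTop (𝓝 0) := by
      have h1 : Tendsto (fun n : ℕ × ℕ => 1 / ((n.1 : ℝ) + 1)) atTop (𝓝 0) := by
        rw [← prod_atTop_atTop_eq]; exact hz.comp tendsto_fst
      have h2 : Tendsto (fun n : ℕ × ℕ => 1 / ((n.2 : ℝ) + 1)) atTop (𝓝 0) := by
        rw [← prod_atTop_atTop_eq]; exact hz.comp tendsto_snd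
      simpa using (((h2.sub h1).abs).mul_const ‖y‖).mul_const |t|
    refine squeeze_zero_norm (fun n => ?_) h0
    refine (norm_exp_smul_sub_exp_smul_le (hLs n.1) (hLs n.2) (commute_regInv A _ _) _ t).trans ?_
    gcongr
    exact ContinuousLinearMap.le_of_opNorm_le _ (norm_regInv_sub_mul_le A hA n.1 n.2) y
  choose f hf using fun t x => cauchySeq_tendsto_of_complete (hcauchy t x)
  let U : ℝ → X →L[ℂ] X := fun t =>
    continuousLinearMapOfTendsto (l := atTop) (fun n => V n t) (f := f t)
      (tendsto_pi_nhds.mpr fun x => hf t x)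
  have hU : ∀ t x, Tendsto (fun n => V n t x) atTop (𝓝 (U t x)) := fun t x => hf t x
  have hUn : ∀ t x, ‖U t x‖ = ‖x‖ := fun t x =>
    tendsto_nhds_unique (hU t x).norm (by simp only [hVn]; exact tendsto_const_nhds)
  have hcomm : ∀ n, Commute (L n) K := fun n => by
    rw [hKA]; exact (commute_regInv_self A hA n).smul_right _
  have hVK : ∀ n t x, V n t (K x) = K (V n t x) := fun n t x =>
    DFunLike.congr_fun (((hcomm n).smul_left t).exp_left : Commute (V n t) K).eq x
  have hUK : ∀ t x, U t (K x) = K (U t x) := fun t x => by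
    refine tendsto_nhds_unique (hU t (K x)) ?_
    simp only [hVK]
    exact (K.continuous.tendsto _).comp (hU t x)
  have hLK : ∀ n x, ‖L n (K x)‖ ≤ ‖x‖ := fun n x => by
    rw [hKA, smul_apply, map_smul, norm_smul, Complex.norm_I, one_mul]
    simpa using ContinuousLinearMap.le_of_opNorm_le _ (norm_regInv_mul_le A hA n) x
  -- On the range of `K`, the regularised generators are uniformly bounded and converge to `K⁻¹`.
  have hLKt : ∀ x, Tendsto (fun n => L n (K x)) atTop (𝓝 x) := fun x => by
    rw [← tendsto_sub_nhds_zero_iff]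
    refine tendsto_zero_of_denseRange (S := fun n => L n ∘L K - 1) (C := 2)
      (fun n => ?_) hrA2 (fun y => ?_) x
    · refine ContinuousLinearMap.opNorm_le_bound _ zero_le_two fun x => ?_
      have : ‖(L n ∘L K - 1) x‖ ≤ ‖L n (K x)‖ + ‖x‖ := norm_sub_le _ _
      linarith [hLK n x]
    · refine squeeze_zero_norm (a := fun n : ℕ => 1 / ((n : ℝ) + 1) * ‖y‖) (fun n => ?_) (by
        simpa using hz.mul_const ‖y‖)
      have := ContinuousLinearMap.le_of_opNorm_le _ (norm_regInv_mul_sub_one_mul_le A hA n) y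
      have e : (L n ∘L K - 1) ((A ^ 2 : X →L[ℂ] X) y) =
          (Complex.I • (regInv A n * A ^ 3) - A ^ 2) y := by
        have h3 : (A ^ 3 : X →L[ℂ] X) y = A ((A ^ 2 : X →L[ℂ] X) y) := by rw [pow_succ' A 2]; rfl
        change L n (K ((A ^ 2 : X →L[ℂ] X) y)) - _ =
          Complex.I • (L n ((A ^ 3 : X →L[ℂ] X) y)) - _
        rw [h3, hKA, smul_apply, map_smul]
        rfl
      rw [e]
      exact this
  have hlip : ∀ s t x, ‖U t (K x) - U s (K x)‖ ≤ ‖x‖ * ‖t - s‖ := fun s t x => by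
    refine le_of_tendsto ((hU t (K x)).sub (hU s (K x))).norm (Eventually.of_forall fun n => ?_)
    refine (norm_exp_smul_apply_sub_le (hLs n) (K x) s t).trans ?_
    gcongr
    exact hLK n x
  have hUop : ∀ t, ‖U t‖ ≤ 1 := fun t =>
    ContinuousLinearMap.opNorm_le_bound _ zero_le_one fun x => by rw [hUn, one_mul]
  have hcont : ∀ x, Continuous fun t => U t x := fun x => by
    rw [continuous_iff_continuousAt]
    intro s
    rw [ContinuousAt, ← tendsto_sub_nhds_zero_iff]
    refine tendsto_zero_of_denseRange (S := fun t => U t - U s) (C := 2)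
      (fun t => (norm_sub_le _ _).trans (by linarith [hUop t, hUop s])) hr (fun y => ?_) x
    refine squeeze_zero_norm (fun t => hlip s t y) ?_
    have : Continuous fun t : ℝ => ‖y‖ * ‖t - s‖ := by fun_prop
    simpa using this.tendsto s
  have hU0 : U 0 = 1 := by
    ext x
    refine tendsto_nhds_unique (hU 0 x) ?_
    simp [hV]
  refine ⟨U, hUn, hU0, fun s t x => ?_, hcont, hUK, fun x t => ?_⟩
  · refine tendsto_nhds_unique (hU (s + t) x) ?_
    have e : ∀ n, V n (s + t) x = V n s (V n t x) := fun n => by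
      simp only [hV]
      rw [add_smul, NormedSpace.exp_add_of_commute]
      · rfl
      · exact ((Commute.refl (L n)).smul_left s).smul_right t
    simp only [e]
    have h1 : Tendsto (fun n => V n s (V n t x - U t x)) atTop (𝓝 0) := by
      refine squeeze_zero_norm (a := fun n => ‖V n t x - U t x‖) (fun n => (hVn _ _ _).le) ?_
      exact tendsto_zero_iff_norm_tendsto_zero.mp (tendsto_sub_nhds_zero_iff.mpr (hU t x))
    have h2 := h1.add (hU s (U t x))
    simpa [map_sub] using h2
  -- Pass to the limit in the integrated form of the equation for the regularised groups.
  · have key : ∀ t, U t (K x) = K x + ∫ τ in 0..t, U τ x := by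
      intro t
      have e : ∀ n, V n t (K x) = K x + ∫ τ in 0..t, V n τ (L n (K x)) := fun n => by
        have hc : Continuous fun τ => V n τ (L n (K x)) := by
          rw [continuous_iff_continuousAt]
          exact fun τ => (hasDerivAt_exp_smul_apply (L n) _ τ).continuousAt
        rw [intervalIntegral.integral_eq_sub_of_hasDerivAt
          (fun τ _ => hasDerivAt_exp_smul_apply (L n) (K x) τ) (hc.intervalIntegrable _ _)]
        simp [hV]
      refine tendsto_nhds_unique (hU t (K x)) ?_
      simp only [e]
      refine tendsto_const_nhds.add ?_
      refine intervalIntegral.tendsto_integral_filter_of_dominated_convergence (fun _ => ‖x‖)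
        (Eventually.of_forall fun n => ?_) (Eventually.of_forall fun n =>
          Eventually.of_forall fun τ _ => by rw [hVn]; exact hLK n x)
        intervalIntegrable_const (Eventually.of_forall fun τ _ => ?_)
      · have hc : Continuous fun τ => V n τ (L n (K x)) := by
          rw [continuous_iff_continuousAt]
          exact fun τ => (hasDerivAt_exp_smul_apply (L n) _ τ).continuousAt
        exact hc.aestronglyMeasurable
      · have h1 : Tendsto (fun n => V n τ (L n (K x) - x)) atTop (𝓝 0) := by
          refine squeeze_zero_norm (a := fun n => ‖L n (K x) - x‖) (fun n => (hVn _ _ _).le) ?_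
          exact tendsto_zero_iff_norm_tendsto_zero.mp (tendsto_sub_nhds_zero_iff.mpr (hLKt x))
        simpa [map_sub] using h1.add (hU τ x)
    rw [funext key]
    exact (intervalIntegral.integral_hasDerivAt_right ((hcont x).intervalIntegrable _ _)
      (hcont x).stronglyMeasurable.stronglyMeasurableAtFilter (hcont x).continuousAt).const_add _

end UnitaryGroup

/-! ### Mild solutions of evolution equations -/

section Evolution

/-- A strongly continuous group of linear isometries. -/
structure IsIsometryGroup {Y : Type*} [NormedAddCommGroup Y] [NormedSpace ℝ Y]
    (S : ℝ → Y →L[ℝ] Y) : Prop where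
  norm_apply : ∀ t y, ‖S t y‖ = ‖y‖
  map_zero : S 0 = 1
  map_add : ∀ s t y, S (s + t) y = S s (S t y)
  continuous_apply : ∀ y, Continuous fun t => S t y

namespace IsIsometryGroup

variable {Y : Type*} [NormedAddCommGroup Y] [NormedSpace ℝ Y] {S : ℝ → Y →L[ℝ] Y}

theorem apply_neg_apply (hS : IsIsometryGroup S) (t : ℝ) (y : Y) : S t (S (-t) y) = y := by
  rw [← hS.map_add, add_neg_cancel, hS.map_zero]; rfl

theorem continuous_uncurry (hS : IsIsometryGroup S) : Continuous fun z : ℝ × Y => S z.1 z.2 := by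
  rw [continuous_iff_continuousAt]
  rintro ⟨s, y⟩
  rw [ContinuousAt, tendsto_iff_norm_sub_tendsto_zero]
  have h1 : Continuous fun z : ℝ × Y => ‖z.2 - y‖ + ‖S z.1 y - S s y‖ := by
    have := (hS.continuous_apply y).comp (continuous_fst (X := ℝ) (Y := Y))
    exact (by fun_prop : Continuous fun z : ℝ × Y => ‖z.2 - y‖).add
      ((this.sub continuous_const).norm)
  refine squeeze_zero (fun _ => norm_nonneg _) (fun z => ?_) (by simpa using h1.tendsto (s, y))
  calc ‖S z.1 z.2 - S s y‖ = ‖S z.1 (z.2 - y) + (S z.1 y - S s y)‖ := by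
        rw [_root_.map_sub]; congr 1; abel
    _ ≤ _ := (norm_add_le _ _).trans (by rw [hS.norm_apply])

theorem aestronglyMeasurable_neg (hS : IsIsometryGroup S) {μ : Measure ℝ} {h : ℝ → Y}
    (hh : AEStronglyMeasurable h μ) : AEStronglyMeasurable (fun τ => S (-τ) (h τ)) μ := by
  have hm : AEStronglyMeasurable (fun τ : ℝ => (-τ, h τ)) μ :=
    (continuous_neg.aestronglyMeasurable).prodMk hh
  exact hS.continuous_uncurry.comp_aestronglyMeasurable hm

theorem integrable_neg (hS : IsIsometryGroup S) {μ : Measure ℝ} {h : ℝ → Y}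
    (hh : Integrable h μ) : Integrable (fun τ => S (-τ) (h τ)) μ :=
  hh.congr' (hS.aestronglyMeasurable_neg hh.1)
    (Eventually.of_forall fun _ => (hS.norm_apply _ _).symm)

end IsIsometryGroup

section Mild

variable {Y : Type*} [NormedAddCommGroup Y] [NormedSpace ℝ Y] {S : ℝ → Y →L[ℝ] Y}
  {B : ℝ → Y →L[ℝ] Y} {T β : ℝ}

theorem aestronglyMeasurable_clm_apply {Z : Type*} [NormedAddCommGroup Z] [NormedSpace ℝ Z]
    {μ : Measure ℝ} {B : ℝ → Y →L[ℝ] Z} (hB : AEStronglyMeasurable B μ) {y : ℝ → Y}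
    (hy : AEStronglyMeasurable y μ) : AEStronglyMeasurable (fun τ => B τ (y τ)) μ :=
  (continuous_fst.clm_apply continuous_snd :
    Continuous fun z : (Y →L[ℝ] Z) × Y => z.1 z.2).comp_aestronglyMeasurable (hB.prodMk hy)

/-- Mild solutions of `y' = L y + B(t) y + f`, where `L` generates `S`. In the unknown `S(-t) y(t)`
the equation becomes a Volterra equation. -/
theorem exists_mild_solution [CompleteSpace Y] (hS : IsIsometryGroup S) (hT : 0 ≤ T) (hβ0 : 0 ≤ β)
    (hB : AEStronglyMeasurable B (timeMeasure T)) (hβ : ∀ᵐ τ ∂(timeMeasure T), ‖B τ‖ ≤ β)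
    {f : ℝ → Y} (hf : IntegrableOn f (Ioo 0 T)) (y₀ : Y) :
    ∃ y : ℝ → Y, Continuous y ∧
      (∀ t ∈ Icc 0 T, y t = S t (y₀ + ∫ τ in 0..t, S (-τ) (B τ (y τ) + f τ))) ∧
      ∀ t ∈ Icc 0 T, ‖y t‖ ≤ (‖y₀‖ + ∫ τ in Ioo 0 T, ‖f τ‖) * Real.exp (β * T) := by
  have hN : ∀ ζ : ℝ → Y, Continuous ζ →
      AEStronglyMeasurable (fun τ => (S (-τ) ∘L B τ ∘L S τ) (ζ τ)) (timeMeasure T) := fun ζ hζ =>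
    hS.aestronglyMeasurable_neg (aestronglyMeasurable_clm_apply hB
      (hS.continuous_uncurry.comp (continuous_id.prodMk hζ)).aestronglyMeasurable)
  have hNβ : ∀ᵐ τ ∂(timeMeasure T), ‖S (-τ) ∘L B τ ∘L S τ‖ ≤ β := by
    filter_upwards [hβ] with τ hτ
    refine ContinuousLinearMap.opNorm_le_bound _ hβ0 fun y => ?_
    simp only [ContinuousLinearMap.comp_apply, hS.norm_apply]
    refine ((B τ).le_of_opNorm_le hτ _).trans ?_
    rw [hS.norm_apply]
  obtain ⟨ζ, h1, h2, h3⟩ := exists_volterra_solution (f := fun τ => S (-τ) (f τ)) hT hβ0 hN hNβ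
    (hS.integrable_neg hf) y₀
  refine ⟨fun t => S t (ζ t), hS.continuous_uncurry.comp (continuous_id.prodMk h1),
    fun t ht => ?_, fun t ht => ?_⟩
  · beta_reduce
    rw [h2 t ht]
    simp [_root_.map_add]
  · simp only [hS.norm_apply] at h3 ⊢
    exact h3 t ht

/-- Uniqueness of mild solutions, in the class of integrable functions. -/
theorem mild_solution_eq_zero (hS : IsIsometryGroup S) (hβ0 : 0 ≤ β)
    (hβ : ∀ᵐ τ ∂(timeMeasure T), ‖B τ‖ ≤ β) {m : ℝ → Y} (hm : IntegrableOn m (Ioo 0 T))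
    (h : ∀ᵐ t ∂(timeMeasure T), m t = S t (∫ τ in 0..t, S (-τ) (B τ (m τ)))) :
    m =ᵐ[timeMeasure T] 0 := by
  refine ae_eq_zero_of_norm_le_integral hβ0 hm ?_
  filter_upwards [h, ae_restrict_mem measurableSet_Ioo] with t ht ht'
  rw [ht, hS.norm_apply, ← intervalIntegral.integral_const_mul]
  have hsub : Ioo 0 t ⊆ Ioo 0 T := Ioo_subset_Ioo_right ht'.2.le
  have hmn : IntegrableOn (fun τ => β * ‖m τ‖) (Ioo 0 T) := hm.norm.const_mul β
  refine intervalIntegral.norm_integral_le_of_norm_le ht'.1.le ?_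
    ((intervalIntegrable_iff_integrableOn_Ioo_of_le ht'.1.le).mpr (hmn.mono_set hsub))
  rw [← ae_restrict_iff' measurableSet_Ioc, Measure.restrict_congr_set Ioo_ae_eq_Ioc.symm]
  filter_upwards [ae_restrict_of_ae_restrict_of_subset hsub hβ] with τ hτ
  rw [hS.norm_apply]
  exact (B τ).le_of_opNorm_le hτ _

end Mild

section InverseGroup

variable {X : Type*} [NormedAddCommGroup X] [InnerProductSpace ℂ X]

/-- The complex inner product as a real bilinear map. -/
def innerBilin (X : Type*) [NormedAddCommGroup X] [InnerProductSpace ℂ X] :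
    X →L[ℝ] X →L[ℝ] ℂ :=
  (isBoundedBilinearMap_inner (𝕜 := ℂ) (E := X)).toContinuousLinearMap

theorem innerBilin_apply (x y : X) : innerBilin X x y = inner ℂ x y := rfl

/-- `U` is the group of isometries generated by `K⁻¹`, where `K` is a bounded skew-adjoint operator
with dense range. -/
structure IsInverseGroup (K : X →L[ℂ] X) (U : ℝ → X →L[ℂ] X) : Prop where
  isometryGroup : IsIsometryGroup fun t => (U t).restrictScalars ℝ
  commute : ∀ t x, U t (K x) = K (U t x)
  hasDerivAt : ∀ x t, HasDerivAt (fun t => U t (K x)) (U t x) t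
  skew : ∀ x y, inner ℂ (K x) y = - inner ℂ x (K y)
  denseRange : DenseRange K

namespace IsInverseGroup

variable {K : X →L[ℂ] X} {U : ℝ → X →L[ℂ] X} {T : ℝ}

theorem inner_apply (h : IsInverseGroup K U) (t : ℝ) (x y : X) :
    inner ℂ (U t x) (U t y) = inner ℂ x y :=
  (LinearMap.norm_map_iff_inner_map_map (U t)).mp (fun x => h.isometryGroup.norm_apply t x) x y

theorem inner_apply_left (h : IsInverseGroup K U) (t : ℝ) (x y : X) :
    inner ℂ (U t x) y = inner ℂ x (U (-t) y) := by
  have e : U t (U (-t) y) = y := h.isometryGroup.apply_neg_apply t y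
  conv_lhs => rw [← e]
  exact h.inner_apply t _ _

theorem injective (h : IsInverseGroup K U) : Function.Injective K := by
  rw [injective_iff_map_eq_zero]
  intro x hx
  refine h.denseRange.eq_zero_of_inner_left (𝕜 := ℂ) fun y => ?_
  rw [← neg_eq_zero, ← h.skew, hx, inner_zero_left]

variable [CompleteSpace X]

theorem apply_eq_integral (h : IsInverseGroup K U) (x : X) (t : ℝ) :
    U t (K x) = K x + ∫ τ in 0..t, U τ x := by
  rw [intervalIntegral.integral_eq_sub_of_hasDerivAt (fun τ _ => h.hasDerivAt x τ)
    ((h.isometryGroup.continuous_apply x).intervalIntegrable _ _)]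
  have : U 0 (K x) = K x := DFunLike.congr_fun h.isometryGroup.map_zero (K x)
  rw [this]; abel

/-- For the mild solution `x` of `x' = K⁻¹ x + h`, the function `K x` is a primitive of
`x + K h`. -/
theorem map_mild_solution (h : IsInverseGroup K U) {f x : ℝ → X}
    (hf : IntegrableOn f (Ioo 0 T)) (hxc : Continuous x) (x₀ : X)
    (hx : ∀ t ∈ Icc 0 T, x t = U t (x₀ + ∫ τ in 0..t, U (-τ) (f τ))) :
    ∀ t ∈ Icc 0 T, K (x t) = K x₀ + ∫ τ in 0..t, (x τ + K (f τ)) := by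
  intro t ht
  have hsub : Ioo 0 t ⊆ Ioo 0 T := Ioo_subset_Ioo_right ht.2
  have hft : IntegrableOn f (Ioo 0 t) := hf.mono_set hsub
  have hfU : IntegrableOn (fun τ => U (-τ) (f τ)) (Ioc 0 t) :=
    integrableOn_Ioo_iff_Ioc.mp (h.isometryGroup.integrable_neg hft)
  have hi : IntegrableOn (fun τ => x τ + K (f τ)) (Ioc 0 t) :=
    (hxc.integrableOn_Icc.mono_set Ioc_subset_Icc_self).add
      (integrableOn_Ioo_iff_Ioc.mp (K.integrable_comp hft))
  -- Tested with `η`, the claim is an integration by parts of `⟨U(-t) K η, ζ(t)⟩`, where `x = U ζ`.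
  refine ext_inner_left ℂ fun η => ?_
  set ζ : ℝ → X := fun t => x₀ + ∫ τ in 0..t, U (-τ) (f τ) with hζ
  have hxζ : ∀ τ ∈ Icc 0 t, x τ = U τ (ζ τ) := fun τ hτ => hx τ ⟨hτ.1, hτ.2.trans ht.2⟩
  have hUc : Continuous fun τ => U (-τ) η :=
    (h.isometryGroup.continuous_apply η).comp continuous_neg
  have hp : ∀ t, U (-t) (K η) = K η + ∫ τ in 0..t, -(U (-τ) η) := fun t => by
    have e : ∫ τ in 0..t, U (-τ) η = -∫ τ in 0..(-t), U τ η := by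
      rw [intervalIntegral.integral_comp_neg (fun τ => U τ η), neg_zero,
        intervalIntegral.integral_symm]
    rw [intervalIntegral.integral_neg, e, neg_neg]
    exact h.apply_eq_integral η (-t)
  have key := integral_bilin_eq_sub (innerBilin X) (p := fun τ => U (-τ) (K η))
    (p' := fun τ => -(U (-τ) η)) (r := ζ) (r' := fun τ => U (-τ) (f τ)) ht.1
    (hUc.neg.integrableOn_Icc.mono_set Ioc_subset_Icc_self) hfU
    (fun s _ => by
      have : U (-0) (K η) = K η := by
        rw [neg_zero]; exact DFunLike.congr_fun h.isometryGroup.map_zero (K η)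
      rw [this]; exact hp s) (fun s _ => by simp [hζ])
  simp only [innerBilin_apply] at key
  have e1 : inner ℂ (U (-t) (K η)) (ζ t) = - inner ℂ η (K (x t)) := by
    rw [h.inner_apply_left, neg_neg, ← hxζ t (right_mem_Icc.mpr ht.1), h.skew]
  have e2 : inner ℂ (U (-0) (K η)) (ζ 0) = - inner ℂ η (K x₀) := by
    have h0 : U (-0) (K η) = K η := by
      rw [neg_zero]; exact DFunLike.congr_fun h.isometryGroup.map_zero (K η)
    rw [h0, h.skew]; simp [hζ]
  rw [e1, e2] at key
  have e3 : ∫ τ in Ioc 0 t, (inner ℂ (-(U (-τ) η)) (ζ τ) + inner ℂ (U (-τ) (K η)) (U (-τ) (f τ))) =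
      ∫ τ in Ioc 0 t, - inner ℂ η (x τ + K (f τ)) := by
    refine setIntegral_congr_fun measurableSet_Ioc fun τ hτ => ?_
    rw [inner_neg_left, h.inner_apply_left, neg_neg, ← hxζ τ (Ioc_subset_Icc_self hτ),
      h.inner_apply, h.skew, inner_add_right]
    ring
  rw [e3, integral_neg, integral_inner hi η, ← intervalIntegral.integral_of_le ht.1] at key
  rw [inner_add_right]
  linear_combination key

/-- A function `x` for which `K x` is a primitive of `x + K h` is the mild solution of
`x' = K⁻¹ x + h`. -/
theorem eq_mild_solution (h : IsInverseGroup K U) {f x : ℝ → X}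
    (hf : IntegrableOn f (Ioo 0 T)) (hxi : IntegrableOn x (Ioo 0 T))
    (hx : ∀ᵐ t ∂(timeMeasure T), K (x t) = ∫ τ in 0..t, (x τ + K (f τ))) :
    ∀ᵐ t ∂(timeMeasure T), x t = U t (∫ τ in 0..t, U (-τ) (f τ)) := by
  filter_upwards [hx, ae_restrict_mem measurableSet_Ioo] with t hxt ht
  have hsub : Ioo 0 t ⊆ Ioo 0 T := Ioo_subset_Ioo_right ht.2.le
  have hft : IntegrableOn f (Ioo 0 t) := hf.mono_set hsub
  have hfU : IntegrableOn (fun τ => U (-τ) (f τ)) (Ioc 0 t) :=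
    integrableOn_Ioo_iff_Ioc.mp (h.isometryGroup.integrable_neg hft)
  have hi : IntegrableOn (fun τ => x τ + K (f τ)) (Ioc 0 t) :=
    integrableOn_Ioo_iff_Ioc.mp ((hxi.mono_set hsub).add (K.integrable_comp hft))
  set y : ℝ → X := fun t => ∫ τ in 0..t, (x τ + K (f τ)) with hy
  have hxy : ∀ᵐ τ ∂(volume.restrict (Ioc 0 t)), K (x τ) = y τ := by
    rw [Measure.restrict_congr_set Ioo_ae_eq_Ioc.symm]
    exact ae_restrict_of_ae_restrict_of_subset hsub hx
  -- `K x = y` turns the equation into `y' = K⁻¹ y + K f`, whose Duhamel formula follows by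
  -- integrating `⟨U(t) K η, y(t)⟩` by parts.
  have key : U (-t) (y t) = K (∫ τ in 0..t, U (-τ) (f τ)) := by
    rw [← sub_eq_zero]
    refine h.denseRange.eq_zero_of_inner_right (𝕜 := ℂ) fun η => ?_
    have ibp := integral_bilin_eq_sub (innerBilin X) (p := fun τ => U τ (K η))
      (p' := fun τ => U τ η) (r := y) (r' := fun τ => x τ + K (f τ)) ht.1.le
      ((h.isometryGroup.continuous_apply η).integrableOn_Icc.mono_set Ioc_subset_Icc_self) hi
      (fun s _ => by
        have : U 0 (K η) = K η := DFunLike.congr_fun h.isometryGroup.map_zero (K η)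
        rw [this]; exact h.apply_eq_integral η s) (fun s _ => by simp [hy])
    simp only [innerBilin_apply] at ibp
    have y0 : y 0 = 0 := by simp [hy]
    rw [y0, inner_zero_right, sub_zero, h.inner_apply_left] at ibp
    have e3 : ∫ τ in Ioc 0 t, (inner ℂ (U τ η) (y τ) + inner ℂ (U τ (K η)) (x τ + K (f τ))) =
        ∫ τ in Ioc 0 t, - inner ℂ (K (K η)) (U (-τ) (f τ)) := by
      refine integral_congr_ae ?_
      filter_upwards [hxy] with τ hτ
      rw [← hτ, inner_add_right, h.commute, h.skew, ← h.commute, h.inner_apply_left τ (K η),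
        h.commute, ← neg_eq_iff_eq_neg.mpr (h.skew (K η) _)]
      ring
    rw [e3, integral_neg, integral_inner hfU, ← intervalIntegral.integral_of_le ht.1.le,
      h.skew, neg_neg] at ibp
    rw [inner_sub_right, ← ibp, sub_self]
  refine h.injective ?_
  rw [← h.commute, ← key]
  have := h.isometryGroup.apply_neg_apply t (y t)
  exact hxt.trans this.symm

end IsInverseGroup
end InverseGroup
end Evolution

/-! ### The third order equation in an abstract energy space -/

section Wave

variable {V H : Type*} [NormedAddCommGroup V] [InnerProductSpace ℂ V] [CompleteSpace V]
  [NormedAddCommGroup H] [InnerProductSpace ℂ H] [CompleteSpace H]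

/-- The inverse `K(g, z) = b^{-1/2} (-J† z, J g)` of the generator of the wave equation
`w'' + b A w = 0` in the unknowns `(√b w, w') ∈ V × H`. Here `V` carries the energy inner product
`⟨A · , ·⟩` and `J` is the embedding of `V` into `H`, so that `J† = A⁻¹` on `H`. -/
def waveInv (J : V →L[ℂ] H) (b : ℝ) : WithLp 2 (V × H) →L[ℂ] WithLp 2 (V × H) :=
  ((WithLp.prodContinuousLinearEquiv 2 ℂ V H).symm : V × H →L[ℂ] WithLp 2 (V × H)) ∘L
    ((-((((√b)⁻¹ : ℝ) : ℂ) • J†) ∘L ContinuousLinearMap.snd ℂ V H).prod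
      (((((√b)⁻¹ : ℝ) : ℂ) • J) ∘L ContinuousLinearMap.fst ℂ V H)) ∘L
    ((WithLp.prodContinuousLinearEquiv 2 ℂ V H) : WithLp 2 (V × H) →L[ℂ] V × H)

theorem waveInv_fst (J : V →L[ℂ] H) (b : ℝ) (x : WithLp 2 (V × H)) :
    (waveInv J b x).fst = -((((√b)⁻¹ : ℝ) : ℂ) • (J†) x.snd) := rfl

theorem waveInv_snd (J : V →L[ℂ] H) (b : ℝ) (x : WithLp 2 (V × H)) :
    (waveInv J b x).snd = (((√b)⁻¹ : ℝ) : ℂ) • J x.fst := rfl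

theorem inner_waveInv_left (J : V →L[ℂ] H) (b : ℝ) (x y : WithLp 2 (V × H)) :
    inner ℂ (waveInv J b x) y = - inner ℂ x (waveInv J b y) := by
  rw [WithLp.prod_inner_apply, WithLp.prod_inner_apply]
  change inner ℂ (waveInv J b x).fst y.fst + inner ℂ (waveInv J b x).snd y.snd =
    -(inner ℂ x.fst (waveInv J b y).fst + inner ℂ x.snd (waveInv J b y).snd)
  rw [waveInv_fst, waveInv_snd, waveInv_fst, waveInv_snd, inner_neg_left, inner_smul_left,
    inner_smul_left, inner_neg_right, inner_smul_right, inner_smul_right, Complex.conj_ofReal,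
    ContinuousLinearMap.adjoint_inner_left, ContinuousLinearMap.adjoint_inner_right]
  ring

/-- The orthogonal complement of the range of `J†` is the kernel of `J`. -/
theorem denseRange_adjoint {J : V →L[ℂ] H} (hJ : Function.Injective J) : DenseRange (J†) := by
  have h1 : (J†).rangeᗮ = ⊥ := by
    rw [ContinuousLinearMap.orthogonal_range, ContinuousLinearMap.adjoint_adjoint]
    exact LinearMap.ker_eq_bot.mpr hJ
  have h2 : ((J†).range : Submodule ℂ V).topologicalClosure = ⊤ := by
    rwa [Submodule.topologicalClosure_eq_top_iff]
  have h3 := (Submodule.dense_iff_topologicalClosure_eq_top (s := (J†).range)).mpr h2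
  exact h3

theorem denseRange_waveInv {J : V →L[ℂ] H} (hJ : Function.Injective J) (hJd : DenseRange J)
    {b : ℝ} (hb : 0 < b) : DenseRange (waveInv J b) := by
  have hr : (((√b)⁻¹ : ℝ) : ℂ) ≠ 0 := by
    rw [Complex.ofReal_ne_zero]; exact (inv_pos.mpr (Real.sqrt_pos.mpr hb)).ne'
  have h1 : DenseRange (fun z : H => -((((√b)⁻¹ : ℝ) : ℂ) • (J†) z)) := by
    have hs : Function.Surjective fun v : V => -((((√b)⁻¹ : ℝ) : ℂ) • v) := fun v =>
      ⟨-((((√b)⁻¹ : ℝ) : ℂ)⁻¹ • v), by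
        beta_reduce
        rw [smul_neg, neg_neg, smul_smul, mul_inv_cancel₀ hr, one_smul]⟩
    exact hs.denseRange.comp (denseRange_adjoint hJ) (by fun_prop)
  have h2 : DenseRange (fun z : V => (((√b)⁻¹ : ℝ) : ℂ) • J z) := by
    have hs : Function.Surjective fun v : H => (((√b)⁻¹ : ℝ) : ℂ) • v := fun v =>
      ⟨(((√b)⁻¹ : ℝ) : ℂ)⁻¹ • v, by
        beta_reduce
        rw [smul_smul, mul_inv_cancel₀ hr, one_smul]⟩
    exact hs.denseRange.comp hJd (by fun_prop)
  have h3 := h1.prodMap h2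
  have h4 : Function.Surjective fun x : WithLp 2 (V × H) => (x.snd, x.fst) := fun y =>
    ⟨WithLp.toLp 2 (y.2, y.1), rfl⟩
  have h5 := (h3.comp h4.denseRange ?_)
  · have h6 : Function.Surjective (WithLp.prodContinuousLinearEquiv 2 ℂ V H).symm :=
      (WithLp.prodContinuousLinearEquiv 2 ℂ V H).symm.surjective
    exact h6.denseRange.comp h5 (WithLp.prodContinuousLinearEquiv 2 ℂ V H).symm.continuous
  · exact (by fun_prop)

/-- The wave equation `w'' + b A w = 0` generates a group of isometries of the energy space. -/
theorem exists_isInverseGroup_waveInv {J : V →L[ℂ] H} (hJ : Function.Injective J)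
    (hJd : DenseRange J) {b : ℝ} (hb : 0 < b) :
    ∃ U, IsInverseGroup (waveInv J b) U := by
  have hK : waveInv J b ∈ skewAdjoint (WithLp 2 (V × H) →L[ℂ] WithLp 2 (V × H)) := by
    rw [skewAdjoint.mem_iff, ContinuousLinearMap.star_eq_adjoint]
    ext1 x
    refine ext_inner_right ℂ fun y => ?_
    rw [ContinuousLinearMap.adjoint_inner_left, neg_apply, inner_neg_left,
      inner_waveInv_left, neg_neg]
  obtain ⟨U, h1, h2, h3, h4, h5, h6⟩ :=
    exists_group_of_skewAdjoint hK (denseRange_waveInv hJ hJd hb)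
  refine ⟨U, ⟨⟨h1, ?_, h3, h4⟩, h5, h6, inner_waveInv_left J b, denseRange_waveInv hJ hJd hb⟩⟩
  rw [h2]; rfl

end Wave

section Primitive

variable {X Z : Type*} [NormedAddCommGroup X] [NormedSpace ℝ X]
  [NormedAddCommGroup Z] [NormedSpace ℝ Z] {T : ℝ}

/-- `p` agrees almost everywhere on `(0, T)` with the primitive of the integrable function `p'` that
takes the value `p₀` at time zero. -/
structure IsPrimitive (T : ℝ) (p₀ : X) (p p' : ℝ → X) : Prop where
  integrableOn : IntegrableOn p' (Ioo 0 T)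
  ae_eq : ∀ᵐ t ∂(timeMeasure T), p t = p₀ + ∫ τ in 0..t, p' τ

namespace IsPrimitive

variable {p₀ q₀ : X} {p p' q q' : ℝ → X}

theorem intervalIntegrable (h : IsPrimitive T p₀ p p') {t : ℝ} (ht : t ∈ Icc 0 T) :
    IntervalIntegrable p' volume 0 t :=
  (intervalIntegrable_iff_integrableOn_Ioo_of_le ht.1).mpr
    (h.integrableOn.mono_set (Ioo_subset_Ioo_right ht.2))

theorem add (h : IsPrimitive T p₀ p p') (k : IsPrimitive T q₀ q q') :
    IsPrimitive T (p₀ + q₀) (fun t => p t + q t) (fun t => p' t + q' t) := by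
  refine ⟨h.integrableOn.add k.integrableOn, ?_⟩
  filter_upwards [h.ae_eq, k.ae_eq, ae_restrict_mem measurableSet_Ioo] with t h1 h2 ht
  rw [h1, h2, intervalIntegral.integral_add (h.intervalIntegrable ⟨ht.1.le, ht.2.le⟩)
    (k.intervalIntegrable ⟨ht.1.le, ht.2.le⟩)]
  abel

theorem clm [CompleteSpace X] [CompleteSpace Z] (h : IsPrimitive T p₀ p p') (L : X →L[ℝ] Z) :
    IsPrimitive T (L p₀) (fun t => L (p t)) (fun t => L (p' t)) := by
  refine ⟨L.integrable_comp h.integrableOn, ?_⟩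
  filter_upwards [h.ae_eq, ae_restrict_mem measurableSet_Ioo] with t h1 ht
  rw [h1, map_add, L.intervalIntegral_comp_comm (h.intervalIntegrable ⟨ht.1.le, ht.2.le⟩)]

theorem smul (h : IsPrimitive T p₀ p p') (r : ℝ) :
    IsPrimitive T (r • p₀) (fun t => r • p t) (fun t => r • p' t) := by
  refine ⟨h.integrableOn.smul r, ?_⟩
  filter_upwards [h.ae_eq] with t h1
  rw [h1, smul_add, intervalIntegral.integral_smul]

theorem congr (h : IsPrimitive T p₀ p p') (h₀ : p₀ = q₀) (hp : p =ᵐ[timeMeasure T] q)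
    (hp' : p' =ᵐ[timeMeasure T] q') : IsPrimitive T q₀ q q' := by
  refine ⟨h.integrableOn.congr hp', ?_⟩
  filter_upwards [h.ae_eq, hp, ae_restrict_mem measurableSet_Ioo] with t h1 h2 ht
  rw [← h2, h1, h₀, intervalIntegral.integral_of_le ht.1.le,
    intervalIntegral.integral_of_le ht.1.le, integral_Ioc_eq_integral_Ioo,
    integral_Ioc_eq_integral_Ioo]
  congr 1
  exact integral_congr_ae (ae_restrict_of_ae_restrict_of_subset (Ioo_subset_Ioo_right ht.2.le) hp')

theorem of_forall (hi : IntegrableOn p' (Ioo 0 T))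
    (h : ∀ t ∈ Icc 0 T, p t = p₀ + ∫ τ in 0..t, p' τ) : IsPrimitive T p₀ p p' := by
  refine ⟨hi, ?_⟩
  filter_upwards [ae_restrict_mem measurableSet_Ioo] with t ht using h t ⟨ht.1.le, ht.2.le⟩

theorem eqOn (hT : 0 < T) (h : IsPrimitive T p₀ p p') (hp : ContinuousOn p (Icc 0 T)) :
    ∀ t ∈ Icc 0 T, p t = p₀ + ∫ τ in 0..t, p' τ :=
  eqOn_of_ae_eq_of_continuousOn hT hp (continuousOn_add_primitive hT.le h.integrableOn p₀) h.ae_eq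

theorem apply_zero (hT : 0 < T) (h : IsPrimitive T p₀ p p') (hp : ContinuousOn p (Icc 0 T)) :
    p 0 = p₀ := by
  rw [h.eqOn hT hp 0 (left_mem_Icc.mpr hT.le)]; simp

theorem hasInitialValue (hT : 0 ≤ T) (h : IsPrimitive T p₀ p p') : HasInitialValue T p p₀ :=
  ⟨_, continuousOn_add_primitive hT h.integrableOn p₀, h.ae_eq.mono fun _ ht => ht.symm, by simp⟩

theorem hasTimeDeriv [CompleteSpace X] (hT : 0 ≤ T) (h : IsPrimitive T p₀ p p') :
    HasTimeDeriv T p p' :=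
  (hasTimeDeriv_primitive hT h.integrableOn p₀ fun _ _ => rfl).congr
    (h.ae_eq.mono fun _ ht => ht.symm) EventuallyEq.rfl

end IsPrimitive
end Primitive

section System

variable {V H : Type*} [NormedAddCommGroup V] [InnerProductSpace ℂ V]
  [NormedAddCommGroup H] [InnerProductSpace ℂ H]

/-- The velocity `u' = w - (c/b) u` in terms of `(u, √b w, w')`. -/
def velocity (V H : Type*) [NormedAddCommGroup V] [InnerProductSpace ℂ V]
    [NormedAddCommGroup H] [InnerProductSpace ℂ H] (b c : ℝ) : V × WithLp 2 (V × H) →L[ℝ] V :=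
  (√b)⁻¹ • ((WithLp.fstL 2 ℂ V H).restrictScalars ℝ ∘L ContinuousLinearMap.snd ℝ V _) -
    (c / b) • ContinuousLinearMap.fst ℝ V _

/-- The acceleration `u'' = w' - (c/b) u'` in terms of `(u, √b w, w')`. -/
def acceleration (J : V →L[ℂ] H) (b c : ℝ) : V × WithLp 2 (V × H) →L[ℝ] H :=
  (WithLp.sndL 2 ℂ V H).restrictScalars ℝ ∘L ContinuousLinearMap.snd ℝ V _ -
    (c / b) • (J.restrictScalars ℝ ∘L velocity V H b c)

/-- The inclusion `z ↦ (0, z)` of `H`. -/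
def inclSnd (V H : Type*) [NormedAddCommGroup V] [InnerProductSpace ℂ V]
    [NormedAddCommGroup H] [InnerProductSpace ℂ H] : H →L[ℝ] WithLp 2 (V × H) :=
  ((WithLp.prodContinuousLinearEquiv 2 ℂ V H).symm.toContinuousLinearMap ∘L
    ContinuousLinearMap.inr ℂ V H).restrictScalars ℝ

/-- The state `(u, √b w, w')`, `w = u' + (c/b) u`, in terms of `u`, `u'` and `u''`. -/
def stateOf (J : V →L[ℂ] H) (b c : ℝ) : V × V × H →L[ℝ] V × WithLp 2 (V × H) :=
  (ContinuousLinearMap.fst ℝ V (V × H)).prod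
    ((WithLp.prodContinuousLinearEquiv 2 ℂ V H).symm.toContinuousLinearMap.restrictScalars ℝ ∘L
      (√b • (ContinuousLinearMap.fst ℝ V H ∘L ContinuousLinearMap.snd ℝ V (V × H) +
        (c / b) • ContinuousLinearMap.fst ℝ V (V × H))).prod
      (ContinuousLinearMap.snd ℝ V H ∘L ContinuousLinearMap.snd ℝ V (V × H) +
        (c / b) • (J.restrictScalars ℝ ∘L
          ContinuousLinearMap.fst ℝ V H ∘L ContinuousLinearMap.snd ℝ V (V × H))))

variable {J : V →L[ℂ] H} {α b c T : ℝ} {Q : ℝ → V →L[ℝ] H} {F : ℝ → H}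
  {u₀ v₀ : V} {a₀ : H} {u v : ℝ → V} {a : ℝ → H}

theorem velocity_apply (y : V × WithLp 2 (V × H)) :
    velocity V H b c y = (√b)⁻¹ • y.2.fst - (c / b) • y.1 := rfl

theorem acceleration_apply (y : V × WithLp 2 (V × H)) :
    acceleration J b c y = y.2.snd - (c / b) • J (velocity V H b c y) := rfl

theorem stateOf_fst (u v : V) (a : H) : (stateOf J b c (u, v, a)).1 = u := rfl

theorem stateOf_snd_fst (u v : V) (a : H) :
    (stateOf J b c (u, v, a)).2.fst = √b • (v + (c / b) • u) := rfl

theorem stateOf_snd_snd (u v : V) (a : H) :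
    (stateOf J b c (u, v, a)).2.snd = a + (c / b) • J v := rfl

theorem velocity_stateOf (hb : 0 < b) (u v : V) (a : H) :
    velocity V H b c (stateOf J b c (u, v, a)) = v := by
  rw [velocity_apply, stateOf_snd_fst, stateOf_fst, smul_smul,
    inv_mul_cancel₀ (Real.sqrt_pos.mpr hb).ne', one_smul, add_sub_cancel_right]

theorem acceleration_stateOf (hb : 0 < b) (u v : V) (a : H) :
    acceleration J b c (stateOf J b c (u, v, a)) = a := by
  rw [acceleration_apply, velocity_stateOf hb, stateOf_snd_snd, add_sub_cancel_right]

/-- The inclusion `g ↦ (g, 0)` of `V`. -/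
def inclFst (V H : Type*) [NormedAddCommGroup V] [InnerProductSpace ℂ V]
    [NormedAddCommGroup H] [InnerProductSpace ℂ H] : V →L[ℝ] WithLp 2 (V × H) :=
  ((WithLp.prodContinuousLinearEquiv 2 ℂ V H).symm.toContinuousLinearMap ∘L
    ContinuousLinearMap.inl ℂ V H).restrictScalars ℝ

theorem inclFst_add_inclSnd (x : WithLp 2 (V × H)) :
    inclFst V H x.fst + inclSnd V H x.snd = x := by
  refine (WithLp.equiv 2 (V × H)).injective ?_
  exact Prod.ext (add_zero x.fst) (zero_add x.snd)

/-- The bounded part `(u', (0, -Q u - (α - c/b) u''))` of the first-order system for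
`(u, √b w, w')`. -/
def lowerOrder (J : V →L[ℂ] H) (α b c : ℝ) (Q : V →L[ℝ] H) :
    V × WithLp 2 (V × H) →L[ℝ] V × WithLp 2 (V × H) :=
  (velocity V H b c).prod (inclSnd V H ∘L
    (-(Q ∘L ContinuousLinearMap.fst ℝ V (WithLp 2 (V × H))) - (α - c / b) • acceleration J b c))

theorem lowerOrder_apply (Q : V →L[ℝ] H) (y : V × WithLp 2 (V × H)) :
    lowerOrder J α b c Q y = (velocity V H b c y,
      inclSnd V H (-(Q y.1) - (α - c / b) • acceleration J b c y)) := rfl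

theorem continuous_lowerOrder : Continuous (lowerOrder J α b c) := by
  have e : lowerOrder J α b c = fun Q => lowerOrder J α b c 0 -
      (ContinuousLinearMap.inr ℝ V (WithLp 2 (V × H))) ∘L inclSnd V H ∘L
        (Q ∘L ContinuousLinearMap.fst ℝ V (WithLp 2 (V × H))) := by
    funext Q
    refine ContinuousLinearMap.ext fun y => ?_
    rw [sub_apply, lowerOrder_apply, lowerOrder_apply]
    refine Prod.ext (sub_zero _).symm ?_
    change inclSnd V H _ = inclSnd V H _ - inclSnd V H (Q y.1)
    rw [← map_sub]
    congr 1
    rw [zero_apply]; abel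
  rw [e]
  exact continuous_const.sub (continuous_const.clm_comp
    (continuous_const.clm_comp (continuous_id.clm_comp continuous_const)))

theorem norm_lowerOrder_le {M : ℝ} {Q : V →L[ℝ] H} (hQ : ‖Q‖ ≤ M) :
    ‖lowerOrder J α b c Q‖ ≤ ‖velocity V H b c‖ + ‖inclSnd V H‖ *
      (M + |α - c / b| * ‖acceleration J b c‖) := by
  have hM : 0 ≤ M := (norm_nonneg _).trans hQ
  refine ContinuousLinearMap.opNorm_le_bound _ (by positivity) fun y => ?_
  rw [lowerOrder_apply, Prod.norm_def]
  have h1 : ‖velocity V H b c y‖ ≤ ‖velocity V H b c‖ * ‖y‖ := (velocity V H b c).le_opNorm y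
  have h2 : ‖inclSnd V H (-(Q y.1) - (α - c / b) • acceleration J b c y)‖ ≤
      ‖inclSnd V H‖ * (M * ‖y‖ + |α - c / b| * (‖acceleration J b c‖ * ‖y‖)) := by
    refine ((inclSnd V H).le_opNorm _).trans ?_
    gcongr
    refine (norm_sub_le _ _).trans ?_
    rw [norm_neg, norm_smul, Real.norm_eq_abs]
    gcongr
    · exact (Q.le_of_opNorm_le hQ _).trans (by gcongr; exact norm_fst_le y)
    · exact (acceleration J b c).le_opNorm y
  have h3 : 0 ≤ ‖inclSnd V H‖ * (M * ‖y‖ + |α - c / b| * (‖acceleration J b c‖ * ‖y‖)) := by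
    positivity
  have h4 : 0 ≤ ‖velocity V H b c‖ * ‖y‖ := by positivity
  calc max _ _ ≤ ‖velocity V H b c‖ * ‖y‖ +
        ‖inclSnd V H‖ * (M * ‖y‖ + |α - c / b| * (‖acceleration J b c‖ * ‖y‖)) :=
        max_le (by linarith) (by linarith)
    _ = _ := by ring

/-- The group of the wave equation, extended by the identity on the first component. -/
def extendGroup (U : ℝ → WithLp 2 (V × H) →L[ℂ] WithLp 2 (V × H)) (t : ℝ) :
    V × WithLp 2 (V × H) →L[ℝ] V × WithLp 2 (V × H) :=
  (ContinuousLinearMap.id ℝ V).prodMap ((U t).restrictScalars ℝ)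

theorem extendGroup_apply (U : ℝ → WithLp 2 (V × H) →L[ℂ] WithLp 2 (V × H)) (t : ℝ)
    (y : V × WithLp 2 (V × H)) : extendGroup U t y = (y.1, U t y.2) := rfl

theorem isIsometryGroup_extendGroup {K : WithLp 2 (V × H) →L[ℂ] WithLp 2 (V × H)}
    {U : ℝ → WithLp 2 (V × H) →L[ℂ] WithLp 2 (V × H)} (hU : IsInverseGroup K U) :
    IsIsometryGroup (extendGroup U) := by
  refine ⟨fun t y => ?_, ?_, fun s t y => ?_, fun y => ?_⟩
  · have := hU.isometryGroup.norm_apply t y.2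
    simp only [ContinuousLinearMap.coe_restrictScalars'] at this
    rw [extendGroup_apply, Prod.norm_def, Prod.norm_def, this]
  · refine ContinuousLinearMap.ext fun y => ?_
    exact Prod.ext rfl (DFunLike.congr_fun hU.isometryGroup.map_zero y.2)
  · exact Prod.ext rfl (hU.isometryGroup.map_add s t y.2)
  · exact continuous_const.prodMk (hU.isometryGroup.continuous_apply y.2)

theorem integrableOn_Ioo_of_continuous {X : Type*} [NormedAddCommGroup X] {g : ℝ → X} {T : ℝ}
    (hg : Continuous g) : IntegrableOn g (Ioo 0 T) :=
  hg.integrableOn_Icc.mono_set Ioo_subset_Icc_self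

/-- The source `F - Q u - (α - c/b) u''` of the wave equation for `w`. -/
theorem integrableOn_source {M : ℝ} (hQ : AEStronglyMeasurable Q (timeMeasure T))
    (hM : ∀ᵐ t ∂(timeMeasure T), ‖Q t‖ ≤ M) (hF : IntegrableOn F (Ioo 0 T))
    (hu : IntegrableOn u (Ioo 0 T)) (ha : IntegrableOn a (Ioo 0 T)) :
    IntegrableOn (fun t => inclSnd V H (F t - Q t (u t) - (α - c / b) • a t)) (Ioo 0 T) := by
  have h1 : IntegrableOn (fun t => Q t (u t)) (Ioo 0 T) := by
    refine Integrable.mono' (hu.norm.const_mul M)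
      (aestronglyMeasurable_clm_apply hQ hu.aestronglyMeasurable) ?_
    filter_upwards [hM] with t ht using (Q t).le_of_opNorm_le ht _
  exact (inclSnd V H).integrable_comp ((hF.sub h1).sub (ha.smul (α - c / b)))

variable [CompleteSpace V] [CompleteSpace H]

/-- Weak solutions of `∂_t³u + α u'' + b A u' + c A u + Q(t) u = F` with `v = u'` and `a = u''`, the
equation being read as an identity between functions with values in the energy space `V`, after
application of `J† = A⁻¹`. -/
structure IsEnergySolution (J : V →L[ℂ] H) (α b c T : ℝ) (Q : ℝ → V →L[ℝ] H) (F : ℝ → H)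
    (u₀ v₀ : V) (a₀ : H) (u v : ℝ → V) (a : ℝ → H) : Prop where
  fst : IsPrimitive T u₀ u v
  snd : IsPrimitive T (J v₀) (fun t => J (v t)) a
  trd : IsPrimitive T ((J†) a₀) (fun t => (J†) (a t))
    (fun t => (J†) (F t - Q t (u t) - α • a t) - b • v t - c • u t)

theorem waveInv_inclSnd (z : H) :
    waveInv J b (inclSnd V H z) = inclFst V H (-((√b)⁻¹ • (J†) z)) := by
  refine (WithLp.equiv 2 (V × H)).injective (Prod.ext rfl ?_)
  change (waveInv J b (inclSnd V H z)).snd = 0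
  rw [waveInv_snd]
  change (((√b)⁻¹ : ℝ) : ℂ) • J 0 = 0
  rw [map_zero, smul_zero]

theorem waveInv_eq (x : WithLp 2 (V × H)) :
    waveInv J b x = inclFst V H (-((√b)⁻¹ • (J†) x.snd)) + inclSnd V H ((√b)⁻¹ • J x.fst) :=
  (inclFst_add_inclSnd _).symm

/-- In the state variables, an energy solution satisfies `(K x)' = x + K k`, where `K` is the
inverse of the wave generator and `k` collects the terms of lower order. -/
theorem IsEnergySolution.isPrimitive_waveInv (hb : 0 < b)
    (h : IsEnergySolution J α b c T Q F u₀ v₀ a₀ u v a) :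
    IsPrimitive T (waveInv J b (stateOf J b c (u₀, v₀, a₀)).2)
      (fun t => waveInv J b (stateOf J b c (u t, v t, a t)).2)
      (fun t => (stateOf J b c (u t, v t, a t)).2 +
        waveInv J b (inclSnd V H (F t - Q t (u t) - (α - c / b) • a t))) := by
  have hr : √b * √b = b := Real.mul_self_sqrt hb.le
  have hr0 : √b ≠ 0 := (Real.sqrt_pos.mpr hb).ne'
  have hc : b * (c / b) = c := by field_simp
  have h1 := h.snd.add ((h.fst.clm (J.restrictScalars ℝ)).smul (c / b))
  have h2 := (h.trd.add ((h.snd.clm ((J†).restrictScalars ℝ)).smul (c / b))).smul (-(√b)⁻¹)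
  have h3 := (h2.clm (inclFst V H)).add (h1.clm (inclSnd V H))
  simp only [ContinuousLinearMap.coe_restrictScalars'] at h3
  have e : ∀ (u v : V) (a : H), waveInv J b (stateOf J b c (u, v, a)).2 =
      inclFst V H (-(√b)⁻¹ • ((J†) a + (c / b) • (J†) (J v))) +
        inclSnd V H (J v + (c / b) • J u) := by
    intro u v a
    rw [waveInv_eq, stateOf_snd_fst, stateOf_snd_snd]
    congr 2
    · simp only [map_add, ContinuousLinearMap.map_smul_of_tower]; module
    · simp only [map_add, ContinuousLinearMap.map_smul_of_tower, smul_smul,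
        inv_mul_cancel₀ hr0, one_smul]
  refine h3.congr (e _ _ _).symm (Eventually.of_forall fun t => (e _ _ _).symm)
    (Eventually.of_forall fun t => ?_)
  beta_reduce
  rw [waveInv_inclSnd, ← inclFst_add_inclSnd (stateOf J b c (u t, v t, a t)).2,
    stateOf_snd_fst, stateOf_snd_snd, add_right_comm, ← map_add]
  congr 2
  simp only [map_sub, ContinuousLinearMap.map_smul_of_tower]
  have k1 : (√b)⁻¹ * b = √b := by
    nth_rewrite 2 [← hr]
    rw [← mul_assoc, inv_mul_cancel₀ hr0, one_mul]
  have k2 : (√b)⁻¹ * c = √b * (c / b) := by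
    nth_rewrite 2 [← k1]
    rw [mul_assoc, hc]
  have k3 : (√b)⁻¹ • b • v t = √b • v t := by rw [smul_smul, k1]
  have k4 : (√b)⁻¹ • c • u t = √b • (c / b) • u t := by rw [smul_smul, k2, smul_smul]
  simp only [neg_smul, smul_sub, smul_add, k3, k4]
  module

/-- Energy solutions with zero data vanish. -/
theorem IsEnergySolution.ae_eq_zero {M : ℝ} (hJ : Function.Injective J) (hJd : DenseRange J)
    (hb : 0 < b) (hM0 : 0 ≤ M) (hQ : AEStronglyMeasurable Q (timeMeasure T))
    (hM : ∀ᵐ t ∂(timeMeasure T), ‖Q t‖ ≤ M) (hu : IntegrableOn u (Ioo 0 T))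
    (h : IsEnergySolution J α b c T Q 0 0 0 0 u v a) : u =ᵐ[timeMeasure T] 0 := by
  obtain ⟨U, hU⟩ := exists_isInverseGroup_waveInv hJ hJd hb
  set y : ℝ → V × WithLp 2 (V × H) := fun t => stateOf J b c (u t, v t, a t) with hy
  have hyi : IntegrableOn y (Ioo 0 T) := (stateOf J b c).integrable_comp
    (hu.prodMk (h.fst.integrableOn.prodMk h.snd.integrableOn))
  have hf := integrableOn_source (α := α) (b := b) (c := c) (F := 0) hQ hM
    (integrable_zero _ _ _) hu h.snd.integrableOn
  have hx := hU.eq_mild_solution (x := fun t => (y t).2) hf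
    ((ContinuousLinearMap.snd ℝ V (WithLp 2 (V × H))).integrable_comp hyi) (by
      filter_upwards [(h.isPrimitive_waveInv hb).ae_eq] with t ht
      have e0 : ((0 : V), (0 : V), (0 : H)) = 0 := rfl
      rw [ht, e0, map_zero, Prod.snd_zero, map_zero, zero_add])
  have hB : ∀ᵐ t ∂(timeMeasure T), ‖lowerOrder J α b c (Q t)‖ ≤ _ :=
    hM.mono fun t ht => norm_lowerOrder_le ht
  have e : ∀ t, lowerOrder J α b c (Q t) (y t) =
      (v t, inclSnd V H ((0 : ℝ → H) t - Q t (u t) - (α - c / b) • a t)) := fun t => by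
    rw [lowerOrder_apply, velocity_stateOf hb, acceleration_stateOf hb, Pi.zero_apply, zero_sub]
    rfl
  have hS := isIsometryGroup_extendGroup hU
  have key := mild_solution_eq_zero hS (by positivity) hB hyi (by
    filter_upwards [hx, h.fst.ae_eq, ae_restrict_mem measurableSet_Ioo] with t ht1 ht2 ht
    have hint : IntervalIntegrable (fun τ => extendGroup U (-τ) (lowerOrder J α b c (Q τ) (y τ)))
        volume 0 t := by
      rw [intervalIntegrable_iff_integrableOn_Ioo_of_le ht.1.le]
      refine hS.integrable_neg (IntegrableOn.mono_set ?_ (Ioo_subset_Ioo_right ht.2.le))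
      simp only [e]
      exact h.fst.integrableOn.prodMk hf
    have i1 := (ContinuousLinearMap.fst ℝ V (WithLp 2 (V × H))).intervalIntegral_comp_comm hint
    have i2 := (ContinuousLinearMap.snd ℝ V (WithLp 2 (V × H))).intervalIntegral_comp_comm hint
    simp only [ContinuousLinearMap.coe_fst', ContinuousLinearMap.coe_snd', extendGroup_apply,
      e] at i1 i2
    rw [extendGroup_apply]
    simp only [extendGroup_apply, e]
    refine Prod.ext ?_ ?_
    · rw [← i1]
      exact ht2.trans (zero_add _)
    · rw [← i2]
      exact ht1)
  filter_upwards [key] with t ht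
  exact congrArg Prod.fst ht

/-- Existence of energy solutions, with a bound that is uniform with respect to the potential. -/
theorem exists_energySolution (hJ : Function.Injective J) (hJd : DenseRange J) (hb : 0 < b)
    (α c : ℝ) {M : ℝ} (hM0 : 0 ≤ M) (hT : 0 < T) :
    ∃ C : ℝ, 0 ≤ C ∧ ∀ Q : ℝ → V →L[ℝ] H, AEStronglyMeasurable Q (timeMeasure T) →
      (∀ᵐ t ∂(timeMeasure T), ‖Q t‖ ≤ M) → ∀ (u₀ v₀ : V) (a₀ : H) (F : ℝ → H),
      IntegrableOn F (Ioo 0 T) → ∃ (u v : ℝ → V) (a : ℝ → H),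
        Continuous u ∧ Continuous v ∧ Continuous a ∧
        IsEnergySolution J α b c T Q F u₀ v₀ a₀ u v a ∧
        ∀ t ∈ Icc 0 T, ‖u t‖ ≤ C * (‖u₀‖ + ‖v₀‖ + ‖a₀‖ + ∫ τ in Ioo 0 T, ‖F τ‖) ∧
          ‖v t‖ ≤ C * (‖u₀‖ + ‖v₀‖ + ‖a₀‖ + ∫ τ in Ioo 0 T, ‖F τ‖) ∧
          ‖a t‖ ≤ C * (‖u₀‖ + ‖v₀‖ + ‖a₀‖ + ∫ τ in Ioo 0 T, ‖F τ‖) := by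
  obtain ⟨U, hU⟩ := exists_isInverseGroup_waveInv hJ hJd hb
  have hS := isIsometryGroup_extendGroup hU
  set β : ℝ := ‖velocity V H b c‖ + ‖inclSnd V H‖ * (M + |α - c / b| * ‖acceleration J b c‖)
  set C₁ : ℝ := (‖stateOf J b c‖ + ‖inclSnd V H‖) * Real.exp (β * T) with hC₁
  have hC₁0 : 0 ≤ C₁ := by positivity
  refine ⟨(1 + ‖velocity V H b c‖ + ‖acceleration J b c‖) * C₁, by positivity, ?_⟩
  intro Q hQ hM u₀ v₀ a₀ F hF
  have hB : ∀ᵐ t ∂(timeMeasure T), ‖lowerOrder J α b c (Q t)‖ ≤ β :=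
    hM.mono fun t ht => norm_lowerOrder_le ht
  have hBm : AEStronglyMeasurable (fun t => lowerOrder J α b c (Q t)) (timeMeasure T) :=
    continuous_lowerOrder.comp_aestronglyMeasurable hQ
  have hf : IntegrableOn (fun t => ((0 : V), inclSnd V H (F t))) (Ioo 0 T) :=
    (integrable_zero _ _ _).prodMk ((inclSnd V H).integrable_comp hF)
  obtain ⟨y, hyc, hyS, hyb⟩ := exists_mild_solution hS hT.le (by positivity) hBm hB hf
    (stateOf J b c (u₀, v₀, a₀))
  have hvc : Continuous fun t => velocity V H b c (y t) := (velocity V H b c).continuous.comp hyc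
  have hac : Continuous fun t => acceleration J b c (y t) :=
    (acceleration J b c).continuous.comp hyc
  have hk := integrableOn_source (α := α) (b := b) (c := c) hQ hM hF
    (integrableOn_Ioo_of_continuous hyc.fst) (integrableOn_Ioo_of_continuous hac)
  have e : ∀ t, lowerOrder J α b c (Q t) (y t) + ((0 : V), inclSnd V H (F t)) =
      (velocity V H b c (y t),
        inclSnd V H (F t - Q t (y t).1 - (α - c / b) • acceleration J b c (y t))) := fun t => by
    rw [lowerOrder_apply]
    refine Prod.ext (add_zero _) ?_
    change inclSnd V H _ + inclSnd V H _ = inclSnd V H _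
    rw [← map_add]
    congr 1
    abel
  have hint : ∀ t ∈ Icc 0 T, IntervalIntegrable (fun τ => extendGroup U (-τ)
      (lowerOrder J α b c (Q τ) (y τ) + ((0 : V), inclSnd V H (F τ)))) volume 0 t := by
    intro t ht
    rw [intervalIntegrable_iff_integrableOn_Ioo_of_le ht.1]
    refine hS.integrable_neg (IntegrableOn.mono_set ?_ (Ioo_subset_Ioo_right ht.2))
    simp only [e]
    exact (integrableOn_Ioo_of_continuous hvc).prodMk hk
  have hfst : ∀ t ∈ Icc 0 T, (y t).1 = u₀ + ∫ τ in 0..t, velocity V H b c (y τ) := by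
    intro t ht
    have i1 := (ContinuousLinearMap.fst ℝ V (WithLp 2 (V × H))).intervalIntegral_comp_comm
      (hint t ht)
    simp only [ContinuousLinearMap.coe_fst', extendGroup_apply, e] at i1
    rw [i1]
    have := congrArg Prod.fst (hyS t ht)
    simpa only [extendGroup_apply, e, Prod.fst_add, stateOf_fst] using this
  have hsnd : ∀ t ∈ Icc 0 T, (y t).2 = U t ((stateOf J b c (u₀, v₀, a₀)).2 + ∫ τ in 0..t,
      U (-τ) (inclSnd V H (F τ - Q τ (y τ).1 - (α - c / b) • acceleration J b c (y τ)))) := by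
    intro t ht
    have i1 := (ContinuousLinearMap.snd ℝ V (WithLp 2 (V × H))).intervalIntegral_comp_comm
      (hint t ht)
    simp only [ContinuousLinearMap.coe_snd', extendGroup_apply, e] at i1
    rw [i1]
    have := congrArg Prod.snd (hyS t ht)
    simpa only [extendGroup_apply, e, Prod.snd_add] using this
  have hu : IsPrimitive T u₀ (fun t => (y t).1) (fun t => velocity V H b c (y t)) :=
    IsPrimitive.of_forall (integrableOn_Ioo_of_continuous hvc) hfst
  have hK : IsPrimitive T _ _ _ := IsPrimitive.of_forall
    ((integrableOn_Ioo_of_continuous hyc.snd).add ((waveInv J b).integrable_comp hk))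
    (hU.map_mild_solution hk hyc.snd _ hsnd)
  have hr : √b * √b = b := Real.mul_self_sqrt hb.le
  have hr0 : √b ≠ 0 := (Real.sqrt_pos.mpr hb).ne'
  have k4 : ∀ x : V, √b • (√b)⁻¹ • x = x := fun x => by
    rw [smul_smul, mul_inv_cancel₀ hr0, one_smul]
  -- The two components of the equation for `K x`: `J w` is a primitive of `w'`, and
  -- `-b^{-1/2} J† w'` is one of `√b w - b^{-1/2} J† k`, where `k` collects the terms of lower order.
  have hJw : IsPrimitive T ((√b)⁻¹ • J (stateOf J b c (u₀, v₀, a₀)).2.fst)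
      (fun t => (√b)⁻¹ • J (y t).2.fst) (fun t => (y t).2.snd) := by
    refine (hK.clm ((WithLp.sndL 2 ℂ V H).restrictScalars ℝ)).congr rfl EventuallyEq.rfl
      (Eventually.of_forall fun t => ?_)
    beta_reduce
    rw [Pi.add_apply, waveInv_inclSnd]
    exact add_zero _
  have hJz : IsPrimitive T (-((√b)⁻¹ • (J†) (stateOf J b c (u₀, v₀, a₀)).2.snd))
      (fun t => -((√b)⁻¹ • (J†) (y t).2.snd))
      (fun t => (y t).2.fst - (√b)⁻¹ • (J†)
        (F t - Q t (y t).1 - (α - c / b) • acceleration J b c (y t))) := by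
    refine (hK.clm ((WithLp.fstL 2 ℂ V H).restrictScalars ℝ)).congr rfl EventuallyEq.rfl
      (Eventually.of_forall fun t => ?_)
    beta_reduce
    rw [Pi.add_apply, waveInv_inclSnd]
    exact (sub_eq_add_neg _ _).symm
  -- Return to `u`, `u'` and `u''`.
  have hsnd' : IsPrimitive T (J v₀) (fun t => J (velocity V H b c (y t)))
      (fun t => acceleration J b c (y t)) := by
    refine (hJw.add ((hu.clm (J.restrictScalars ℝ)).smul (-(c / b)))).congr ?_
      (Eventually.of_forall fun t => ?_) (Eventually.of_forall fun t => ?_)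
    · rw [stateOf_snd_fst]
      simp only [map_add, ContinuousLinearMap.map_smul_of_tower,
        ContinuousLinearMap.coe_restrictScalars', smul_smul,
        inv_mul_cancel₀ hr0]
      module
    · simp only [velocity_apply, map_sub, ContinuousLinearMap.map_smul_of_tower,
        ContinuousLinearMap.coe_restrictScalars']
      module
    · simp only [acceleration_apply, ContinuousLinearMap.coe_restrictScalars']
      module
  refine ⟨fun t => (y t).1, fun t => velocity V H b c (y t), fun t => acceleration J b c (y t),
    hyc.fst, hvc, hac, ⟨hu, hsnd', ?_⟩, ?_⟩
  · refine ((hJz.smul (-√b)).add ((hsnd'.clm ((J†).restrictScalars ℝ)).smul (-(c / b)))).congr ?_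
      (Eventually.of_forall fun t => ?_) (Eventually.of_forall fun t => ?_)
    · rw [stateOf_snd_snd]
      simp only [map_add, ContinuousLinearMap.map_smul_of_tower,
        ContinuousLinearMap.coe_restrictScalars', smul_neg,
        neg_smul, k4]
      module
    · simp only [acceleration_apply, map_sub, ContinuousLinearMap.map_smul_of_tower,
        ContinuousLinearMap.coe_restrictScalars', smul_neg, neg_smul, k4]
      module
    · have k1 : b * (√b)⁻¹ = √b := by
        nth_rewrite 1 [← hr]
        rw [mul_assoc, mul_inv_cancel₀ hr0, mul_one]
      have k2 : b • (√b)⁻¹ • (y t).2.fst = √b • (y t).2.fst := by rw [smul_smul, k1]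
      have k3 : b • (c / b) • (y t).1 = c • (y t).1 := by
        rw [smul_smul, mul_div_cancel₀ _ hb.ne']
      simp only [velocity_apply, smul_sub, neg_smul, k4, map_sub,
        ContinuousLinearMap.map_smul_of_tower,
        ContinuousLinearMap.coe_restrictScalars', k2, k3]
      module
  · intro t ht
    set R : ℝ := ‖u₀‖ + ‖v₀‖ + ‖a₀‖ + ∫ τ in Ioo 0 T, ‖F τ‖ with hR
    have hI0 : 0 ≤ ∫ τ in Ioo 0 T, ‖F τ‖ := integral_nonneg fun _ => norm_nonneg _
    have hR0 : 0 ≤ R := by positivity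
    have h1 : ‖stateOf J b c (u₀, v₀, a₀)‖ ≤ ‖stateOf J b c‖ * R := by
      refine ((stateOf J b c).le_opNorm _).trans ?_
      gcongr
      simp only [Prod.norm_def]
      have n1 := norm_nonneg u₀
      have n2 := norm_nonneg v₀
      have n3 := norm_nonneg a₀
      exact max_le (by linarith) (max_le (by linarith) (by linarith))
    have h2 : ∫ τ in Ioo 0 T, ‖((0 : V), inclSnd V H (F τ))‖ ≤ ‖inclSnd V H‖ * R := by
      calc _ ≤ ∫ τ in Ioo 0 T, ‖inclSnd V H‖ * ‖F τ‖ := by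
            refine integral_mono hf.norm (hF.norm.const_mul _) fun τ => ?_
            simp only [Prod.norm_def, norm_zero]
            exact max_le (by positivity) ((inclSnd V H).le_opNorm _)
        _ = ‖inclSnd V H‖ * ∫ τ in Ioo 0 T, ‖F τ‖ := integral_const_mul _ _
        _ ≤ _ := by
            gcongr
            linarith [norm_nonneg u₀, norm_nonneg v₀, norm_nonneg a₀]
    have h3 : ‖y t‖ ≤ C₁ * R := by
      refine (hyb t ht).trans ?_
      rw [hC₁, mul_right_comm]
      gcongr
      rw [add_mul]
      exact add_le_add h1 h2
    have hm : ∀ d : ℝ, 0 ≤ d → d ≤ 1 + ‖velocity V H b c‖ + ‖acceleration J b c‖ →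
        d * ‖y t‖ ≤ (1 + ‖velocity V H b c‖ + ‖acceleration J b c‖) * C₁ * R := by
      intro d hd0 hd
      rw [mul_assoc]
      gcongr
    have n1 := norm_nonneg (velocity V H b c)
    have n2 := norm_nonneg (acceleration J b c)
    refine ⟨?_, ?_, ?_⟩
    · refine (norm_fst_le (y t)).trans ?_
      have := hm 1 zero_le_one (by linarith)
      rwa [one_mul] at this
    · exact ((velocity V H b c).le_opNorm _).trans (hm _ n1 (by linarith))
    · exact ((acceleration J b c).le_opNorm _).trans (hm _ n2 (by linarith))

end System

/-! ### Sobolev spaces on the Fourier side -/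

section Fourier

variable {E : Type*} [NormedAddCommGroup E] [InnerProductSpace ℝ E] [FiniteDimensional ℝ E]
  [MeasurableSpace E] [BorelSpace E] {r s t σ : ℝ}

/-- `H^r(ℝⁿ)` is a Hilbert space for `⟨u, v⟩ = ∫ ⟨ξ⟩^{2r} conj(û) v̂`. -/
instance : InnerProductSpace ℂ (Hs E r) where
  inner u v := inner ℂ (Hs.bessel u) (Hs.bessel v)
  norm_sq_eq_re_inner u := by
    rw [Hs.norm_eq]
    exact InnerProductSpace.norm_sq_eq_re_inner _
  conj_inner_symm u v := InnerProductSpace.conj_inner_symm _ _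
  add_left u v w := by rw [map_add, inner_add_left]
  smul_left u v a := by rw [map_smul, inner_smul_left]

theorem Hs.inner_eq (u v : Hs E r) : inner ℂ u v = inner ℂ (Hs.bessel u) (Hs.bessel v) := rfl

/-- A locally integrable function is determined almost everywhere by its integrals against
Schwartz functions. -/
theorem ae_eq_of_integral_schwartz_mul_eq {f g : E → ℂ} (hf : LocallyIntegrable f)
    (hg : LocallyIntegrable g)
    (h : ∀ ψ : 𝓢(E, ℂ), ∫ x, ψ x * f x = ∫ x, ψ x * g x) : f =ᵐ[volume] g := by
  refine ae_eq_of_integral_contDiff_smul_eq hf hg fun χ hχ hc => ?_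
  have hc' : HasCompactSupport fun x => (χ x : ℂ) := hc.comp_left (g := ((↑) : ℝ → ℂ)) (by simp)
  have hχ' : ContDiff ℝ ∞ fun x => (χ x : ℂ) := Complex.ofRealCLM.contDiff.comp hχ
  simpa using h (hc'.toSchwartzMap hχ')

theorem Hs.continuous_weight (r : ℝ) :
    Continuous fun ξ : E => (((1 + ‖ξ‖ ^ 2) ^ r : ℝ) : ℂ) := by
  refine Complex.continuous_ofReal.comp (Continuous.rpow_const (by fun_prop) fun ξ => Or.inl ?_)
  positivity

theorem Hs.locallyIntegrable_fourierFun (u : Hs E r) : LocallyIntegrable u.fourierFun := by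
  have h : LocallyIntegrable (𝓕 (Hs.bessel u) : L2Rn E) :=
    (Lp.memLp _).locallyIntegrable one_le_two
  have := h.continuous_smul (Hs.continuous_weight (E := E) (-r / 2))
  exact this

/-- The Fourier transform is determined by its action on Schwartz functions. -/
theorem Hs.fourierFun_ae_eq {u : Hs E r} {g : E → ℂ} (hg : LocallyIntegrable g)
    (h : ∀ ψ : 𝓢(E, ℂ), (𝓕 u.toDist) ψ = ∫ ξ, ψ ξ * g ξ) : u.fourierFun =ᵐ[volume] g :=
  ae_eq_of_integral_schwartz_mul_eq u.locallyIntegrable_fourierFun hg fun ψ => by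
    rw [← Hs.fourier_toDist_apply, h]

theorem Hs.fourierFun_embed (h : t ≤ r) (u : Hs E r) :
    (Hs.embed h u).fourierFun =ᵐ[volume] u.fourierFun :=
  Hs.fourierFun_ae_eq u.locallyIntegrable_fourierFun fun ψ => by
    rw [Hs.toDist_embed, Hs.fourier_toDist_apply]

theorem Hs.fourierFun_zero_order (u : Hs E 0) : u.fourierFun = (𝓕 u.toL2 : L2Rn E) := by
  funext ξ
  simp [Hs.fourierFun, Hs.toL2]

theorem Hs.fourier_bessel_ae_eq (u : Hs E r) : (𝓕 (Hs.bessel u) : L2Rn E) =ᵐ[volume]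
    fun ξ => (((1 + ‖ξ‖ ^ 2) ^ (r / 2) : ℝ) : ℂ) * u.fourierFun ξ := by
  refine Eventually.of_forall fun ξ => ?_
  simp only [Hs.fourierFun]
  rw [← mul_assoc, ← Complex.ofReal_mul, ← Real.rpow_add (by positivity)]
  ring_nf
  simp

theorem Hs.inner_eq_integral_zero_order (u v : Hs E 0) :
    inner ℂ u v = ∫ ξ, starRingEnd ℂ (u.fourierFun ξ) * v.fourierFun ξ := by
  rw [Hs.inner_eq, ← Lp.inner_fourier_eq, L2.inner_def, Hs.fourierFun_zero_order,
    Hs.fourierFun_zero_order]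
  exact integral_congr_ae (Eventually.of_forall fun ξ => RCLike.inner_apply' _ _)

theorem Hs.ext_pair {u v : Hs E r} (h : ∀ ψ : 𝓢(E, ℂ), u.pair ψ = v.pair ψ) : u = v :=
  Hs.toDist_injective (by ext ψ; exact h ψ)

theorem Hs.pair_embed (h : t ≤ r) (u : Hs E r) (ψ : 𝓢(E, ℂ)) :
    (Hs.embed h u).pair ψ = u.pair ψ := by
  rw [Hs.pair, Hs.toDist_embed, Hs.pair]

theorem Hs.pair_add (u v : Hs E r) (ψ : 𝓢(E, ℂ)) : (u + v).pair ψ = u.pair ψ + v.pair ψ := by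
  simp [Hs.pair]

theorem Hs.pair_smul (a : ℂ) (u : Hs E r) (ψ : 𝓢(E, ℂ)) : (a • u).pair ψ = a * u.pair ψ := by
  simp [Hs.pair]

theorem Hs.pair_eq_integral_fourier (u : Hs E r) (ψ : 𝓢(E, ℂ)) :
    u.pair ψ = ∫ ξ, (𝓕⁻ ψ) ξ * u.fourierFun ξ := by
  rw [← Hs.fourier_toDist_apply, TemperedDistribution.fourier_apply]
  simp [Hs.pair]

/-- A Schwartz function as an element of `H^r(ℝⁿ)`. -/
def Hs.ofSchwartz (r : ℝ) : 𝓢(E, ℂ) →ₗ[ℂ] Hs E r where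
  toFun φ := Hs.ofDist (φ : 𝓢'(E, ℂ)) φ.memSobolev
  map_add' φ ψ := by
    apply Hs.toDist_injective
    rw [LinearMap.map_add Hs.toDist, Hs.toDist_ofDist, Hs.toDist_ofDist, Hs.toDist_ofDist,
      ContinuousLinearMap.map_add]
  map_smul' a φ := by
    apply Hs.toDist_injective
    rw [LinearMap.map_smul Hs.toDist, Hs.toDist_ofDist, Hs.toDist_ofDist,
      ContinuousLinearMap.map_smul, RingHom.id_apply]

theorem Hs.toDist_ofSchwartz (φ : 𝓢(E, ℂ)) : (Hs.ofSchwartz r φ).toDist = (φ : 𝓢'(E, ℂ)) :=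
  Hs.toDist_ofDist _ _

theorem Hs.embed_ofSchwartz (h : t ≤ r) (φ : 𝓢(E, ℂ)) :
    Hs.embed h (Hs.ofSchwartz r φ) = Hs.ofSchwartz t φ :=
  Hs.toDist_injective (by rw [Hs.toDist_embed, Hs.toDist_ofSchwartz, Hs.toDist_ofSchwartz])

theorem Hs.pair_ofSchwartz (φ ψ : 𝓢(E, ℂ)) :
    (Hs.ofSchwartz r φ).pair ψ = ∫ x, ψ x * φ x := by
  rw [Hs.pair, Hs.toDist_ofSchwartz, SchwartzMap.coe_apply]
  rfl

theorem Hs.toL2_ofSchwartz (φ : 𝓢(E, ℂ)) : (Hs.ofSchwartz 0 φ).toL2 = φ.toLp 2 := by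
  apply toDist_L2_injective
  beta_reduce
  rw [Hs.toL2_spec, Hs.toDist_ofSchwartz, Lp.toTemperedDistribution_toLp_eq]

theorem Hs.fourierFun_ofSchwartz (φ : 𝓢(E, ℂ)) :
    (Hs.ofSchwartz r φ).fourierFun =ᵐ[volume] (𝓕 φ : 𝓢(E, ℂ)) := by
  refine Hs.fourierFun_ae_eq (𝓕 φ).integrable.locallyIntegrable fun ψ => ?_
  rw [Hs.toDist_ofSchwartz, TemperedDistribution.fourier_toTemperedDistributionCLM_eq,
    SchwartzMap.coe_apply]
  rfl

/-- The complex conjugate of a Schwartz function. -/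
def conjSchwartz : 𝓢(E, ℂ) →L[ℝ] 𝓢(E, ℂ) :=
  SchwartzMap.postcompCLM (Complex.conjCLE : ℂ →L[ℝ] ℂ)

theorem conjSchwartz_apply (φ : 𝓢(E, ℂ)) (x : E) : conjSchwartz φ x = starRingEnd ℂ (φ x) := rfl

/-- Conjugation exchanges the Fourier transform with its inverse. -/
theorem conj_fourier_conjSchwartz (φ : 𝓢(E, ℂ)) (ξ : E) :
    starRingEnd ℂ ((𝓕 (conjSchwartz φ)) ξ) = (𝓕⁻ φ) ξ := by
  rw [SchwartzMap.fourier_coe, SchwartzMap.fourierInv_coe, Real.fourier_eq', Real.fourierInv_eq',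
    ← integral_conj]
  refine integral_congr_ae (Eventually.of_forall fun x => ?_)
  simp [conjSchwartz_apply, ← Complex.exp_conj, map_ofNat (starRingEnd ℂ) 2]

theorem hasCompactSupport_conjSchwartz {φ : 𝓢(E, ℂ)} (h : HasCompactSupport φ) :
    HasCompactSupport (conjSchwartz φ) :=
  h.comp_left (g := starRingEnd ℂ) (map_zero _)

theorem tsupport_conjSchwartz_subset (φ : 𝓢(E, ℂ)) : tsupport (conjSchwartz φ) ⊆ tsupport φ :=
  closure_mono (Function.support_comp_subset (g := starRingEnd ℂ) (map_zero _) φ)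

/-- The duality pairing with `ψ`, in terms of the inner product of `L²(ℝⁿ)`. -/
theorem Hs.pair_eq_inner (u : Hs E 0) (ψ : 𝓢(E, ℂ)) :
    u.pair ψ = inner ℂ (Hs.ofSchwartz 0 (conjSchwartz ψ)) u := by
  rw [Hs.pair_eq_integral_fourier, Hs.inner_eq_integral_zero_order]
  refine integral_congr_ae ?_
  filter_upwards [Hs.fourierFun_ofSchwartz (r := 0) (conjSchwartz ψ)] with ξ hξ
  rw [hξ, conj_fourier_conjSchwartz]

/-- `⟨(-Δ)^s u, ψ⟩ = ⟨(-Δ)^{s/2} conj ψ, (-Δ)^{s/2} u⟩_{L²}`. -/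
theorem Hs.pair_fracLap (hs : 0 ≤ s) (u : Hs E s) (ψ : 𝓢(E, ℂ)) :
    (fracLap s hs (t := -s) (by linarith) u).pair ψ =
      inner ℂ (fracLap (s / 2) (by positivity) (t := 0) (by linarith)
        (Hs.ofSchwartz s (conjSchwartz ψ)))
        (fracLap (s / 2) (by positivity) (t := 0) (by linarith) u) := by
  rw [Hs.pair_eq_integral_fourier, Hs.inner_eq_integral_zero_order]
  refine integral_congr_ae ?_
  filter_upwards [Hs.fourierFun_ofSchwartz (r := s) (conjSchwartz ψ),
    fracLap_fourierFun hs (t := -s) (by linarith) u,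
    fracLap_fourierFun (by positivity : 0 ≤ s / 2) (t := 0) (by linarith) u,
    fracLap_fourierFun (by positivity : 0 ≤ s / 2) (t := 0) (by linarith)
      (Hs.ofSchwartz s (conjSchwartz ψ))] with ξ h1 h2 h3 h4
  rw [h2, h3, h4, h1, map_mul, conj_fourier_conjSchwartz, Complex.conj_ofReal]
  have : (2 * Real.pi * ‖ξ‖) ^ (2 * s) =
      (2 * Real.pi * ‖ξ‖) ^ (2 * (s / 2)) * (2 * Real.pi * ‖ξ‖) ^ (2 * (s / 2)) := by
    rcases hs.eq_or_lt with rfl | hs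
    · simp
    · rw [← Real.rpow_add_of_nonneg (by positivity) (by positivity) (by positivity)]
      ring_nf
  rw [this]
  push_cast
  ring

/-- An `L²` function with integrable Fourier transform is bounded by the `L¹` norm of the
latter. -/
theorem ae_norm_le_integral_norm_fourier (f : L2Rn E) (hf : Integrable (𝓕 f : L2Rn E)) :
    ∀ᵐ x, ‖f x‖ ≤ ∫ ξ, ‖(𝓕 f : L2Rn E) ξ‖ := by
  have hcont : Continuous (𝓕⁻ ((𝓕 f : L2Rn E) : E → ℂ)) := by
    rw [← Real.Lp.fourierTransformInv_toLp (memLp_one_iff_integrable.mpr hf)]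
    exact map_continuous _
  have h : f =ᵐ[volume] 𝓕⁻ ((𝓕 f : L2Rn E) : E → ℂ) := by
    refine ae_eq_of_integral_schwartz_mul_eq ((Lp.memLp f).locallyIntegrable one_le_two)
      hcont.locallyIntegrable fun ψ => ?_
    have h1 : ∫ x, ψ x * f x = ∫ ξ, (𝓕⁻ ψ : 𝓢(E, ℂ)) ξ * (𝓕 f : L2Rn E) ξ := by
      have h2 := Lp.toTemperedDistribution_apply f ψ
      have h3 := Lp.toTemperedDistribution_apply (𝓕 f : L2Rn E) (𝓕⁻ ψ : 𝓢(E, ℂ))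
      rw [← Lp.fourier_toTemperedDistribution_eq, TemperedDistribution.fourier_apply,
        FourierTransform.fourier_fourierInv_eq, h2] at h3
      exact h3
    rw [h1, SchwartzMap.fourierInv_coe]
    have h4 := VectorFourier.integral_fourierIntegral_smul_eq_flip (L := -innerₗ E)
      Real.continuous_fourierChar (by simpa using! continuous_inner.neg)
      (ψ.integrable (μ := volume)) hf
    have h5 : (-innerₗ E).flip = -innerₗ E := by
      ext x y; simp [real_inner_comm]
    rw [h5] at h4
    exact h4
  filter_upwards [h] with x hx
  rw [hx, Real.fourierInv_eq]
  refine (norm_integral_le_integral_norm _).trans (le_of_eq ?_)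
  simp

end Fourier

/-! ### The fractional Poincaré inequality -/

section Poincare

variable {E : Type*} [NormedAddCommGroup E] [InnerProductSpace ℝ E] [FiniteDimensional ℝ E]
  [MeasurableSpace E] [BorelSpace E] {r s t σ : ℝ} {Ω : Set E}

theorem integrable_norm_sq (f : L2Rn E) : Integrable fun x => ‖f x‖ ^ 2 :=
  (memLp_two_iff_integrable_sq_norm (Lp.aestronglyMeasurable f)).mp (Lp.memLp f)

theorem L2_norm_sq (f : L2Rn E) : ‖f‖ ^ 2 = ∫ x, ‖f x‖ ^ 2 := by
  rw [← RCLike.ofReal_inj (K := ℂ)]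
  have h := inner_self_eq_norm_sq_to_K (𝕜 := ℂ) f
  push_cast
  rw [← h, L2.inner_def, ← integral_ofReal]
  refine integral_congr_ae (Eventually.of_forall fun x => ?_)
  have := inner_self_eq_norm_sq_to_K (𝕜 := ℂ) (f x)
  beta_reduce
  rw [this]
  simp

theorem Hs.norm_sq_eq (u : Hs E r) : ‖u‖ ^ 2 = ∫ ξ, ‖(𝓕 (Hs.bessel u) : L2Rn E) ξ‖ ^ 2 := by
  rw [Hs.norm_eq, ← Lp.norm_fourier_eq, L2_norm_sq]

theorem Hs.norm_fourier_bessel_ae_eq (u : Hs E r) :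
    ∀ᵐ ξ, ‖(𝓕 (Hs.bessel u) : L2Rn E) ξ‖ = (1 + ‖ξ‖ ^ 2) ^ (r / 2) * ‖u.fourierFun ξ‖ := by
  filter_upwards [u.fourier_bessel_ae_eq] with ξ hξ
  rw [hξ, norm_mul, Complex.norm_real, Real.norm_of_nonneg (by positivity)]

theorem Hs.norm_embed_le (h : t ≤ r) (u : Hs E r) : ‖Hs.embed h u‖ ≤ ‖u‖ := by
  refine le_of_sq_le_sq ?_ (norm_nonneg _)
  rw [Hs.norm_sq_eq, Hs.norm_sq_eq]
  refine integral_mono_ae (integrable_norm_sq _) (integrable_norm_sq _) ?_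
  filter_upwards [u.norm_fourier_bessel_ae_eq, (Hs.embed h u).norm_fourier_bessel_ae_eq,
    Hs.fourierFun_embed h u] with ξ h1 h2 h3
  rw [h1, h2, h3]
  gcongr
  nlinarith [sq_nonneg ‖ξ‖]

/-- Cauchy-Schwarz inequality `‖φ‖²_{L¹} ≤ |B_R| ‖φ‖²_{L²}` for functions supported in a ball. -/
theorem integral_norm_le_of_tsupport_subset_ball {φ : 𝓢(E, ℂ)} {R : ℝ}
    (hφ : tsupport φ ⊆ Metric.ball 0 R) :
    (∫ x, ‖φ x‖) ^ 2 ≤ volume.real (Metric.ball (0 : E) R) * ‖Hs.ofSchwartz 0 φ‖ ^ 2 := by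
  have h0 : ∀ x, x ∉ Metric.ball (0 : E) R → φ x = 0 := fun x hx => by
    by_contra h
    exact hx (hφ (subset_tsupport _ h))
  have h1 : ‖Hs.ofSchwartz 0 φ‖ ^ 2 = ∫ x, ‖φ x‖ ^ 2 := by
    rw [← Hs.norm_toL2, Hs.toL2_ofSchwartz, L2_norm_sq]
    refine integral_congr_ae ?_
    filter_upwards [φ.coeFn_toLp 2] with x hx
    rw [hx]
  have h2 : ∫ x, ‖φ x‖ = ∫ x in Metric.ball 0 R, ‖φ x‖ :=
    (setIntegral_eq_integral_of_forall_compl_eq_zero fun x hx => by simp [h0 x hx]).symm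
  have h3 : ∫ x, ‖φ x‖ ^ 2 = ∫ x in Metric.ball 0 R, ‖φ x‖ ^ 2 :=
    (setIntegral_eq_integral_of_forall_compl_eq_zero fun x hx => by simp [h0 x hx]).symm
  have hfin : IsFiniteMeasure (volume.restrict (Metric.ball (0 : E) R)) :=
    ⟨by simpa using measure_ball_lt_top⟩
  have hi : Integrable (fun x => ‖φ x‖ ^ 2) :=
    (memLp_two_iff_integrable_sq_norm φ.continuous.aestronglyMeasurable).mp (φ.memLp 2)
  -- Cauchy-Schwarz, from `∫ (|φ| - a)² ≥ 0` with `a` the mean of `|φ|` over the ball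
  set m := volume.real (Metric.ball (0 : E) R) with hm
  set I := ∫ x in Metric.ball 0 R, ‖φ x‖ with hI
  have hquad : ∀ a : ℝ, 0 ≤ (∫ x in Metric.ball 0 R, ‖φ x‖ ^ 2) - 2 * a * I + a ^ 2 * m := by
    intro a
    have : 0 ≤ ∫ x in Metric.ball (0 : E) R, (‖φ x‖ - a) ^ 2 := by positivity
    have e : ∫ x in Metric.ball (0 : E) R, (‖φ x‖ - a) ^ 2 =
        (∫ x in Metric.ball 0 R, ‖φ x‖ ^ 2) - 2 * a * I + a ^ 2 * m := by
      have : ∀ x, (‖φ x‖ - a) ^ 2 = ‖φ x‖ ^ 2 - 2 * a * ‖φ x‖ + a ^ 2 := fun x => by ring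
      simp_rw [this]
      have hi1 : IntegrableOn (fun x => ‖φ x‖) (Metric.ball 0 R) := φ.integrable.norm.integrableOn
      have hi2 : IntegrableOn (fun x => ‖φ x‖ ^ 2 - 2 * a * ‖φ x‖) (Metric.ball 0 R) :=
        hi.integrableOn.sub (hi1.const_mul _)
      rw [integral_add hi2 (integrable_const _), integral_sub hi.integrableOn (hi1.const_mul _),
        integral_const_mul, setIntegral_const, smul_eq_mul, mul_comm m]
    linarith
  rw [h1, h2, h3]
  have h4 := discrim_le_zero (a := m) (b := -2 * I) (c := ∫ x in Metric.ball 0 R, ‖φ x‖ ^ 2)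
    fun a => by have := hquad a; linarith
  rw [discrim] at h4
  linarith

/-- The **fractional Poincaré inequality** for test functions: on a bounded set, the low frequencies
are controlled by the `L¹` norm, hence by a small multiple of the `L²` norm, and can be absorbed; on
the high frequencies, `⟨ξ⟩^{2s}` is bounded by a multiple of `|ξ|^{2s}`. -/
theorem exists_norm_ofSchwartz_le (hn : 0 < Module.finrank ℝ E) (hΩ : Bornology.IsBounded Ω)
    (hs : 0 < s) : ∃ C : ℝ, 0 < C ∧ ∀ φ : 𝓢(E, ℂ), tsupport φ ⊆ Ω →
      ‖Hs.ofSchwartz s φ‖ ≤ C * ‖fracLap (s / 2) (by positivity) (t := 0) (by linarith)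
        (Hs.ofSchwartz s φ)‖ := by
  obtain ⟨R, hR⟩ := hΩ.subset_ball (0 : E)
  set m := volume.real (Metric.ball (0 : E) R) with hm
  set m₁ := volume.real (Metric.ball (0 : E) 1) with hm₁
  have hm0 : 0 ≤ m := measureReal_nonneg
  have hm10 : 0 ≤ m₁ := measureReal_nonneg
  -- The frequencies below `ε` carry at most half of the squared norm of `u`.
  set ε : ℝ := min 1 (1 / (2 * (2 ^ s * m * m₁ + 1))) with hε
  have hε0 : 0 < ε := by positivity
  have hε1 : ε ≤ 1 := min_le_left _ _
  have hball : 2 ^ s * m * volume.real (Metric.ball (0 : E) ε) ≤ 1 / 2 := by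
    rw [Measure.real, Measure.addHaar_ball_of_pos _ _ hε0, ENNReal.toReal_mul,
      ENNReal.toReal_ofReal (by positivity), ← Measure.real, ← hm₁]
    have h1 : ε ^ Module.finrank ℝ E ≤ ε := pow_le_of_le_one hε0.le hε1 hn.ne'
    have h2 : ε * (2 * (2 ^ s * m * m₁ + 1)) ≤ 1 := by
      rw [← le_div_iff₀ (by positivity)]
      exact min_le_right _ _
    have h3 : 2 ^ s * m * (ε ^ Module.finrank ℝ E * m₁) ≤ 2 ^ s * m * (ε * m₁) := by gcongr
    nlinarith
  set κ : ℝ := (1 + ε⁻¹ ^ 2) ^ s with hκ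
  have hκ0 : 0 < κ := by positivity
  refine ⟨√(2 * κ), by positivity, fun φ hφ => ?_⟩
  set u := Hs.ofSchwartz s φ with hu
  set d := fracLap (s / 2) (by positivity) (t := 0) (by linarith) u with hd
  refine le_of_sq_le_sq ?_ (by positivity)
  rw [mul_pow, Real.sq_sqrt (by positivity)]
  have hlow : ∫ ξ in Metric.ball 0 ε, ‖(𝓕 (Hs.bessel u) : L2Rn E) ξ‖ ^ 2 ≤ 1 / 2 * ‖u‖ ^ 2 := by
    have h1 : ∀ᵐ ξ ∂(volume.restrict (Metric.ball (0 : E) ε)),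
        ‖(𝓕 (Hs.bessel u) : L2Rn E) ξ‖ ^ 2 ≤ 2 ^ s * (∫ x, ‖φ x‖) ^ 2 := by
      rw [ae_restrict_iff' Metric.isOpen_ball.measurableSet]
      filter_upwards [u.norm_fourier_bessel_ae_eq, Hs.fourierFun_ofSchwartz (r := s) φ]
        with ξ h1 h2 h3
      rw [h1, h2, mul_pow, ← Real.rpow_mul_natCast (by positivity)]
      have h4 : ‖ξ‖ ^ 2 ≤ 1 := by
        have : ‖ξ‖ ≤ 1 := (by simpa using h3 : ‖ξ‖ < ε).le.trans hε1
        nlinarith [norm_nonneg ξ]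
      have h5 : ‖(𝓕 φ : 𝓢(E, ℂ)) ξ‖ ≤ ∫ x, ‖φ x‖ :=
        (SchwartzMap.norm_fourier_apply_le_toLp_one φ ξ).trans_eq SchwartzMap.norm_toLp_one
      have h6 : s / 2 * ((2 : ℕ) : ℝ) = s := by push_cast; ring
      rw [h6]
      gcongr
      linarith
    calc ∫ ξ in Metric.ball 0 ε, ‖(𝓕 (Hs.bessel u) : L2Rn E) ξ‖ ^ 2
        ≤ ∫ ξ in Metric.ball (0 : E) ε, 2 ^ s * (∫ x, ‖φ x‖) ^ 2 :=
          integral_mono_ae (integrable_norm_sq _).integrableOn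
            (integrableOn_const measure_ball_lt_top.ne) h1
      _ = volume.real (Metric.ball (0 : E) ε) * (2 ^ s * (∫ x, ‖φ x‖) ^ 2) := by
          rw [setIntegral_const, smul_eq_mul]
      _ ≤ volume.real (Metric.ball (0 : E) ε) * (2 ^ s * (m * ‖u‖ ^ 2)) := by
          gcongr
          refine (integral_norm_le_of_tsupport_subset_ball (hφ.trans hR)).trans ?_
          rw [← Hs.embed_ofSchwartz hs.le φ]
          gcongr
          exact Hs.norm_embed_le _ _
      _ = 2 ^ s * m * volume.real (Metric.ball (0 : E) ε) * ‖u‖ ^ 2 := by ring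
      _ ≤ _ := by gcongr
  have hhigh : ∫ ξ in (Metric.ball 0 ε)ᶜ, ‖(𝓕 (Hs.bessel u) : L2Rn E) ξ‖ ^ 2 ≤ κ * ‖d‖ ^ 2 := by
    have h1 : ∀ᵐ ξ ∂(volume.restrict (Metric.ball (0 : E) ε)ᶜ),
        ‖(𝓕 (Hs.bessel u) : L2Rn E) ξ‖ ^ 2 ≤ κ * ‖(𝓕 (Hs.bessel d) : L2Rn E) ξ‖ ^ 2 := by
      rw [ae_restrict_iff' Metric.isOpen_ball.measurableSet.compl]
      filter_upwards [u.norm_fourier_bessel_ae_eq, d.norm_fourier_bessel_ae_eq,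
        fracLap_fourierFun (by positivity : 0 ≤ s / 2) (t := 0) (by linarith) u] with ξ h1 h2 h3 h4
      rw [h1, h2, h3]
      have h5 : ε ≤ ‖ξ‖ := by simpa using h4
      have h6 : (1 + ‖ξ‖ ^ 2 : ℝ) ≤ (1 + ε⁻¹ ^ 2) * (2 * Real.pi * ‖ξ‖) ^ 2 := by
        have h7 : 1 ≤ ε⁻¹ ^ 2 * ‖ξ‖ ^ 2 := by
          rw [← mul_pow]
          exact one_le_pow₀ (by rwa [← div_eq_inv_mul, one_le_div₀ hε0])
        have h8 : (1 : ℝ) ≤ (2 * Real.pi) ^ 2 :=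
          one_le_pow₀ (by linarith [Real.pi_gt_three])
        calc (1 + ‖ξ‖ ^ 2 : ℝ) ≤ (1 + ε⁻¹ ^ 2) * ‖ξ‖ ^ 2 * 1 := by linarith
          _ ≤ (1 + ε⁻¹ ^ 2) * ‖ξ‖ ^ 2 * (2 * Real.pi) ^ 2 := by gcongr
          _ = _ := by ring
      have h9 : (1 + ‖ξ‖ ^ 2 : ℝ) ^ s ≤ κ * ((2 * Real.pi * ‖ξ‖) ^ 2) ^ s := by
        rw [hκ, ← Real.mul_rpow (by positivity) (by positivity)]
        exact Real.rpow_le_rpow (by positivity) h6 hs.le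
      have h10 : ((1 + ‖ξ‖ ^ 2 : ℝ) ^ (s / 2)) ^ 2 = (1 + ‖ξ‖ ^ 2) ^ s := by
        rw [← Real.rpow_mul_natCast (by positivity)]
        congr 1; push_cast; ring
      have h11 : ((2 * Real.pi * ‖ξ‖) ^ (2 * (s / 2))) ^ 2 = ((2 * Real.pi * ‖ξ‖) ^ 2) ^ s := by
        rw [← Real.rpow_natCast _ 2, ← Real.rpow_mul (by positivity), ← Real.rpow_natCast _ 2,
          ← Real.rpow_mul (by positivity)]
        congr 1; push_cast; ring
      rw [mul_pow, mul_pow, norm_mul, mul_pow, Complex.norm_real,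
        Real.norm_of_nonneg (by positivity), h10, h11]
      simp only [zero_div, Real.rpow_zero, one_pow, one_mul]
      rw [← mul_assoc]
      gcongr
    calc ∫ ξ in (Metric.ball 0 ε)ᶜ, ‖(𝓕 (Hs.bessel u) : L2Rn E) ξ‖ ^ 2
        ≤ ∫ ξ in (Metric.ball 0 ε)ᶜ, κ * ‖(𝓕 (Hs.bessel d) : L2Rn E) ξ‖ ^ 2 :=
          integral_mono_ae (integrable_norm_sq _).integrableOn
            ((integrable_norm_sq _).const_mul _).integrableOn h1
      _ ≤ ∫ ξ, κ * ‖(𝓕 (Hs.bessel d) : L2Rn E) ξ‖ ^ 2 :=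
          setIntegral_le_integral ((integrable_norm_sq _).const_mul _)
            (Eventually.of_forall fun ξ => by positivity)
      _ = κ * ‖d‖ ^ 2 := by rw [integral_const_mul, ← Hs.norm_sq_eq]
  have := integral_add_compl (Metric.isOpen_ball (x := (0 : E)) (ε := ε)).measurableSet
    (integrable_norm_sq (𝓕 (Hs.bessel u) : L2Rn E))
  rw [← Hs.norm_sq_eq] at this
  linarith

/-- The operator `(-Δ)^{s/2} : H̃^s(Ω) → L²(ℝⁿ)`. -/
def halfLapCLM (Ω : Set E) (hs : 0 < s) : Htilde Ω s →L[ℂ] Hs E 0 :=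
  fracLap (s / 2) (by positivity) (by linarith) ∘L (Htilde Ω s).subtypeL

theorem ofSchwartz_mem_testSubmodule {φ : 𝓢(E, ℂ)} (h : HasCompactSupport φ)
    (h' : tsupport φ ⊆ Ω) : Hs.ofSchwartz r φ ∈ testSubmodule Ω r :=
  ⟨φ, h, h', Hs.toDist_ofSchwartz φ⟩

theorem exists_eq_ofSchwartz {u : Hs E r} (hu : u ∈ testSubmodule Ω r) :
    ∃ φ : 𝓢(E, ℂ), HasCompactSupport φ ∧ tsupport φ ⊆ Ω ∧ u = Hs.ofSchwartz r φ := by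
  obtain ⟨φ, h1, h2, h3⟩ := hu
  exact ⟨φ, h1, h2, Hs.toDist_injective (h3.trans (Hs.toDist_ofSchwartz φ).symm)⟩

/-- A function in `C_c^∞(Ω)` as an element of `H̃^r(Ω)`. -/
def Htilde.ofTest (r : ℝ) (φ : 𝓢(E, ℂ)) (h : HasCompactSupport φ) (h' : tsupport φ ⊆ Ω) :
    Htilde Ω r :=
  ⟨Hs.ofSchwartz r φ, subset_closure (ofSchwartz_mem_testSubmodule h h')⟩

theorem Htilde.embed_ofTest (hr : 0 ≤ r) (φ : 𝓢(E, ℂ)) (h : HasCompactSupport φ)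
    (h' : tsupport φ ⊆ Ω) :
    Htilde.embed hr (Htilde.ofTest r φ h h') = Htilde.ofTest 0 φ h h' :=
  Subtype.ext (Hs.embed_ofSchwartz hr φ)

/-- Properties which are closed under limits hold in `H̃^r(Ω)` if they hold for test functions. -/
theorem Htilde.induction {P : Htilde Ω r → Prop} (hP : IsClosed {u | P u})
    (h : ∀ φ hφ hφ', P (Htilde.ofTest r φ hφ hφ')) (u : Htilde Ω r) : P u := by
  have hd : Dense {u : Htilde Ω r | (u : Hs E r) ∈ testSubmodule Ω r} := by
    intro u
    rw [closure_subtype]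
    refine closure_mono ?_ u.2
    intro v hv
    exact ⟨⟨v, subset_closure hv⟩, hv, rfl⟩
  refine hP.closure_subset_iff.mpr ?_ (hd u)
  intro v hv
  obtain ⟨φ, h1, h2, h3⟩ := exists_eq_ofSchwartz hv
  have : v = Htilde.ofTest r φ h1 h2 := Subtype.ext h3
  rw [this]
  exact h φ h1 h2

/-- The **fractional Poincaré inequality**: on `H̃^s(Ω)`, `Ω` bounded, the energy norm is
equivalent to the norm of `H^s(ℝⁿ)`. -/
theorem exists_norm_le_halfLap (hn : 0 < Module.finrank ℝ E) (hΩ : Bornology.IsBounded Ω)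
    (hs : 0 < s) : ∃ C : ℝ, 0 < C ∧ ∀ u : Htilde Ω s, ‖u‖ ≤ C * ‖halfLap hs u‖ := by
  obtain ⟨C, hC, h⟩ := exists_norm_ofSchwartz_le hn hΩ hs
  refine ⟨C, hC, fun u => ?_⟩
  induction u using Htilde.induction with
  | hP =>
    have h1 : Continuous fun u : Htilde Ω s => C * ‖halfLapCLM Ω hs u‖ := by fun_prop
    exact isClosed_le (continuous_norm (E := Htilde Ω s)) h1
  | h φ hφ hφ' => exact h φ hφ'

theorem Htilde.embed_injective (hr : 0 ≤ r) :
    Function.Injective (Htilde.embed (Ω := Ω) hr) := by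
  intro u v h
  refine Subtype.ext (Hs.toDist_injective ?_)
  rw [← Hs.toDist_embed hr, ← Hs.toDist_embed hr]
  exact congrArg (fun w : Htilde Ω 0 => (w : Hs E 0).toDist) h

theorem Htilde.denseRange_embed (hr : 0 ≤ r) : DenseRange (Htilde.embed (Ω := Ω) hr) := by
  intro u
  induction u using Htilde.induction with
  | hP => exact isClosed_closure
  | h φ hφ hφ' => exact subset_closure ⟨Htilde.ofTest r φ hφ hφ', Htilde.embed_ofTest hr φ hφ hφ'⟩

end Poincare

/-! ### The Sobolev embedding -/

section SobolevEmbedding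

variable {E : Type*} [NormedAddCommGroup E] [InnerProductSpace ℝ E] [FiniteDimensional ℝ E]
  [MeasurableSpace E] [BorelSpace E] {r s t σ : ℝ} {Ω : Set E}

theorem ofReal_norm_sq_L2 (f : L2Rn E) :
    ENNReal.ofReal (‖f‖ ^ 2) = ∫⁻ x, ENNReal.ofReal (‖f x‖ ^ 2) := by
  rw [L2_norm_sq, ofReal_integral_eq_lintegral_ofReal (integrable_norm_sq f)
    (Eventually.of_forall fun x => by positivity)]

/-- Splitting of `u ∈ H^r(ℝⁿ)` into its frequencies in `S` and in the complement of `S`. If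
`⟨ξ⟩^{-r}` is square integrable on `S`, then the first part is bounded. -/
theorem exists_frequency_split (hr : 0 ≤ r) (u : Hs E r) {S : Set E} (hS : MeasurableSet S)
    (hI : IntegrableOn (fun ξ => (1 + ‖ξ‖ ^ 2) ^ (-r)) S) :
    ∃ f₁ f₂ : L2Rn E, (Hs.embed hr u).toL2 = f₁ + f₂ ∧
      (∀ᵐ x, ‖f₁ x‖ ≤ √(∫ ξ in S, (1 + ‖ξ‖ ^ 2) ^ (-r)) * ‖u‖) ∧
      ∫⁻ x, ENNReal.ofReal (‖f₂ x‖ ^ 2) = ∫⁻ ξ in Sᶜ, ENNReal.ofReal (‖u.fourierFun ξ‖ ^ 2) := by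
  set f := (Hs.embed hr u).toL2 with hf
  set g : L2Rn E := 𝓕 f with hg
  have hgu : g =ᵐ[volume] u.fourierFun := by
    rw [hg, hf, ← Hs.fourierFun_zero_order]
    exact Hs.fourierFun_embed hr u
  set g₁ : L2Rn E := ((Lp.memLp g).indicator hS).toLp _ with hg₁
  set g₂ : L2Rn E := ((Lp.memLp g).indicator hS.compl).toLp _ with hg₂
  have e₁ : g₁ =ᵐ[volume] S.indicator u.fourierFun := by
    filter_upwards [hgu, ((Lp.memLp g).indicator hS).coeFn_toLp] with ξ h1 h2
    rw [h2]
    simp [indicator, h1]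
  have e₂ : g₂ =ᵐ[volume] Sᶜ.indicator u.fourierFun := by
    filter_upwards [hgu, ((Lp.memLp g).indicator hS.compl).coeFn_toLp] with ξ h1 h2
    rw [h2]
    simp [indicator, h1]
  have hsum : g = g₁ + g₂ := by
    refine Lp.ext ?_
    filter_upwards [hgu, e₁, e₂, Lp.coeFn_add g₁ g₂] with ξ h1 h2 h3 h4
    rw [h1, h4, Pi.add_apply, h2, h3, indicator_self_add_compl_apply]
  set L := (Lp.fourierTransformₗᵢ E ℂ).symm with hL
  have hFL : ∀ h : L2Rn E, (𝓕 (L h) : L2Rn E) = h := fun h =>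
    (Lp.fourierTransformₗᵢ E ℂ).apply_symm_apply h
  refine ⟨L g₁, L g₂, ?_, ?_, ?_⟩
  · rw [← map_add, ← hsum]
    exact ((Lp.fourierTransformₗᵢ E ℂ).symm_apply_apply f).symm
  · -- Cauchy-Schwarz for `û = ⟨ξ⟩^{-r} · ⟨ξ⟩^r û` on `S`
    set w : E → ℝ := S.indicator fun ξ => (1 + ‖ξ‖ ^ 2) ^ (-r / 2) with hw
    have hw2 : ∀ ξ, w ξ ^ 2 = S.indicator (fun ξ => (1 + ‖ξ‖ ^ 2) ^ (-r)) ξ := by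
      intro ξ
      by_cases hξ : ξ ∈ S
      · simp only [hw, indicator_of_mem hξ]
        rw [← Real.rpow_mul_natCast (by positivity)]
        congr 1; push_cast; ring
      · simp [hw, indicator_of_notMem hξ]
    have hwm : MemLp w 2 := by
      refine (memLp_two_iff_integrable_sq ?_).mpr ?_
      · exact ((by fun_prop : Measurable fun ξ : E => ((1 + ‖ξ‖ ^ 2) ^ (-r / 2) : ℝ)).indicator
          hS).aestronglyMeasurable
      · simp_rw [hw2]
        exact (integrable_indicator_iff hS).mpr hI
    have hG : MemLp (fun ξ => ‖(𝓕 (Hs.bessel u) : L2Rn E) ξ‖) 2 := (Lp.memLp _).norm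
    have e₃ : (fun ξ => ‖g₁ ξ‖) =ᵐ[volume] fun ξ => w ξ * ‖(𝓕 (Hs.bessel u) : L2Rn E) ξ‖ := by
      filter_upwards [e₁, u.norm_fourier_bessel_ae_eq] with ξ h1 h2
      rw [h1, h2]
      by_cases hξ : ξ ∈ S
      · simp only [hw, indicator_of_mem hξ]
        rw [← mul_assoc, ← Real.rpow_add (by positivity)]
        ring_nf
        simp
      · simp [hw, indicator_of_notMem hξ]
    have hint : Integrable g₁ := by
      refine (integrable_norm_iff (Lp.aestronglyMeasurable g₁)).mp ?_
      exact (hwm.integrable_mul hG).congr e₃.symm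
    have h1 := ae_norm_le_integral_norm_fourier (L g₁) (by rw [hFL]; exact hint)
    rw [hFL] at h1
    have h2 : ∫ ξ, ‖g₁ ξ‖ ≤ √(∫ ξ in S, (1 + ‖ξ‖ ^ 2) ^ (-r)) * ‖u‖ := by
      rw [integral_congr_ae e₃]
      have h3 := integral_mul_le_Lp_mul_Lq_of_nonneg (μ := volume) Real.HolderConjugate.two_two
        (f := w) (g := fun ξ => ‖(𝓕 (Hs.bessel u) : L2Rn E) ξ‖)
        (Eventually.of_forall fun ξ => indicator_nonneg (fun ξ _ => by positivity) ξ)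
        (Eventually.of_forall fun ξ => norm_nonneg _) (by simpa using hwm) (by simpa using hG)
      refine h3.trans_eq ?_
      simp only [Real.rpow_two, hw2]
      rw [← Hs.norm_sq_eq, integral_indicator hS, ← Real.sqrt_eq_rpow, ← Real.sqrt_eq_rpow,
        Real.sqrt_sq (norm_nonneg _)]
    filter_upwards [h1] with x hx using hx.trans h2
  · rw [← ofReal_norm_sq_L2, ← Lp.norm_fourier_eq, hFL, ofReal_norm_sq_L2,
      ← lintegral_indicator hS.compl]
    refine lintegral_congr_ae ?_
    filter_upwards [e₂] with ξ h
    rw [h]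
    by_cases hξ : ξ ∈ Sᶜ
    · simp only [indicator_of_mem hξ]
    · simp [indicator_of_notMem hξ]

/-- The **Sobolev embedding** `H^s(ℝⁿ) ⊂ L^∞(ℝⁿ)`, `2s > n`. -/
theorem exists_ae_norm_le (hs : 0 ≤ s) (h : (Module.finrank ℝ E : ℝ) < 2 * s) :
    ∃ K : ℝ, 0 ≤ K ∧ ∀ u : Hs E s, ∀ᵐ x, ‖(Hs.embed hs u).toL2 x‖ ≤ K * ‖u‖ := by
  refine ⟨√(∫ ξ in (univ : Set E), (1 + ‖ξ‖ ^ 2) ^ (-s)), Real.sqrt_nonneg _, fun u => ?_⟩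
  have hI := integrable_rpow_neg_one_add_norm_sq (μ := (volume : Measure E)) h
  have e : -(2 * s) / 2 = -s := by ring
  rw [e] at hI
  obtain ⟨f₁, f₂, h1, h2, h3⟩ := exists_frequency_split hs u MeasurableSet.univ hI.integrableOn
  have h4 : f₂ = 0 := by
    rw [← ofReal_norm_sq_L2] at h3
    have h5 : ‖f₂‖ ^ 2 ≤ 0 := by simpa using h3
    exact norm_eq_zero.mp (pow_eq_zero_iff two_ne_zero |>.mp (le_antisymm h5 (by positivity)))
  rw [h1, h4, add_zero]
  exact h2

/-- The `L²` norm of `⟨ξ⟩^{-σ}` over the ball of radius `A` is `O(A^{n/2 - σ})`, for `2σ < n`. -/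
theorem exists_integral_ball_rpow_le (hσ : 0 ≤ σ) (hn : 0 < Module.finrank ℝ E)
    (h : 2 * σ < Module.finrank ℝ E) : ∃ K : ℝ, 0 < K ∧ ∀ A : ℝ, 0 < A →
      IntegrableOn (fun ξ : E => (1 + ‖ξ‖ ^ 2) ^ (-σ)) (Metric.ball 0 A) ∧
      √(∫ ξ in Metric.ball (0 : E) A, (1 + ‖ξ‖ ^ 2) ^ (-σ)) ≤
        K * A ^ ((Module.finrank ℝ E : ℝ) / 2 - σ) := by
  have : Nontrivial E := Module.nontrivial_of_finrank_pos (R := ℝ) hn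
  set d : ℕ := Module.finrank ℝ E with hd
  set c : ℝ := d * (volume.real (Metric.ball (0 : E) 1) * (d - 2 * σ)⁻¹) with hc
  have hc0 : 0 ≤ c := by
    have : 0 < (d : ℝ) - 2 * σ := by linarith
    positivity
  refine ⟨√c + 1, by positivity, fun A hA => ?_⟩
  have hle : ∀ ξ : E, ξ ≠ 0 → (1 + ‖ξ‖ ^ 2 : ℝ) ^ (-σ) ≤ ‖ξ‖ ^ (-(2 * σ)) := by
    intro ξ hξ
    have h0 : 0 < ‖ξ‖ := norm_pos_iff.mpr hξ
    have : ‖ξ‖ ^ (-(2 * σ)) = (‖ξ‖ ^ 2) ^ (-σ) := by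
      rw [← Real.rpow_natCast ‖ξ‖ 2, ← Real.rpow_mul h0.le]
      congr 1; push_cast; ring
    rw [this]
    exact Real.rpow_le_rpow_of_nonpos (by positivity) (by linarith) (by linarith)
  have hne : ∀ᵐ ξ ∂(volume.restrict (Metric.ball (0 : E) A)), ξ ≠ 0 :=
    ae_restrict_of_ae (by simp [ae_iff, measure_singleton])
  have hi₁ : IntegrableOn (fun ξ : E => (1 + ‖ξ‖ ^ 2) ^ (-σ)) (Metric.ball 0 A) := by
    refine integrableOn_ball_of_norm_le_rpow hn (C := 1) h (hne.mono fun ξ hξ => ?_)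
      (by fun_prop : Measurable _).aestronglyMeasurable
    rw [Real.norm_of_nonneg (by positivity), one_mul]
    exact hle ξ hξ
  have hi₂ : IntegrableOn (fun ξ : E => ‖ξ‖ ^ (-(2 * σ))) (Metric.ball 0 A) := by
    refine integrableOn_ball_of_norm_le_rpow hn (C := 1) h (hne.mono fun ξ hξ => ?_)
      (by fun_prop : Measurable _).aestronglyMeasurable
    rw [Real.norm_of_nonneg (by positivity), one_mul]
  have hval : ∫ ξ in Metric.ball (0 : E) A, ‖ξ‖ ^ (-(2 * σ)) = c * A ^ ((d : ℝ) - 2 * σ) := by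
    have h1 := integral_fun_norm_addHaar (volume : Measure E)
      ((Iio A).indicator fun y : ℝ => y ^ (-(2 * σ)))
    have h2 : (fun ξ : E => (Iio A).indicator (fun y : ℝ => y ^ (-(2 * σ))) ‖ξ‖) =
        (Metric.ball (0 : E) A).indicator fun ξ => ‖ξ‖ ^ (-(2 * σ)) := by
      ext ξ
      simp [indicator]
    have h3 : ∫ y in Ioi (0 : ℝ), y ^ (d - 1) • (Iio A).indicator (fun y : ℝ => y ^ (-(2 * σ))) y =
        A ^ ((d : ℝ) - 2 * σ) / (d - 2 * σ) := by
      have h4 : ∀ y ∈ Ioi (0 : ℝ), y ^ (d - 1) • (Iio A).indicator (fun y : ℝ => y ^ (-(2 * σ))) y =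
          (Iio A).indicator (fun y : ℝ => y ^ ((d : ℝ) - 1 - 2 * σ)) y := by
        intro y hy
        by_cases hyA : y ∈ Iio A
        · rw [indicator_of_mem hyA, indicator_of_mem hyA, smul_eq_mul, ← Real.rpow_natCast,
            ← Real.rpow_add hy]
          congr 1
          rw [Nat.cast_sub hn]
          push_cast; ring
        · simp [indicator_of_notMem hyA]
      rw [setIntegral_congr_fun measurableSet_Ioi h4, setIntegral_indicator measurableSet_Iio,
        Ioi_inter_Iio, ← integral_Ioc_eq_integral_Ioo,
        ← intervalIntegral.integral_of_le hA.le, integral_rpow (Or.inl (by linarith)),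
        (by ring : (d : ℝ) - 1 - 2 * σ + 1 = d - 2 * σ), Real.zero_rpow (by linarith), sub_zero]
    rw [h2, integral_indicator Metric.isOpen_ball.measurableSet, h3] at h1
    rw [h1, hc]
    simp only [nsmul_eq_mul, smul_eq_mul]
    ring
  refine ⟨hi₁, ?_⟩
  have h1 : ∫ ξ in Metric.ball (0 : E) A, (1 + ‖ξ‖ ^ 2) ^ (-σ) ≤ c * A ^ ((d : ℝ) - 2 * σ) :=
    (integral_mono_ae hi₁ hi₂ (hne.mono hle)).trans_eq hval
  have h2 : A ^ ((d : ℝ) - 2 * σ) = (A ^ ((d : ℝ) / 2 - σ)) ^ 2 := by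
    rw [← Real.rpow_mul_natCast hA.le]
    congr 1; push_cast; ring
  calc √(∫ ξ in Metric.ball (0 : E) A, (1 + ‖ξ‖ ^ 2) ^ (-σ))
      ≤ √(c * (A ^ ((d : ℝ) / 2 - σ)) ^ 2) := Real.sqrt_le_sqrt (h2 ▸ h1)
    _ = √c * A ^ ((d : ℝ) / 2 - σ) := by
        rw [Real.sqrt_mul hc0, Real.sqrt_sq (by positivity)]
    _ ≤ _ := by gcongr; linarith

/-- The weak-type estimate behind the Sobolev embedding: cut the frequencies of `f` at the level
where the low frequency part is bounded by `t / 2`. -/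
theorem measure_lt_norm_le (hσ : 0 ≤ σ) {K β : ℝ} (hK : 0 < K) (hβ : 0 < β)
    (hKβ : ∀ A : ℝ, 0 < A →
      IntegrableOn (fun ξ : E => (1 + ‖ξ‖ ^ 2) ^ (-σ)) (Metric.ball 0 A) ∧
      √(∫ ξ in Metric.ball (0 : E) A, (1 + ‖ξ‖ ^ 2) ^ (-σ)) ≤ K * A ^ β)
    (u : Hs E σ) (hu : ‖u‖ ≤ 1) {t : ℝ} (ht : 0 < t) :
    volume {x | t < ‖(Hs.embed hσ u).toL2 x‖} ≤
      (∫⁻ ξ, {ξ : E | t ≤ 2 * K * ‖ξ‖ ^ β}.indicator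
        (fun ξ => ENNReal.ofReal (‖u.fourierFun ξ‖ ^ 2)) ξ) *
        ENNReal.ofReal (4 * t ^ (-2 : ℝ)) := by
  -- The frequencies below `A` contribute at most `K A^β = t / 2` to the sup norm.
  set A : ℝ := (t / (2 * K)) ^ β⁻¹ with hA
  have hA0 : 0 < A := by positivity
  have hAβ : K * A ^ β = t / 2 := by
    rw [hA, Real.rpow_inv_rpow (by positivity) hβ.ne']
    field_simp
  obtain ⟨hI, hle⟩ := hKβ A hA0
  obtain ⟨f₁, f₂, h1, h2, h3⟩ := exists_frequency_split hσ u
    Metric.isOpen_ball.measurableSet hI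
  have hsub : {x | t < ‖(Hs.embed hσ u).toL2 x‖} ≤ᵐ[volume]
      {x | ENNReal.ofReal ((t / 2) ^ 2) ≤ ENNReal.ofReal (‖f₂ x‖ ^ 2)} := by
    rw [h1]
    filter_upwards [h2, Lp.coeFn_add f₁ f₂] with x hx1 hx2 hx3
    have hx4 : t < ‖f₁ x + f₂ x‖ := by
      have : t < ‖(f₁ + f₂ : L2Rn E) x‖ := hx3
      rwa [hx2] at this
    have hx5 : ‖f₁ x‖ ≤ t / 2 := by
      refine hx1.trans ((mul_le_mul hle hu (norm_nonneg _) (by positivity)).trans_eq ?_)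
      rw [mul_one, hAβ]
    have hx6 : t / 2 ≤ ‖f₂ x‖ := by linarith [norm_add_le (f₁ x) (f₂ x)]
    exact ENNReal.ofReal_le_ofReal (by gcongr)
  have hS : (Metric.ball (0 : E) A)ᶜ = {ξ : E | t ≤ 2 * K * ‖ξ‖ ^ β} := by
    ext ξ
    simp only [mem_compl_iff, Metric.mem_ball, dist_zero_right, not_lt, mem_ofPred_eq]
    rw [← Real.rpow_le_rpow_iff hA0.le (norm_nonneg ξ) hβ,
      ← mul_le_mul_iff_right₀ (by positivity : 0 < 2 * K)]
    have : 2 * K * A ^ β = t := by linarith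
    rw [this]
  refine (measure_mono_ae hsub).trans ((meas_ge_le_lintegral_div ?_ ?_ ENNReal.ofReal_ne_top).trans
    (le_of_eq ?_))
  · exact ((Lp.aestronglyMeasurable f₂).norm.aemeasurable.pow_const 2).ennreal_ofReal
  · simp only [ne_eq, ENNReal.ofReal_eq_zero, not_le]
    positivity
  · rw [h3, ← lintegral_indicator Metric.isOpen_ball.measurableSet.compl, hS, div_eq_mul_inv,
      ← ENNReal.ofReal_inv_of_pos (by positivity)]
    congr 2
    rw [Real.rpow_neg ht.le, Real.rpow_two]
    field_simp
    norm_num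

/-- The **Sobolev embedding** `H^σ(ℝⁿ) ⊂ L^r(ℝⁿ)`, `0 < 2σ < n`, `1/r = 1/2 - σ/n`: integrate the
weak-type estimate against `t^{r - 1}` and exchange the integrals over `t` and over `ξ`. -/
theorem exists_lintegral_norm_rpow_le (hσ : 0 < σ) (hn : 0 < Module.finrank ℝ E)
    (h : 2 * σ < Module.finrank ℝ E)
    (hr : r = 2 * Module.finrank ℝ E / (Module.finrank ℝ E - 2 * σ)) :
    ∃ C : ℝ≥0, ∀ u : Hs E σ, ‖u‖ ≤ 1 →
      ∫⁻ x, ENNReal.ofReal (‖(Hs.embed hσ.le u).toL2 x‖ ^ r) ≤ C := by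
  obtain ⟨K, hK, hKβ⟩ := exists_integral_ball_rpow_le hσ.le hn h
  set β : ℝ := (Module.finrank ℝ E : ℝ) / 2 - σ with hβ
  have hβ0 : 0 < β := by linarith
  have hr2 : β * (r - 2) = 2 * σ := by
    have : (Module.finrank ℝ E : ℝ) - 2 * σ ≠ 0 := by linarith
    rw [hr, hβ]
    field_simp
    ring
  have hr2' : 0 < r - 2 := pos_of_mul_pos_right (hr2 ▸ by positivity : 0 < β * (r - 2)) hβ0.le
  -- `4 ∫₀ᴮ t^{r - 3} dt = c 
  -- ξ
  -- ^{2σ}` for `B = 2 K 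
  -- ξ
  -- ^β`, as `β (r - 2) = 2σ`.
  set c : ℝ := 4 * (2 * K) ^ (r - 2) / (r - 2) with hc
  refine ⟨Real.toNNReal r * Real.toNNReal c, fun u hu => ?_⟩
  set f := (Hs.embed hσ.le u).toL2 with hf
  set g : E → ℝ≥0∞ := fun ξ => ENNReal.ofReal (‖u.fourierFun ξ‖ ^ 2) with hg
  have hgm : AEMeasurable g := by
    have := u.locallyIntegrable_fourierFun.aestronglyMeasurable
    exact (this.norm.aemeasurable.pow_const 2).ennreal_ofReal
  rw [lintegral_rpow_eq_lintegral_meas_lt_mul volume (Eventually.of_forall fun x => norm_nonneg _)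
    (Lp.aestronglyMeasurable f).norm.aemeasurable (by linarith : 0 < r), ENNReal.coe_mul]
  refine mul_le_mul_right ?_ _
  have hinner : ∀ ξ : E, ∫⁻ t in Ioi (0 : ℝ), {ξ : E | t ≤ 2 * K * ‖ξ‖ ^ β}.indicator g ξ *
      ENNReal.ofReal (4 * t ^ (r - 3)) = g ξ * ENNReal.ofReal (c * ‖ξ‖ ^ (2 * σ)) := by
    intro ξ
    set B : ℝ := 2 * K * ‖ξ‖ ^ β with hB
    have hB0 : 0 ≤ B := by positivity
    have e1 : ∀ t : ℝ, {ξ : E | t ≤ 2 * K * ‖ξ‖ ^ β}.indicator g ξ *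
        ENNReal.ofReal (4 * t ^ (r - 3)) =
        (Iic B).indicator (fun t => g ξ * ENNReal.ofReal (4 * t ^ (r - 3))) t := by
      intro t
      by_cases ht : t ≤ B
      · rw [indicator_of_mem (show ξ ∈ {ξ : E | t ≤ 2 * K * ‖ξ‖ ^ β} from ht),
          indicator_of_mem (show t ∈ Iic B from ht)]
      · rw [indicator_of_notMem (show ξ ∉ {ξ : E | t ≤ 2 * K * ‖ξ‖ ^ β} from ht),
          indicator_of_notMem (show t ∉ Iic B from ht), zero_mul]
    simp_rw [e1]
    rw [setLIntegral_indicator measurableSet_Iic, inter_comm, Ioi_inter_Iic,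
      lintegral_const_mul _ (by fun_prop)]
    congr 1
    have hint : IntervalIntegrable (fun t : ℝ => 4 * t ^ (r - 3)) volume 0 B :=
      (intervalIntegral.intervalIntegrable_rpow' (by linarith)).const_mul 4
    rw [← ofReal_integral_eq_lintegral_ofReal
      ((intervalIntegrable_iff_integrableOn_Ioc_of_le hB0).mp hint)
      ((ae_restrict_mem measurableSet_Ioc).mono fun t ht => by
        have : 0 < t := ht.1
        positivity), ← intervalIntegral.integral_of_le hB0, intervalIntegral.integral_const_mul,
      integral_rpow (Or.inl (by linarith)), (by ring : r - 3 + 1 = r - 2),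
      Real.zero_rpow hr2'.ne', sub_zero, hB, Real.mul_rpow (by positivity) (by positivity),
      ← Real.rpow_mul (norm_nonneg _), hr2, hc]
    congr 1
    ring
  calc ∫⁻ t in Ioi 0, volume {x | t < ‖f x‖} * ENNReal.ofReal (t ^ (r - 1))
      ≤ ∫⁻ t in Ioi (0 : ℝ), ∫⁻ ξ, {ξ : E | t ≤ 2 * K * ‖ξ‖ ^ β}.indicator g ξ *
          ENNReal.ofReal (4 * t ^ (r - 3)) := by
        refine setLIntegral_mono' measurableSet_Ioi fun t ht => ?_
        have ht0 : 0 < t := ht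
        rw [lintegral_mul_const' _ _ ENNReal.ofReal_ne_top]
        refine (mul_le_mul_left (measure_lt_norm_le hσ.le hK hβ0 hKβ u hu ht0) _).trans_eq ?_
        rw [mul_assoc, ← ENNReal.ofReal_mul (by positivity), mul_assoc, ← Real.rpow_add ht0,
          (by ring : (-2 : ℝ) + (r - 1) = r - 3)]
    _ = ∫⁻ ξ, ∫⁻ t in Ioi (0 : ℝ), {ξ : E | t ≤ 2 * K * ‖ξ‖ ^ β}.indicator g ξ *
          ENNReal.ofReal (4 * t ^ (r - 3)) := by
        refine lintegral_lintegral_swap (AEMeasurable.mul ?_ ?_)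
        · have hm : MeasurableSet {z : ℝ × E | z.1 ≤ 2 * K * ‖z.2‖ ^ β} :=
            measurableSet_le (by fun_prop) (by fun_prop)
          have e : Function.uncurry (fun (t : ℝ) (ξ : E) =>
              {ξ : E | t ≤ 2 * K * ‖ξ‖ ^ β}.indicator g ξ) =
              {z : ℝ × E | z.1 ≤ 2 * K * ‖z.2‖ ^ β}.indicator fun z => g z.2 := by
            ext ⟨t, ξ⟩
            rfl
          have h5 : AEMeasurable (fun z : ℝ × E => g z.2)
              ((volume.restrict (Ioi (0 : ℝ))).prod volume) := hgm.comp_snd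
          exact (e ▸ h5.indicator hm :)
        · fun_prop
    _ = ∫⁻ ξ, g ξ * ENNReal.ofReal (c * ‖ξ‖ ^ (2 * σ)) := lintegral_congr hinner
    _ ≤ ∫⁻ ξ, ENNReal.ofReal c * ENNReal.ofReal (‖(𝓕 (Hs.bessel u) : L2Rn E) ξ‖ ^ 2) := by
        refine lintegral_mono_ae ?_
        filter_upwards [u.norm_fourier_bessel_ae_eq] with ξ hξ
        rw [hg, hξ]
        beta_reduce
        rw [← ENNReal.ofReal_mul (by positivity), ← ENNReal.ofReal_mul (by positivity)]
        refine ENNReal.ofReal_le_ofReal ?_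
        rw [mul_pow, ← Real.rpow_mul_natCast (by positivity)]
        have h6 : ‖ξ‖ ^ (2 * σ) ≤ (1 + ‖ξ‖ ^ 2) ^ (σ / 2 * ((2 : ℕ) : ℝ)) := by
          rw [Real.rpow_mul (norm_nonneg _), Nat.cast_two, div_mul_cancel₀ _ two_ne_zero,
            Real.rpow_two]
          exact Real.rpow_le_rpow (by positivity) (by linarith) hσ.le
        calc ‖u.fourierFun ξ‖ ^ 2 * (c * ‖ξ‖ ^ (2 * σ))
            ≤ ‖u.fourierFun ξ‖ ^ 2 * (c * (1 + ‖ξ‖ ^ 2) ^ (σ / 2 * ((2 : ℕ) : ℝ))) := by gcongr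
          _ = _ := by ring
    _ = ENNReal.ofReal c * ENNReal.ofReal (‖u‖ ^ 2) := by
        rw [lintegral_const_mul' _ _ ENNReal.ofReal_ne_top, ← ofReal_norm_sq_L2,
          Lp.norm_fourier_eq, Hs.norm_eq]
    _ ≤ ENNReal.ofReal c * 1 := by
        refine mul_le_mul_right ?_ _
        rw [ENNReal.ofReal_le_one]
        exact pow_le_one₀ (norm_nonneg _) hu
    _ = _ := by rw [mul_one]; rfl

end SobolevEmbedding

/-! ### The potential as an operator -/

section Potential

variable {E : Type*} [NormedAddCommGroup E] [InnerProductSpace ℝ E] [FiniteDimensional ℝ E]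
  [MeasurableSpace E] [BorelSpace E] {s t σ : ℝ} {Ω : Set E}

theorem Hs.embed_embed {r : ℝ} (h : t ≤ r) (h' : σ ≤ t) (u : Hs E r) :
    Hs.embed h' (Hs.embed h u) = Hs.embed (h'.trans h) u :=
  Hs.toDist_injective (by rw [Hs.toDist_embed, Hs.toDist_embed, Hs.toDist_embed])

theorem Hs.toL2_add (u v : Hs E 0) : (u + v).toL2 = u.toL2 + v.toL2 := map_add Hs.bessel u v

theorem Hs.toL2_smul (a : ℂ) (u : Hs E 0) : (a • u).toL2 = a • u.toL2 := map_smul Hs.bessel a u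

/-- An estimate on the unit ball of `H^s(ℝⁿ)` extends to the whole space by homogeneity. -/
theorem eLpNorm_toL2_le_of_unit_ball (hs : 0 ≤ s) {r K : ℝ≥0∞} {μ : Measure E}
    (hμ : μ ≪ volume)
    (h : ∀ u : Hs E s, ‖u‖ ≤ 1 → eLpNorm (Hs.embed hs u).toL2 r μ ≤ K) (u : Hs E s) :
    eLpNorm (Hs.embed hs u).toL2 r μ ≤ K * ‖u‖ₑ := by
  set a : ℂ := ((‖u‖ : ℝ) : ℂ) with ha
  have hna : ‖a‖ₑ = ‖u‖ₑ := by
    rw [ha, ← ofReal_norm, ← ofReal_norm, Complex.norm_real, norm_norm]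
  obtain ⟨v, hv, huv⟩ : ∃ v : Hs E s, ‖v‖ ≤ 1 ∧ u = a • v := by
    rcases eq_or_ne u 0 with rfl | hu
    · exact ⟨0, by simp, by simp⟩
    · have hu' : ‖u‖ ≠ 0 := norm_ne_zero_iff.mpr hu
      have ha0 : a ≠ 0 := by simpa [ha] using hu'
      refine ⟨a⁻¹ • u, ?_, by rw [smul_inv_smul₀ ha0]⟩
      rw [norm_smul, norm_inv, ha, Complex.norm_real, norm_norm, inv_mul_cancel₀ hu']
  have e : (Hs.embed hs u).toL2 =ᵐ[μ] a • ((Hs.embed hs v).toL2 : E → ℂ) := by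
    rw [huv, map_smul, Hs.toL2_smul]
    exact hμ.ae_eq (Lp.coeFn_smul _ _)
  rw [eLpNorm_congr_ae e, eLpNorm_const_smul, hna, mul_comm]
  gcongr
  exact h v hv

/-- The Sobolev embedding into the space `L^r(Ω)`, `1/r = 1/2 - 1/p`, which `L^p(Ω)` multiplies into
`L²(Ω)`. In `ℝ≥0∞` this covers `p = ∞` (`r = 2`) and `p = 2` (`r = ∞`). -/
theorem exists_eLpNorm_toL2_le (hn : 0 < Module.finrank ℝ E) (hΩ : Bornology.IsBounded Ω)
    (hs : 0 < s) {p : ℝ≥0∞} (hp : 2 ≤ p)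
    (hp_sub : 2 * s < Module.finrank ℝ E → ENNReal.ofReal (Module.finrank ℝ E / s) ≤ p)
    (hp_crit : 2 * s = Module.finrank ℝ E → 2 < p) :
    ∃ K : ℝ≥0, ∀ u : Hs E s, eLpNorm (Hs.embed hs.le u).toL2 (2⁻¹ - p⁻¹)⁻¹
      (volume.restrict Ω) ≤ K * ‖u‖ₑ := by
  suffices h : ∃ K : ℝ≥0∞, K ≠ ⊤ ∧ ∀ u : Hs E s, ‖u‖ ≤ 1 →
      eLpNorm (Hs.embed hs.le u).toL2 (2⁻¹ - p⁻¹)⁻¹ (volume.restrict Ω) ≤ K by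
    obtain ⟨K, hK, h⟩ := h
    refine ⟨K.toNNReal, fun u => ?_⟩
    rw [ENNReal.coe_toNNReal hK]
    exact eLpNorm_toL2_le_of_unit_ball hs.le Measure.restrict_le_self.absolutelyContinuous h u
  have hΩfin : volume Ω ≠ ⊤ := hΩ.measure_lt_top.ne
  -- For `p = ∞` the claim is `H^s ⊂ L²`.
  rcases eq_or_ne p ⊤ with rfl | hp_top
  · refine ⟨1, ENNReal.one_ne_top, fun u hu => ?_⟩
    rw [ENNReal.inv_top, tsub_zero, inv_inv]
    refine (eLpNorm_mono_measure _ Measure.restrict_le_self).trans ?_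
    rw [← Lp.enorm_def, ← ofReal_norm, Hs.norm_toL2, ENNReal.ofReal_le_one]
    exact (Hs.norm_embed_le _ _).trans hu
  -- For `2s > n`, functions in `H^s(ℝⁿ)` are bounded, and `Ω` has finite measure.
  rcases lt_or_ge (Module.finrank ℝ E : ℝ) (2 * s) with hlt | hge
  · obtain ⟨K, hK, h⟩ := exists_ae_norm_le (E := E) hs.le hlt
    -- For `p = 2` one has `r = ∞`, and both exponents are `1 / 0 = 0`.
    refine ⟨ENNReal.ofReal K *
      volume Ω ^ (1 / ((2⁻¹ - p⁻¹)⁻¹ : ℝ≥0∞).toReal - 1 / (⊤ : ℝ≥0∞).toReal), ?_, fun u hu => ?_⟩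
    · refine ENNReal.mul_ne_top ENNReal.ofReal_ne_top (ENNReal.rpow_ne_top_of_nonneg ?_ hΩfin)
      simp
    · refine (eLpNorm_le_eLpNorm_mul_rpow_measure_univ le_top
        (Lp.aestronglyMeasurable _).restrict).trans ?_
      rw [Measure.restrict_apply_univ]
      gcongr
      rw [eLpNorm_exponent_top]
      refine eLpNormEssSup_le_of_ae_bound (ae_restrict_of_ae ?_)
      filter_upwards [h u] with x hx
      exact hx.trans (mul_le_of_le_one_right hK hu)
  · set d : ℝ := (Module.finrank ℝ E : ℝ) with hd
    have hd0 : 0 < d := Nat.cast_pos.mpr hn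
    set P : ℝ := p.toReal with hP
    have hpP : p = ENNReal.ofReal P := (ENNReal.ofReal_toReal hp_top).symm
    have hP2 : 2 < P ∧ d / P ≤ s := by
      have h2 : 2 ≤ P := by
        have := ENNReal.toReal_mono hp_top hp
        simpa using this
      rcases hge.lt_or_eq with hlt | heq
      · have h3 := ENNReal.toReal_mono hp_top (hp_sub hlt)
        rw [ENNReal.toReal_ofReal (by positivity), ← hP, div_le_iff₀ hs] at h3
        refine ⟨?_, ?_⟩
        · by_contra! h
          nlinarith
        · rw [div_le_iff₀ (by linarith)]
          linarith
      · have h3 : 2 < P := by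
          have := ENNReal.toReal_strict_mono hp_top (hp_crit heq)
          simpa using this
        refine ⟨h3, ?_⟩
        rw [div_le_iff₀ (by linarith)]
        nlinarith
    obtain ⟨hP2, hσs⟩ := hP2
    -- For `2s ≤ n`, the exponent `r` is that of the embedding of `H^σ(ℝⁿ)` with `σ = n / p ≤ s`;
    -- moreover `p > 2` gives `2σ < n`.
    set σ : ℝ := d / P with hσ
    have hσ0 : 0 < σ := div_pos hd0 (by linarith)
    have hσP : σ * P = d := div_mul_cancel₀ _ (by linarith)
    have hσd : 2 * σ < d := by nlinarith
    set r : ℝ := 2 * d / (d - 2 * σ) with hr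
    have hr0 : 0 < r := div_pos (by linarith) (by linarith)
    have hrp : (2⁻¹ - p⁻¹)⁻¹ = ENNReal.ofReal r := by
      have h2 : (2 : ℝ≥0∞) = ENNReal.ofReal 2 := by simp
      have hpos : (0 : ℝ) < 2⁻¹ - P⁻¹ := by
        rw [sub_pos]
        exact inv_strictAnti₀ two_pos hP2
      rw [hpP, h2, ← ENNReal.ofReal_inv_of_pos two_pos, ← ENNReal.ofReal_inv_of_pos (by linarith),
        ← ENNReal.ofReal_sub _ (by positivity), ← ENNReal.ofReal_inv_of_pos hpos]
      congr 1
      have h3 : d - 2 * σ ≠ 0 := by linarith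
      have h4 : P ≠ 0 := by linarith
      rw [hr, inv_eq_iff_eq_inv, inv_div, ← hσP]
      field_simp
    obtain ⟨C, hC⟩ := exists_lintegral_norm_rpow_le (E := E) hσ0 hn hσd hr
    refine ⟨(C : ℝ≥0∞) ^ (1 / r), ENNReal.rpow_ne_top_of_nonneg (by positivity)
      ENNReal.coe_ne_top, fun u hu => ?_⟩
    rw [hrp]
    refine (eLpNorm_mono_measure _ Measure.restrict_le_self).trans ?_
    rw [eLpNorm_eq_lintegral_rpow_enorm_toReal (by simpa using hr0) ENNReal.ofReal_ne_top,
      ENNReal.toReal_ofReal hr0.le]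
    refine ENNReal.rpow_le_rpow ?_ (by positivity)
    refine le_trans (le_of_eq ?_) (hC (Hs.embed hσs u) ((Hs.norm_embed_le _ _).trans hu))
    rw [Hs.embed_embed]
    refine lintegral_congr fun x => ?_
    rw [← ofReal_norm, ENNReal.ofReal_rpow_of_nonneg (norm_nonneg _) hr0.le]

/-- Restriction `H̃^0(Ω) → L²(Ω)`. -/
def restrictL2 (Ω : Set E) : Htilde Ω 0 →L[ℂ] Lp ℂ 2 (volume.restrict Ω) :=
  LpToLpRestrictCLM E ℂ ℂ volume 2 Ω ∘L
    (Hs.besselIso (E := E) (r := 0)).toContinuousLinearEquiv.toContinuousLinearMap ∘L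
    (Htilde Ω 0).subtypeL

theorem restrictL2_ae_eq (u : Htilde Ω 0) :
    restrictL2 Ω u =ᵐ[volume.restrict Ω] (u : Hs E 0).toL2 :=
  LpToLpRestrictCLM_coeFn ℂ Ω _

theorem Htilde.pair_eq_inner (u : Htilde Ω 0) {ψ : 𝓢(E, ℂ)} (h : HasCompactSupport ψ)
    (h' : tsupport ψ ⊆ Ω) :
    (u : Hs E 0).pair ψ = inner ℂ (Htilde.ofTest 0 (conjSchwartz ψ)
      (hasCompactSupport_conjSchwartz h) ((tsupport_conjSchwartz_subset ψ).trans h')) u :=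
  Hs.pair_eq_inner _ _

/-- The multiplication operators `u ↦ q u`, `H̃^s(Ω) → L̃²(Ω)`, depend continuously on
`q ∈ L^p(Ω)`. The product is extended by zero outside `Ω`, by means of the adjoint of the
restriction to `Ω`. -/
theorem exists_potentialOperator (hn : 0 < Module.finrank ℝ E) (hΩ : Bornology.IsBounded Ω)
    (hs : 0 < s) {p : ℝ≥0∞} [Fact (1 ≤ p)] (hp : 2 ≤ p)
    (hp_sub : 2 * s < Module.finrank ℝ E → ENNReal.ofReal (Module.finrank ℝ E / s) ≤ p)
    (hp_crit : 2 * s = Module.finrank ℝ E → 2 < p) :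
    ∃ m : Lp ℝ p (volume.restrict Ω) →L[ℝ] Htilde Ω s →L[ℝ] Htilde Ω 0,
      ∀ q u (φ : 𝓢(E, ℂ)), HasCompactSupport φ → tsupport φ ⊆ Ω →
        ((m q u : Htilde Ω 0) : Hs E 0).pair φ =
          ∫ x in Ω, ((q x : ℝ) : ℂ) * (Htilde.embed hs.le u : Hs E 0).toL2 x * φ x := by
  obtain ⟨K, hK⟩ := exists_eLpNorm_toL2_le hn hΩ hs hp hp_sub hp_crit
  set r : ℝ≥0∞ := (2⁻¹ - p⁻¹)⁻¹ with hr
  have hp' : p⁻¹ ≤ 2⁻¹ := ENNReal.inv_le_inv.mpr hp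
  have : ENNReal.HolderTriple p r 2 := ⟨by rw [hr, inv_inv, add_tsub_cancel_of_le hp']⟩
  have : Fact (1 ≤ r) := ⟨by
    rw [hr, ENNReal.one_le_inv]
    exact tsub_le_self.trans (by norm_num)⟩
  have hmem : ∀ u : Htilde Ω s,
      MemLp (Hs.embed hs.le (u : Hs E s)).toL2 r (volume.restrict Ω) := fun u =>
    ⟨(Lp.aestronglyMeasurable _).restrict, (hK u).trans_lt
      (ENNReal.mul_lt_top ENNReal.coe_lt_top enorm_lt_top)⟩
  let I : Htilde Ω s →ₗ[ℝ] Lp ℂ r (volume.restrict Ω) :=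
    { toFun := fun u => (hmem u).toLp _
      map_add' := fun u v => by
        refine Lp.ext ?_
        filter_upwards [(hmem u).coeFn_toLp, (hmem v).coeFn_toLp, (hmem (u + v)).coeFn_toLp,
          Lp.coeFn_add ((hmem u).toLp _) ((hmem v).toLp _),
          ae_restrict_of_ae (Lp.coeFn_add (Hs.embed hs.le (u : Hs E s)).toL2
            (Hs.embed hs.le (v : Hs E s)).toL2)] with x h1 h2 h3 h4 h5
        rw [h3, h4, Pi.add_apply, h1, h2, ← Pi.add_apply, ← h5, ← Hs.toL2_add, ← map_add]
        rfl
      map_smul' := fun a u => by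
        refine Lp.ext ?_
        filter_upwards [(hmem u).coeFn_toLp, (hmem (a • u)).coeFn_toLp,
          Lp.coeFn_smul a ((hmem u).toLp _),
          ae_restrict_of_ae (Lp.coeFn_smul (a : ℂ) (Hs.embed hs.le (u : Hs E s)).toL2)]
          with x h1 h2 h3 h4
        rw [h2, RingHom.id_apply, h3, Pi.smul_apply, h1]
        have h5 : (Hs.embed hs.le ((a • u : Htilde Ω s) : Hs E s)).toL2 =
            (a : ℂ) • (Hs.embed hs.le (u : Hs E s)).toL2 := by
          rw [← Hs.toL2_smul, ← map_smul]
          rfl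
        rw [h5, h4]
        rfl }
  let I' : Htilde Ω s →L[ℝ] Lp ℂ r (volume.restrict Ω) := I.mkContinuous K fun u => by
    have h1 : ‖I u‖ₑ ≤ K * ‖(u : Hs E s)‖ₑ := by
      rw [Lp.enorm_def]
      exact (eLpNorm_congr_ae (hmem u).coeFn_toLp).trans_le (hK u)
    have h2 := ENNReal.toReal_mono (ENNReal.mul_ne_top ENNReal.coe_ne_top enorm_ne_top) h1
    simpa using h2
  let B : ℝ →L[ℝ] ℂ →L[ℝ] ℂ := ContinuousLinearMap.lsmul ℝ ℝ
  let R : Lp ℂ 2 (volume.restrict Ω) →L[ℝ] Htilde Ω 0 :=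
    ((restrictL2 Ω)†).restrictScalars ℝ
  refine ⟨(R.postcomp (Htilde Ω s)) ∘L
    ((B.holderL (volume.restrict Ω) p r 2).bilinearComp (.id ℝ _) I'), fun q u φ hφ hφ' => ?_⟩
  change ((((restrictL2 Ω)†) (B.holder 2 q (I' u)) : Htilde Ω 0) : Hs E 0).pair φ = _
  rw [Htilde.pair_eq_inner _ hφ hφ', ContinuousLinearMap.adjoint_inner_right, L2.inner_def]
  refine integral_congr_ae ?_
  filter_upwards [ContinuousLinearMap.coeFn_holder (r := 2) B q (I' u), (hmem u).coeFn_toLp,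
    restrictL2_ae_eq (Htilde.ofTest 0 (conjSchwartz φ) (hasCompactSupport_conjSchwartz hφ)
      ((tsupport_conjSchwartz_subset φ).trans hφ')),
    ae_restrict_of_ae ((conjSchwartz φ).coeFn_toLp 2 volume)] with x h1 h2 h3 h4
  rw [h1, h3]
  change inner ℂ ((Hs.ofSchwartz 0 (conjSchwartz φ)).toL2 x) (q x • (hmem u).toLp _ x) = _
  rw [h2, Hs.toL2_ofSchwartz, h4, RCLike.inner_apply', conjSchwartz_apply, Complex.conj_conj,
    Complex.real_smul]
  change _ = (q x : ℂ) * (Hs.embed hs.le (u : Hs E s)).toL2 x * φ x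
  ring

end Potential

/-! ### Test functions as functions of time -/

section TestFunctions

variable {E : Type*} [NormedAddCommGroup E] [InnerProductSpace ℝ E] [FiniteDimensional ℝ E]
  [MeasurableSpace E] [BorelSpace E] {r s t : ℝ} {Ω : Set E} {T : ℝ}

theorem hasTemperateGrowth_weight (r : ℝ) :
    (fun ξ : E => (((1 + ‖ξ‖ ^ 2) ^ r : ℝ) : ℂ)).HasTemperateGrowth := by fun_prop

theorem Hs.fourier_bessel_ofSchwartz (φ : 𝓢(E, ℂ)) :
    (𝓕 (Hs.bessel (Hs.ofSchwartz r φ)) : L2Rn E) = (SchwartzMap.smulLeftCLM ℂ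
      (fun ξ : E => (((1 + ‖ξ‖ ^ 2) ^ (r / 2) : ℝ) : ℂ)) (𝓕 φ)).toLp 2 := by
  refine Lp.ext ?_
  filter_upwards [SchwartzMap.coeFn_toLp (SchwartzMap.smulLeftCLM ℂ
      (fun ξ : E => (((1 + ‖ξ‖ ^ 2) ^ (r / 2) : ℝ) : ℂ)) (𝓕 φ)) 2 volume,
    (Hs.ofSchwartz r φ).fourier_bessel_ae_eq, Hs.fourierFun_ofSchwartz (r := r) φ] with ξ h1 h2 h3
  rw [h1, h2, h3, SchwartzMap.smulLeftCLM_apply_apply (hasTemperateGrowth_weight _), smul_eq_mul]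

/-- The embedding of the Schwartz space into `H^r(ℝⁿ)` is continuous. -/
theorem Hs.continuous_ofSchwartz (r : ℝ) :
    Continuous (Hs.ofSchwartz r : 𝓢(E, ℂ) → Hs E r) := by
  rw [(Hs.besselIso (E := E) (r := r)).isometry.isEmbedding.isInducing.continuous_iff,
    (Lp.fourierTransformₗᵢ E ℂ).isometry.isEmbedding.isInducing.continuous_iff]
  have h : Continuous fun φ : 𝓢(E, ℂ) => SchwartzMap.toLpCLM ℂ ℂ 2 volume
      (SchwartzMap.smulLeftCLM ℂ (fun ξ : E => (((1 + ‖ξ‖ ^ 2) ^ (r / 2) : ℝ) : ℂ))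
        (FourierTransform.fourierCLM ℂ 𝓢(E, ℂ) φ)) :=
    (SchwartzMap.toLpCLM ℂ ℂ 2 volume).continuous.comp
      ((SchwartzMap.smulLeftCLM ℂ _).continuous.comp (ContinuousLinearMap.continuous _))
  refine h.congr fun φ => ?_
  exact (Hs.fourier_bessel_ofSchwartz φ).symm

namespace TestFun

theorem slice_apply (φ : TestFun Ω T) (t : ℝ) (x : E) : φ.slice t x = φ.toFun (t, x) := rfl

theorem hasCompactSupport_slice (φ : TestFun Ω T) (t : ℝ) : HasCompactSupport (φ.slice t) := by
  refine HasCompactSupport.intro (φ.compact.image continuous_snd) fun x hx => ?_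
  by_contra h
  exact hx ⟨(t, x), subset_tsupport _ h, rfl⟩

theorem tsupport_slice_subset (φ : TestFun Ω T) (t : ℝ) : tsupport (φ.slice t) ⊆ Ω := by
  have hc : IsClosed {x : E | (t, x) ∈ tsupport φ.toFun} :=
    (isClosed_tsupport φ.toFun).preimage (by fun_prop)
  exact (closure_minimal (t := {x : E | (t, x) ∈ tsupport φ.toFun})
    (fun x hx => subset_tsupport φ.toFun hx) hc).trans
    fun x hx => (φ.supp hx).2

theorem slice_eq_zero (φ : TestFun Ω T) {t : ℝ} (ht : T ≤ t) : φ.slice t = 0 := by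
  ext x
  by_contra h
  exact (not_lt.mpr ht) (φ.supp (subset_tsupport φ.toFun h)).1

theorem iteratedFDeriv_slice (φ : TestFun Ω T) (t : ℝ) (n : ℕ) (x : E) :
    iteratedFDeriv ℝ n (φ.slice t) x = (iteratedFDeriv ℝ n φ.toFun (t, x)).compContinuousLinearMap
      fun _ => ContinuousLinearMap.inr ℝ ℝ E := by
  have h1 : (φ.slice t : E → ℂ) =
      (fun z => φ.toFun ((t, 0) + z)) ∘ ContinuousLinearMap.inr ℝ ℝ E := by
    ext x
    simp [slice_apply]
  rw [h1, ContinuousLinearMap.iteratedFDeriv_comp_right (n := ∞)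
    (f := fun z => φ.toFun ((t, 0) + z)) _
    (φ.smooth.comp (by fun_prop)) x (mod_cast le_top), iteratedFDeriv_comp_add_left]
  simp

/-- The slices of a test function depend continuously on time, in the topology of `𝓢(ℝⁿ)`. -/
theorem continuous_slice (φ : TestFun Ω T) : Continuous φ.slice := by
  obtain ⟨R, hR⟩ := (φ.compact.image continuous_snd).isBounded.exists_norm_le
  rw [continuous_iff_continuousAt]
  intro t
  refine ((schwartz_withSeminorms ℝ E ℂ).tendsto_nhds _ _).mpr fun ⟨k, n⟩ ε hε => ?_
  have hu : UniformContinuous (iteratedFDeriv ℝ n φ.toFun) :=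
    (φ.compact.iteratedFDeriv n).uniformContinuous_of_continuous
      (φ.smooth.continuous_iteratedFDeriv (mod_cast le_top))
  set N : ℝ := ∏ _i : Fin n, ‖ContinuousLinearMap.inr ℝ ℝ E‖ with hN
  have hN0 : 0 ≤ N := by positivity
  set ε' : ℝ := ε / 2 / ((|R| + 1) ^ k * (N + 1)) with hε'
  have hε'0 : 0 < ε' := by positivity
  obtain ⟨δ, hδ, hδε⟩ := Metric.uniformContinuous_iff.mp hu ε' hε'0
  filter_upwards [Metric.ball_mem_nhds t hδ] with t' ht'
  refine lt_of_le_of_lt ?_ (half_lt_self hε)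
  refine SchwartzMap.seminorm_le_bound ℝ k n _ (by positivity) fun x => ?_
  have e : iteratedFDeriv ℝ n (φ.slice t' - φ.slice t : 𝓢(E, ℂ)) x =
      (iteratedFDeriv ℝ n φ.toFun (t', x) - iteratedFDeriv ℝ n φ.toFun
        (t, x)).compContinuousLinearMap fun _ => ContinuousLinearMap.inr ℝ ℝ E := by
    change iteratedFDeriv ℝ n ((φ.slice t' : E → ℂ) - (φ.slice t : E → ℂ)) x = _
    rw [iteratedFDeriv_sub_apply (((φ.slice t').smooth n).contDiffAt)
      (((φ.slice t).smooth n).contDiffAt), iteratedFDeriv_slice, iteratedFDeriv_slice]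
    rfl
  by_cases hx : x ∈ Prod.snd '' tsupport φ.toFun
  · have h1 : ‖iteratedFDeriv ℝ n (φ.slice t' - φ.slice t : 𝓢(E, ℂ)) x‖ ≤ ε' * N := by
      rw [e]
      refine (ContinuousMultilinearMap.norm_compContinuousLinearMap_le _ _).trans ?_
      gcongr
      rw [← dist_eq_norm]
      refine (hδε ?_).le
      rw [Prod.dist_eq]
      simpa using ht'
    have h2 : ‖x‖ ≤ |R| + 1 := by linarith [hR x hx, le_abs_self R]
    calc ‖x‖ ^ k * ‖iteratedFDeriv ℝ n (φ.slice t' - φ.slice t : 𝓢(E, ℂ)) x‖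
        ≤ (|R| + 1) ^ k * (ε' * (N + 1)) := by
          gcongr
          exact h1.trans (by gcongr; linarith)
      _ = ε / 2 := by
          rw [hε']
          field_simp
  · have h0 : ∀ t, iteratedFDeriv ℝ n φ.toFun (t, x) = 0 := fun t => by
      by_contra h
      exact hx ⟨(t, x), support_iteratedFDeriv_subset n h, rfl⟩
    rw [e, h0, h0, sub_zero]
    have : ((0 : ContinuousMultilinearMap ℝ (fun _ : Fin n => ℝ × E) ℂ).compContinuousLinearMap
        fun _ => ContinuousLinearMap.inr ℝ ℝ E) = 0 := by ext; simp
    rw [this, norm_zero, mul_zero]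
    positivity

/-- A test function as a function of time with values in `H̃^r(Ω)`. -/
def toHtilde (φ : TestFun Ω T) (r t : ℝ) : Htilde Ω r :=
  Htilde.ofTest r (φ.slice t) (φ.hasCompactSupport_slice t) (φ.tsupport_slice_subset t)

theorem continuous_toHtilde (φ : TestFun Ω T) (r : ℝ) : Continuous (φ.toHtilde r) := by
  refine Continuous.subtype_mk (f := fun t => Hs.ofSchwartz r (φ.slice t)) ?_ _
  exact (Hs.continuous_ofSchwartz r).comp φ.continuous_slice

theorem toHtilde_eq_zero (φ : TestFun Ω T) (r : ℝ) {t : ℝ} (ht : T ≤ t) : φ.toHtilde r t = 0 := by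
  refine Subtype.ext ?_
  change Hs.ofSchwartz r (φ.slice t) = 0
  rw [φ.slice_eq_zero ht, map_zero]

theorem sub_eq_integral_dt (φ : TestFun Ω T) (a b : ℝ) (x : E) :
    φ.toFun (b, x) - φ.toFun (a, x) = ∫ τ in a..b, φ.dt.toFun (τ, x) := by
  refine (intervalIntegral.integral_eq_sub_of_hasDerivAt (f := fun τ => φ.toFun (τ, x))
    (fun τ _ => ?_) ?_).symm
  · have h1 : HasFDerivAt φ.toFun (fderiv ℝ φ.toFun (τ, x)) (τ, x) :=
      (φ.smooth.differentiable (by simp)).differentiableAt.hasFDerivAt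
    exact h1.comp_hasDerivAt τ ((hasDerivAt_id τ).prodMk (hasDerivAt_const τ x))
  · exact (φ.dt.smooth.continuous.comp (by fun_prop)).intervalIntegrable _ _

theorem toHtilde_eq_add_integral (φ : TestFun Ω T) (r : ℝ) {t : ℝ} (ht : 0 ≤ t) :
    φ.toHtilde r t = φ.toHtilde r 0 + ∫ τ in 0..t, φ.dt.toHtilde r τ := by
  refine Subtype.ext (Hs.ext_pair fun ψ => ?_)
  have hint : IntervalIntegrable (φ.dt.toHtilde r) volume 0 t :=
    (φ.dt.continuous_toHtilde r).intervalIntegrable _ _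
  let L : Htilde Ω r →L[ℝ] ℂ :=
    { toFun := fun u => (u : Hs E r).pair ψ
      map_add' := fun u v => Hs.pair_add _ _ ψ
      map_smul' := fun a u => Hs.pair_smul (a : ℂ) (u : Hs E r) ψ
      cont := (Hs.continuous_pair ψ).comp continuous_subtype_val }
  suffices h : L (φ.toHtilde r t) = L (φ.toHtilde r 0 + ∫ τ in 0..t, φ.dt.toHtilde r τ) from h
  rw [map_add, ← L.intervalIntegral_comp_comm hint]
  have hL : ∀ (φ : TestFun Ω T) τ, L (φ.toHtilde r τ) = ∫ x, ψ x * φ.toFun (τ, x) := fun φ τ =>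
    Hs.pair_ofSchwartz (r := r) (φ.slice τ) ψ
  simp only [hL]
  have hi : ∀ (φ : TestFun Ω T) τ, Integrable fun x => ψ x * φ.toFun (τ, x) := fun φ τ =>
    (ψ.continuous.mul (φ.smooth.continuous.comp (by fun_prop))).integrable_of_hasCompactSupport
      ((φ.hasCompactSupport_slice τ).mul_left)
  have hprod : Integrable (fun z : ℝ × E => ψ z.2 * φ.dt.toFun z)
      ((volume.restrict (Ioc 0 t)).prod volume) := by
    have h1 : Integrable (fun z : ℝ × E => ψ z.2 * φ.dt.toFun z) (volume.prod volume) :=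
      ((ψ.continuous.comp continuous_snd).mul
        φ.dt.smooth.continuous).integrable_of_hasCompactSupport φ.dt.compact.mul_left
    have h2 : (volume.restrict (Ioc 0 t)).prod (volume : Measure E) =
        (volume.prod volume).restrict (Ioc 0 t ×ˢ univ) := by
      rw [← Measure.prod_restrict, Measure.restrict_univ]
    rw [h2]
    exact h1.integrableOn
  rw [← sub_eq_iff_eq_add', ← integral_sub (hi φ t) (hi φ 0), intervalIntegral.integral_of_le ht,
    integral_integral_swap hprod]
  refine integral_congr_ae (Eventually.of_forall fun x => ?_)
  beta_reduce
  rw [← mul_sub, φ.sub_eq_integral_dt, intervalIntegral.integral_of_le ht, integral_const_mul]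

/-- The complex conjugate of a test function. -/
def conj (φ : TestFun Ω T) : TestFun Ω T where
  toFun z := starRingEnd ℂ (φ.toFun z)
  smooth := Complex.conjCLE.contDiff.comp φ.smooth
  compact := φ.compact.comp_left (g := starRingEnd ℂ) (map_zero _)
  supp := (closure_mono (Function.support_comp_subset (g := starRingEnd ℂ) (map_zero _)
    φ.toFun)).trans φ.supp

theorem conjSchwartz_slice (φ : TestFun Ω T) (t : ℝ) :
    conjSchwartz (φ.slice t) = φ.conj.slice t := rfl

theorem conjSchwartz_slice_dt (φ : TestFun Ω T) (t : ℝ) :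
    conjSchwartz (φ.dt.slice t) = φ.conj.dt.slice t := by
  ext x
  have h1 : HasFDerivAt φ.toFun (fderiv ℝ φ.toFun (t, x)) (t, x) :=
    (φ.smooth.differentiable (by simp)).differentiableAt.hasFDerivAt
  have h2 := (Complex.conjCLE.toContinuousLinearMap.hasFDerivAt.comp (t, x) h1).fderiv
  change starRingEnd ℂ (fderiv ℝ φ.toFun (t, x) (1, 0)) =
    fderiv ℝ (fun z => starRingEnd ℂ (φ.toFun z)) (t, x) (1, 0)
  have h3 : (fun z => starRingEnd ℂ (φ.toFun z)) =
      (Complex.conjCLE.toContinuousLinearMap : ℂ → ℂ) ∘ φ.toFun := rfl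
  rw [h3, h2]
  rfl

/-- The test function `η(t) ψ(x)`. -/
def tensor (η : ℝ → ℝ) (hη : ContDiff ℝ ∞ η) (hηc : HasCompactSupport η)
    (hηT : tsupport η ⊆ Iio T) (ψ : 𝓢(E, ℂ)) (hψ : HasCompactSupport ψ)
    (hψΩ : tsupport ψ ⊆ Ω) : TestFun Ω T where
  toFun z := (η z.1 : ℂ) * ψ z.2
  smooth := (Complex.ofRealCLM.contDiff.comp (hη.comp contDiff_fst)).mul
    (ψ.smooth'.comp contDiff_snd)
  compact := by
    refine HasCompactSupport.intro (hηc.prod hψ) fun z hz => ?_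
    by_contra h
    rw [mul_eq_zero, not_or] at h
    exact hz ⟨subset_tsupport η (by simpa using h.1), subset_tsupport ψ h.2⟩
  supp := by
    refine (closure_minimal (t := tsupport η ×ˢ tsupport ψ) (fun z hz => ?_)
      ((isClosed_tsupport η).prod (isClosed_tsupport ψ))).trans (prod_mono hηT hψΩ)
    have h : (η z.1 : ℂ) * ψ z.2 ≠ 0 := hz
    rw [mul_ne_zero_iff] at h
    exact ⟨subset_tsupport η (by simpa using h.1), subset_tsupport ψ h.2⟩

variable {η : ℝ → ℝ} (hη : ContDiff ℝ ∞ η) (hηc : HasCompactSupport η)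
    (hηT : tsupport η ⊆ Iio T) {ψ : 𝓢(E, ℂ)} (hψ : HasCompactSupport ψ)
    (hψΩ : tsupport ψ ⊆ Ω)

theorem slice_tensor (t : ℝ) :
    (tensor η hη hηc hηT ψ hψ hψΩ).slice t = ((η t : ℝ) : ℂ) • ψ := rfl

theorem slice_dt_tensor (t : ℝ) :
    (tensor η hη hηc hηT ψ hψ hψΩ).dt.slice t = ((deriv η t : ℝ) : ℂ) • ψ := by
  ext x
  have h1 : HasFDerivAt (tensor η hη hηc hηT ψ hψ hψΩ).toFun
      (fderiv ℝ (tensor η hη hηc hηT ψ hψ hψΩ).toFun (t, x)) (t, x) :=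
    ((tensor η hη hηc hηT ψ hψ hψΩ).smooth.differentiable (by simp)).differentiableAt.hasFDerivAt
  have h2 := h1.comp_hasDerivAt t ((hasDerivAt_id t).prodMk (hasDerivAt_const t x))
  have h3 : HasDerivAt η (deriv η t) t :=
    (hη.differentiable (by simp)).differentiableAt.hasDerivAt
  exact h2.unique (h3.ofReal_comp.mul_const (ψ x))

end TestFun

end TestFunctions

/-! ### The weak formulation in the energy space -/

section WeakForm

variable {E : Type*} [NormedAddCommGroup E] [InnerProductSpace ℝ E] [FiniteDimensional ℝ E]
  [MeasurableSpace E] [BorelSpace E] {s T : ℝ} {Ω : Set E}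
  {W : Type*} [NormedAddCommGroup W] [InnerProductSpace ℂ W] [CompleteSpace W]

/-- A realization of `H̃^s(Ω)` with the energy inner product `⟨(-Δ)^{s/2} u, (-Δ)^{s/2} v⟩`: an
isomorphism onto a Hilbert space `W` which transports the energy inner product to that of `W`. -/
def IsEnergyEquiv (hs : 0 < s) (e : Htilde Ω s ≃L[ℂ] W) : Prop :=
  ∀ u v, inner ℂ (e u) (e v) = inner ℂ (halfLap hs u) (halfLap hs v)

/-- By the Poincaré inequality, the range of `(-Δ)^{s/2}` on `H̃^s(Ω)` is closed in `L²(ℝⁿ)`; it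
realizes the energy space. -/
theorem exists_isEnergyEquiv (hn : 0 < Module.finrank ℝ E) (hΩ : Bornology.IsBounded Ω)
    (hs : 0 < s) : CompleteSpace (halfLapCLM Ω hs).range ∧
      ∃ e : Htilde Ω s ≃L[ℂ] (halfLapCLM Ω hs).range, IsEnergyEquiv hs e := by
  obtain ⟨C, hC, h⟩ := exists_norm_le_halfLap (Ω := Ω) hn hΩ hs
  have hanti : AntilipschitzWith C.toNNReal (halfLapCLM Ω hs) :=
    (halfLapCLM Ω hs).antilipschitz_of_bound fun u => by
      rw [Real.coe_toNNReal _ hC.le]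
      exact h u
  have hcl : IsClosed (range (halfLapCLM Ω hs)) :=
    hanti.isClosed_range (halfLapCLM Ω hs).uniformContinuous
  exact ⟨hcl.completeSpace_coe, (halfLapCLM Ω hs).equivRange hanti.injective hcl, fun u v => rfl⟩

variable {hs : 0 < s} {e : Htilde Ω s ≃L[ℂ] W}

theorem IsEnergyEquiv.norm_eq (he : IsEnergyEquiv hs e) (u : Htilde Ω s) :
    ‖e u‖ = ‖halfLap hs u‖ := by
  rw [@norm_eq_sqrt_re_inner ℂ, @norm_eq_sqrt_re_inner ℂ, he]

/-- The embedding of the energy space into `L̃²(Ω)`. -/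
def energyEmbed (hs : 0 < s) (e : Htilde Ω s ≃L[ℂ] W) : W →L[ℂ] Htilde Ω 0 :=
  Htilde.embed hs.le ∘L (e.symm : W →L[ℂ] Htilde Ω s)

theorem energyEmbed_apply (u : Htilde Ω s) : energyEmbed hs e (e u) = Htilde.embed hs.le u := by
  simp [energyEmbed]

theorem energyEmbed_injective : Function.Injective (energyEmbed hs e) :=
  (Htilde.embed_injective hs.le).comp e.symm.injective

theorem denseRange_energyEmbed : DenseRange (energyEmbed hs e) :=
  (Htilde.denseRange_embed hs.le).comp e.symm.surjective.denseRange
    (Htilde.embed hs.le).continuous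

/-- The adjoint of the embedding represents the duality pairing of `L̃²(Ω)` with test functions
in the energy inner product. The complex conjugate accounts for the pairing being bilinear. -/
theorem pair_eq_inner_energyEmbed (u : Htilde Ω 0) {ψ : 𝓢(E, ℂ)} (h : HasCompactSupport ψ)
    (h' : tsupport ψ ⊆ Ω) :
    (u : Hs E 0).pair ψ = inner ℂ (e (Htilde.ofTest s (conjSchwartz ψ)
      (hasCompactSupport_conjSchwartz h) ((tsupport_conjSchwartz_subset ψ).trans h')))
      (((energyEmbed hs e)†) u) := by
  rw [ContinuousLinearMap.adjoint_inner_right, energyEmbed_apply, Htilde.embed_ofTest,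
    Htilde.pair_eq_inner u h h']

/-- In the energy inner product, `(-Δ)^s` becomes the identity. -/
theorem IsEnergyEquiv.pair_fracLap (he : IsEnergyEquiv hs e) (u : Htilde Ω s) {ψ : 𝓢(E, ℂ)}
    (h : HasCompactSupport ψ) (h' : tsupport ψ ⊆ Ω) :
    (fracLap s hs.le (t := -s) (by linarith) (u : Hs E s)).pair ψ =
      inner ℂ (e (Htilde.ofTest s (conjSchwartz ψ) (hasCompactSupport_conjSchwartz h)
        ((tsupport_conjSchwartz_subset ψ).trans h'))) (e u) := by
  rw [he, Hs.pair_fracLap hs.le]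
  rfl

theorem TestFun.pair_slice (φ : TestFun Ω T) (u : Htilde Ω 0) (t : ℝ) :
    (u : Hs E 0).pair (φ.slice t) =
      inner ℂ (e (φ.conj.toHtilde s t)) (((energyEmbed hs e)†) u) :=
  pair_eq_inner_energyEmbed u (φ.hasCompactSupport_slice t) (φ.tsupport_slice_subset t)

theorem TestFun.pair_slice_dt (φ : TestFun Ω T) (u : Htilde Ω 0) (t : ℝ) :
    (u : Hs E 0).pair (φ.dt.slice t) =
      inner ℂ (e (φ.conj.dt.toHtilde s t)) (((energyEmbed hs e)†) u) := by
  rw [pair_eq_inner_energyEmbed (hs := hs) (e := e) u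
    (φ.dt.hasCompactSupport_slice t) (φ.dt.tsupport_slice_subset t)]
  congr 2
  exact Subtype.ext (congrArg (Hs.ofSchwartz s) (φ.conjSchwartz_slice_dt t))

theorem IsEnergyEquiv.pair_fracLap_slice (he : IsEnergyEquiv hs e) (φ : TestFun Ω T)
    (u : Htilde Ω s) (t : ℝ) :
    (fracLap s hs.le (t := -s) (by linarith) (u : Hs E s)).pair (φ.slice t) =
      inner ℂ (e (φ.conj.toHtilde s t)) (e u) :=
  he.pair_fracLap u (φ.hasCompactSupport_slice t) (φ.tsupport_slice_subset t)

theorem integrableOn_inner {X : Type*} [NormedAddCommGroup X] [InnerProductSpace ℂ X]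
    {f g : ℝ → X} (hf : Continuous f) (hg : IntegrableOn g (Ioo 0 T)) :
    IntegrableOn (fun t => inner ℂ (f t) (g t)) (Ioo 0 T) := by
  obtain ⟨C, hC⟩ := (isCompact_Icc (a := (0 : ℝ)) (b := T)).exists_bound_of_continuousOn
    hf.continuousOn
  refine Integrable.mono' (hg.norm.const_mul C)
    (hf.aestronglyMeasurable.inner hg.aestronglyMeasurable) ?_
  filter_upwards [ae_restrict_mem measurableSet_Ioo] with t ht
  exact (norm_inner_le_norm _ _).trans
    (mul_le_mul_of_nonneg_right (hC t (Ioo_subset_Icc_self ht)) (norm_nonneg _))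

/-- A potential as an operator on the energy space. -/
def energyPotential (e : Htilde Ω s ≃L[ℂ] W) (Q : Htilde Ω s →L[ℝ] Htilde Ω 0) :
    W →L[ℝ] Htilde Ω 0 :=
  Q ∘L ((e.symm : W →L[ℂ] Htilde Ω s).restrictScalars ℝ)

theorem energyPotential_apply (Q : Htilde Ω s →L[ℝ] Htilde Ω 0) (u : Htilde Ω s) :
    energyPotential e Q (e u) = Q u := by
  simp [energyPotential]

/-- The right-hand side `A⁻¹(F - q u - α u'') - b u' - c u` of the equation for `A⁻¹ u'''`, as an
element of the energy space. -/
def energyRhs (hs : 0 < s) (e : Htilde Ω s ≃L[ℂ] W) (α b c : ℝ)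
    (Q : ℝ → Htilde Ω s →L[ℝ] Htilde Ω 0) (F : ℝ → Htilde Ω 0) (u v : ℝ → Htilde Ω s)
    (a : ℝ → Htilde Ω 0) (t : ℝ) : W :=
  ((energyEmbed hs e)†) (F t - Q t (u t) - α • a t) - b • e (v t) - c • e (u t)

variable {α b c : ℝ} {Q : ℝ → Htilde Ω s →L[ℝ] Htilde Ω 0} {F a : ℝ → Htilde Ω 0}
  {u v : ℝ → Htilde Ω s}

theorem integrableOn_energyRhs (hF : IntegrableOn F (Ioo 0 T))
    (hQ : IntegrableOn (fun t => Q t (u t)) (Ioo 0 T)) (ha : IntegrableOn a (Ioo 0 T))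
    (hu : IntegrableOn u (Ioo 0 T)) (hv : IntegrableOn v (Ioo 0 T)) :
    IntegrableOn (energyRhs hs e α b c Q F u v a) (Ioo 0 T) := by
  have h1 : IntegrableOn (fun t => e (u t)) (Ioo 0 T) :=
    (e : Htilde Ω s →L[ℂ] W).integrable_comp hu
  have h2 : IntegrableOn (fun t => e (v t)) (Ioo 0 T) :=
    (e : Htilde Ω s →L[ℂ] W).integrable_comp hv
  exact ((((energyEmbed hs e)†).integrable_comp ((hF.sub hQ).sub (ha.smul α))).sub
    (h2.smul b)).sub (h1.smul c)

/-- The weak formulation, tested with `φ`, as an identity in the energy space. -/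
theorem weak_iff (he : IsEnergyEquiv hs e) {p : ℝ≥0∞} [Fact (1 ≤ p)]
    {m : Lp ℝ p (volume.restrict Ω) →L[ℝ] Htilde Ω s →L[ℝ] Htilde Ω 0}
    (hm : ∀ q u (φ : 𝓢(E, ℂ)), HasCompactSupport φ → tsupport φ ⊆ Ω →
        ((m q u : Htilde Ω 0) : Hs E 0).pair φ =
          ∫ x in Ω, ((q x : ℝ) : ℂ) * (Htilde.embed hs.le u : Hs E 0).toL2 x * φ x)
    {q : ℝ → Lp ℝ p (volume.restrict Ω)} (hF : IntegrableOn F (Ioo 0 T))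
    (hQ : IntegrableOn (fun t => m (q t) (u t)) (Ioo 0 T)) (ha : IntegrableOn a (Ioo 0 T))
    (hu : IntegrableOn u (Ioo 0 T)) (hv : IntegrableOn v (Ioo 0 T)) (a₀ : Htilde Ω 0)
    (φ : TestFun Ω T) :
    (- (∫ t in Ioo 0 T, (a t : Hs E 0).pair (φ.dt.slice t))
      + (α * (∫ t in Ioo 0 T, (a t : Hs E 0).pair (φ.slice t))
        + b * (∫ t in Ioo 0 T,
            (fracLap s hs.le (t := -s) (by linarith) (v t : Hs E s)).pair (φ.slice t))
        + c * (∫ t in Ioo 0 T,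
            (fracLap s hs.le (t := -s) (by linarith) (u t : Hs E s)).pair (φ.slice t))
        + ∫ t in Ioo 0 T, ∫ x in Ω,
            ((q t x : ℝ) : ℂ) * (Htilde.embed hs.le (u t) : Hs E 0).toL2 x * φ.toFun (t, x))
      = (∫ t in Ioo 0 T, (F t : Hs E 0).pair (φ.slice t)) + (a₀ : Hs E 0).pair (φ.slice 0)) ↔
    ∫ t in Ioo 0 T, (innerBilin W (e (φ.conj.dt.toHtilde s t)) (((energyEmbed hs e)†) (a t)) +
        innerBilin W (e (φ.conj.toHtilde s t))
          (energyRhs hs e α b c (fun t => m (q t)) F u v a t)) =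
      - innerBilin W (e (φ.conj.toHtilde s 0)) (((energyEmbed hs e)†) a₀) := by
  have hθ : Continuous fun t => e (φ.conj.toHtilde s t) :=
    e.continuous.comp (φ.conj.continuous_toHtilde s)
  have hθ' : Continuous fun t => e (φ.conj.dt.toHtilde s t) :=
    e.continuous.comp (φ.conj.dt.continuous_toHtilde s)
  have hadj : ∀ {g : ℝ → Htilde Ω 0}, IntegrableOn g (Ioo 0 T) →
      IntegrableOn (fun t => ((energyEmbed hs e)†) (g t)) (Ioo 0 T) := fun hg =>
    ((energyEmbed hs e)†).integrable_comp hg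
  have h1 : ∀ t, ∫ x in Ω,
      ((q t x : ℝ) : ℂ) * (Htilde.embed hs.le (u t) : Hs E 0).toL2 x * φ.toFun (t, x) =
      inner ℂ (e (φ.conj.toHtilde s t)) (((energyEmbed hs e)†) (m (q t) (u t))) := fun t => by
    rw [← TestFun.pair_slice]
    exact (hm (q t) (u t) (φ.slice t) (φ.hasCompactSupport_slice t)
      (φ.tsupport_slice_subset t)).symm
  have h2 : ∀ t, innerBilin W (e (φ.conj.toHtilde s t))
      (energyRhs hs e α b c (fun t => m (q t)) F u v a t) =
      inner ℂ (e (φ.conj.toHtilde s t)) (((energyEmbed hs e)†) (F t))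
      - inner ℂ (e (φ.conj.toHtilde s t)) (((energyEmbed hs e)†) (m (q t) (u t)))
      - α * inner ℂ (e (φ.conj.toHtilde s t)) (((energyEmbed hs e)†) (a t))
      - b * inner ℂ (e (φ.conj.toHtilde s t)) (e (v t))
      - c * inner ℂ (e (φ.conj.toHtilde s t)) (e (u t)) := fun t => by
    rw [energyRhs, map_sub ((energyEmbed hs e)†), map_sub ((energyEmbed hs e)†),
      ContinuousLinearMap.map_smul_of_tower]
    simp only [map_sub, map_smul, innerBilin_apply, Complex.real_smul]
  simp only [TestFun.pair_slice_dt (hs := hs) (e := e)]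
  simp only [h1, h2, TestFun.pair_slice (hs := hs) (e := e), he.pair_fracLap_slice,
    innerBilin_apply]
  have i1 := integrableOn_inner hθ (hadj hF)
  have i2 := integrableOn_inner hθ (hadj hQ)
  have i3 := (integrableOn_inner hθ (hadj ha)).const_mul (α : ℂ)
  have i4 := (integrableOn_inner hθ ((e : Htilde Ω s →L[ℂ] W).integrable_comp hv)).const_mul (b : ℂ)
  have i5 := (integrableOn_inner hθ ((e : Htilde Ω s →L[ℂ] W).integrable_comp hu)).const_mul (c : ℂ)
  have i6 := integrableOn_inner hθ' (hadj ha)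
  have e1 := integral_add i6 ((((i1.sub i2).sub i3).sub i4).sub i5)
  have e2 := integral_sub (((i1.sub i2).sub i3).sub i4) i5
  have e3 := integral_sub ((i1.sub i2).sub i3) i4
  have e4 := integral_sub (i1.sub i2) i3
  have e5 := integral_sub i1 i2
  simp only [Pi.sub_apply, integral_const_mul, ContinuousLinearEquiv.coe_coe] at e1 e2 e3 e4 e5
  rw [e1, e2, e3, e4, e5]
  constructor
  · intro h
    linear_combination -h
  · intro h
    linear_combination -h

end WeakForm

/-! ### Weak solutions and energy solutions -/

section Equivalence

variable {X : Type*} [NormedAddCommGroup X] [NormedSpace ℝ X] {T : ℝ}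

theorem isFiniteMeasure_timeMeasure (T : ℝ) : IsFiniteMeasure (timeMeasure T) :=
  inferInstanceAs (IsFiniteMeasure (volume.restrict (Ioo 0 T)))

theorem memLp_timeMeasure_of_continuous {g : ℝ → X} (hg : Continuous g) (p : ℝ≥0∞) :
    MemLp g p (timeMeasure T) := by
  haveI := isFiniteMeasure_timeMeasure T
  obtain ⟨C, hC⟩ := (isCompact_Icc (a := (0 : ℝ)) (b := T)).exists_bound_of_continuousOn
    hg.continuousOn
  refine MemLp.of_bound hg.aestronglyMeasurable C ?_
  filter_upwards [ae_restrict_mem measurableSet_Ioo] with t ht using hC t (Ioo_subset_Icc_self ht)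

theorem MemLp.integrableOn_Ioo {g : ℝ → X} {p : ℝ≥0∞} (hp : 1 ≤ p)
    (hg : MemLp g p (timeMeasure T)) : IntegrableOn g (Ioo 0 T) :=
  haveI := isFiniteMeasure_timeMeasure T
  hg.integrable hp

theorem HasInitialValue.congr {u v : ℝ → X} {a : X} (h : HasInitialValue T u a)
    (huv : u =ᵐ[timeMeasure T] v) : HasInitialValue T v a := by
  obtain ⟨w, hw, hwu, h0⟩ := h
  exact ⟨w, hw, hwu.trans huv, h0⟩

variable {E : Type*} [NormedAddCommGroup E] [InnerProductSpace ℝ E] [FiniteDimensional ℝ E]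
  [MeasurableSpace E] [BorelSpace E] {s : ℝ} {Ω : Set E}
  {W : Type*} [NormedAddCommGroup W] [InnerProductSpace ℂ W] [CompleteSpace W]
  {hs : 0 < s} {e : Htilde Ω s ≃L[ℂ] W}
  {α b c : ℝ} {F a : ℝ → Htilde Ω 0} {u v : ℝ → Htilde Ω s}
  {u₀ u₁ : Htilde Ω s} {u₂ : Htilde Ω 0} {Q : ℝ → W →L[ℝ] Htilde Ω 0}

namespace IsEnergySolution

theorem isPrimitive_position
    (h : IsEnergySolution (energyEmbed hs e) α b c T Q F (e u₀) (e u₁) u₂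
      (fun t => e (u t)) (fun t => e (v t)) a) : IsPrimitive T u₀ u v := by
  simpa using h.fst.clm ((e.symm : W →L[ℂ] Htilde Ω s).restrictScalars ℝ)

theorem isPrimitive_velocity
    (h : IsEnergySolution (energyEmbed hs e) α b c T Q F (e u₀) (e u₁) u₂
      (fun t => e (u t)) (fun t => e (v t)) a) :
    IsPrimitive T (Htilde.embed hs.le u₁) (fun t => Htilde.embed hs.le (v t)) a := by
  simpa only [energyEmbed_apply] using h.snd

theorem timeDeriv_ae_eq (hT : 0 ≤ T)
    (h : IsEnergySolution (energyEmbed hs e) α b c T Q F (e u₀) (e u₁) u₂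
      (fun t => e (u t)) (fun t => e (v t)) a) : timeDeriv T u =ᵐ[timeMeasure T] v :=
  (h.isPrimitive_position.hasTimeDeriv hT).timeDeriv_ae_eq

theorem hasTimeDeriv_embed (hT : 0 ≤ T)
    (h : IsEnergySolution (energyEmbed hs e) α b c T Q F (e u₀) (e u₁) u₂
      (fun t => e (u t)) (fun t => e (v t)) a) :
    HasTimeDeriv T (fun t => Htilde.embed hs.le (u t)) (fun t => Htilde.embed hs.le (v t)) :=
  (h.isPrimitive_position.hasTimeDeriv hT).clm ((Htilde.embed hs.le).restrictScalars ℝ)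

theorem timeDeriv_timeDeriv_ae_eq (hT : 0 ≤ T)
    (h : IsEnergySolution (energyEmbed hs e) α b c T Q F (e u₀) (e u₁) u₂
      (fun t => e (u t)) (fun t => e (v t)) a) :
    timeDeriv T (timeDeriv T fun t => Htilde.embed hs.le (u t)) =ᵐ[timeMeasure T] a :=
  ((h.isPrimitive_velocity.hasTimeDeriv hT).congr
    (h.hasTimeDeriv_embed hT).timeDeriv_ae_eq.symm EventuallyEq.rfl).timeDeriv_ae_eq

end IsEnergySolution

variable {p : ℝ≥0∞} [Fact (1 ≤ p)]
    {m : Lp ℝ p (volume.restrict Ω) →L[ℝ] Htilde Ω s →L[ℝ] Htilde Ω 0}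
    {q : ℝ → Lp ℝ p (volume.restrict Ω)}

/-- Energy solutions are weak solutions. -/
theorem IsEnergySolution.isWeakSolution (he : IsEnergyEquiv hs e)
    (hm : ∀ q u (φ : 𝓢(E, ℂ)), HasCompactSupport φ → tsupport φ ⊆ Ω →
        ((m q u : Htilde Ω 0) : Hs E 0).pair φ =
          ∫ x in Ω, ((q x : ℝ) : ℂ) * (Htilde.embed hs.le u : Hs E 0).toL2 x * φ x)
    (hT : 0 < T) (hF : IntegrableOn F (Ioo 0 T))
    (hQ : IntegrableOn (fun t => m (q t) (u t)) (Ioo 0 T))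
    (hu : Continuous u) (hv : Continuous v) (ha : Continuous a)
    (h : IsEnergySolution (energyEmbed hs e) α b c T (fun t => energyPotential e (m (q t))) F
      (e u₀) (e u₁) u₂ (fun t => e (u t)) (fun t => e (v t)) a) :
    IsWeakSolution Ω T hs α b c q u₀ u₁ u₂ F u := by
  have hp := h.isPrimitive_position
  have hv' := h.isPrimitive_velocity
  have e1 := h.timeDeriv_ae_eq hT.le
  have e2 := (h.hasTimeDeriv_embed hT.le).timeDeriv_ae_eq
  have e3 := h.timeDeriv_timeDeriv_ae_eq hT.le
  have hι : Continuous (Htilde.embed (Ω := Ω) hs.le) := (Htilde.embed hs.le).continuous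
  refine ⟨⟨memLp_timeMeasure_of_continuous hu _, v, hp.hasTimeDeriv hT.le,
      memLp_timeMeasure_of_continuous hv _⟩,
    ⟨memLp_timeMeasure_of_continuous (hι.comp hu) _, _, h.hasTimeDeriv_embed hT.le,
      memLp_timeMeasure_of_continuous (hι.comp hv) _, a, hv'.hasTimeDeriv hT.le,
      memLp_timeMeasure_of_continuous ha _⟩,
    hp.hasInitialValue hT.le, (hv'.hasInitialValue hT.le).congr e2.symm, fun φ => ?_⟩
  refine (weak_iff (v := timeDeriv T u) he hm hF hQ
    ((integrableOn_Ioo_of_continuous ha).congr e3.symm) (integrableOn_Ioo_of_continuous hu)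
    ((integrableOn_Ioo_of_continuous hv).congr e1.symm) u₂ φ).mpr ?_
  have hr : IsPrimitive T (((energyEmbed hs e)†) u₂) (fun t => ((energyEmbed hs e)†) (a t))
      (energyRhs hs e α b c (fun t => m (q t)) F u v a) := by
    have := h.trd
    simp only [energyPotential_apply] at this
    exact this
  have hrc : Continuous fun t => ((energyEmbed hs e)†) (a t) :=
    ((energyEmbed hs e)†).continuous.comp ha
  have hθ' : Continuous fun t => e (φ.conj.dt.toHtilde s t) :=
    e.continuous.comp (φ.conj.dt.continuous_toHtilde s)
  have key := integral_bilin_eq_sub (innerBilin W) (p := fun t => e (φ.conj.toHtilde s t))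
    (p' := fun t => e (φ.conj.dt.toHtilde s t)) (r := fun t => ((energyEmbed hs e)†) (a t))
    (r' := energyRhs hs e α b c (fun t => m (q t)) F u v a) hT.le
    (integrableOn_Ioo_iff_Ioc.mp (integrableOn_Ioo_of_continuous hθ'))
    (integrableOn_Ioo_iff_Ioc.mp hr.integrableOn)
    (fun t ht => by
      have := ((e : Htilde Ω s →L[ℂ] W).restrictScalars ℝ).intervalIntegral_comp_comm
        ((φ.conj.dt.continuous_toHtilde s).intervalIntegrable (μ := volume) 0 t)
      rw [φ.conj.toHtilde_eq_add_integral s ht.1, map_add]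
      exact congrArg _ this.symm)
    (fun t ht => by
      have h0 := hr.apply_zero hT hrc.continuousOn
      beta_reduce at h0
      rw [h0]
      exact hr.eqOn hT hrc.continuousOn t ht)
  have h0 := hr.apply_zero hT hrc.continuousOn
  beta_reduce at h0
  rw [φ.conj.toHtilde_eq_zero s le_rfl, map_zero, map_zero, zero_apply, zero_sub, h0,
    integral_Ioc_eq_integral_Ioo] at key
  rw [← key]
  refine integral_congr_ae ?_
  filter_upwards [e1, e3] with t h1 h3
  rw [energyRhs, energyRhs, h1, h3]

theorem TestFun.conj_toHtilde_tensor {η : ℝ → ℝ} (hη : ContDiff ℝ ∞ η) (hηc : HasCompactSupport η)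
    (hηT : tsupport η ⊆ Iio T) {ψ : 𝓢(E, ℂ)} (hψ : HasCompactSupport ψ) (hψΩ : tsupport ψ ⊆ Ω)
    (t : ℝ) :
    (tensor η hη hηc hηT (conjSchwartz ψ) (hasCompactSupport_conjSchwartz hψ)
      ((tsupport_conjSchwartz_subset ψ).trans hψΩ)).conj.toHtilde s t =
      η t • Htilde.ofTest s ψ hψ hψΩ := by
  refine Subtype.ext ?_
  have h1 : (tensor η hη hηc hηT (conjSchwartz ψ) (hasCompactSupport_conjSchwartz hψ)
      ((tsupport_conjSchwartz_subset ψ).trans hψΩ)).conj.slice t = ((η t : ℝ) : ℂ) • ψ := by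
    rw [← conjSchwartz_slice, slice_tensor]
    ext x
    simp [conjSchwartz_apply]
  exact (congrArg (Hs.ofSchwartz s) h1).trans (map_smul _ _ _)

theorem TestFun.conj_dt_toHtilde_tensor {η : ℝ → ℝ} (hη : ContDiff ℝ ∞ η)
    (hηc : HasCompactSupport η) (hηT : tsupport η ⊆ Iio T) {ψ : 𝓢(E, ℂ)}
    (hψ : HasCompactSupport ψ) (hψΩ : tsupport ψ ⊆ Ω) (t : ℝ) :
    (tensor η hη hηc hηT (conjSchwartz ψ) (hasCompactSupport_conjSchwartz hψ)
      ((tsupport_conjSchwartz_subset ψ).trans hψΩ)).conj.dt.toHtilde s t =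
      deriv η t • Htilde.ofTest s ψ hψ hψΩ := by
  refine Subtype.ext ?_
  have h1 : (tensor η hη hηc hηT (conjSchwartz ψ) (hasCompactSupport_conjSchwartz hψ)
      ((tsupport_conjSchwartz_subset ψ).trans hψΩ)).conj.dt.slice t =
      ((deriv η t : ℝ) : ℂ) • ψ := by
    rw [← conjSchwartz_slice_dt, slice_dt_tensor]
    ext x
    simp [conjSchwartz_apply]
  exact (congrArg (Hs.ofSchwartz s) h1).trans (map_smul _ _ _)

/-- Elements of the energy space are determined by their inner products with test functions. -/
theorem eq_zero_of_inner_ofTest (w : W)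
    (h : ∀ (ψ : 𝓢(E, ℂ)) (hψ : HasCompactSupport ψ) (hψΩ : tsupport ψ ⊆ Ω),
      inner ℂ (e (Htilde.ofTest s ψ hψ hψΩ)) w = 0) : w = 0 := by
  have h1 : ∀ u : Htilde Ω s, inner ℂ (e u) w = 0 := fun u =>
    Htilde.induction (P := fun u => inner ℂ (e u) w = 0)
      (isClosed_eq (e.continuous.inner continuous_const) continuous_const) h u
  have h2 := h1 (e.symm w)
  rw [e.apply_symm_apply] at h2
  exact inner_self_eq_zero.mp h2

/-- A weak solution, with its derivatives, is an energy solution: test with `η(t) ψ(x)`, where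
`η` need not vanish at time zero, so that the initial value of `u''` is attained as well. -/
theorem IsWeakSolution.isEnergySolution (he : IsEnergyEquiv hs e)
    (hm : ∀ q u (φ : 𝓢(E, ℂ)), HasCompactSupport φ → tsupport φ ⊆ Ω →
        ((m q u : Htilde Ω 0) : Hs E 0).pair φ =
          ∫ x in Ω, ((q x : ℝ) : ℂ) * (Htilde.embed hs.le u : Hs E 0).toL2 x * φ x)
    (hT : 0 < T) (hF : IntegrableOn F (Ioo 0 T))
    (hQ : IntegrableOn (fun t => m (q t) (u t)) (Ioo 0 T))
    (h : IsWeakSolution Ω T hs α b c q u₀ u₁ u₂ F u) :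
    IsEnergySolution (energyEmbed hs e) α b c T (fun t => energyPotential e (m (q t))) F
      (e u₀) (e u₁) u₂ (fun t => e (u t)) (fun t => e (timeDeriv T u t))
      (timeDeriv T (timeDeriv T fun t => Htilde.embed hs.le (u t))) := by
  obtain ⟨hu, v', hv', hv'm⟩ := h.memW_one
  obtain ⟨-, w', hw', -, a', ha', ha'm⟩ := h.memW_two
  set v := timeDeriv T u with hv
  set a := timeDeriv T (timeDeriv T fun t => Htilde.embed hs.le (u t)) with ha
  have hui : IntegrableOn u (Ioo 0 T) := MemLp.integrableOn_Ioo le_top hu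
  have hvi : IntegrableOn v (Ioo 0 T) :=
    (MemLp.integrableOn_Ioo le_top hv'm).congr hv'.timeDeriv_ae_eq.symm
  have huv : HasTimeDeriv T u v := hv'.hasTimeDeriv_timeDeriv
  have hιv : timeDeriv T (fun t => Htilde.embed hs.le (u t)) =ᵐ[timeMeasure T]
      fun t => Htilde.embed hs.le (v t) :=
    (huv.clm ((Htilde.embed hs.le).restrictScalars ℝ)).timeDeriv_ae_eq
  have hda := ha'.congr hw'.timeDeriv_ae_eq.symm EventuallyEq.rfl
  have hai : IntegrableOn a (Ioo 0 T) :=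
    (MemLp.integrableOn_Ioo le_top ha'm).congr hda.timeDeriv_ae_eq.symm
  have hva : HasTimeDeriv T (fun t => Htilde.embed hs.le (v t)) a :=
    hda.hasTimeDeriv_timeDeriv.congr hιv EventuallyEq.rfl
  have hr'i := integrableOn_energyRhs (hs := hs) (e := e) (α := α) (b := b) (c := c)
    (Q := fun t => m (q t)) hF hQ hai hui hvi
  have hri : IntegrableOn (fun t => ((energyEmbed hs e)†) (a t)) (Ioo 0 T) :=
    ((energyEmbed hs e)†).integrable_comp hai
  refine ⟨?_, ?_, ?_⟩
  · exact IsPrimitive.clm ⟨hvi, huv.eq_primitive_of_hasInitialValue hT hvi h.initial_zero⟩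
      ((e : Htilde Ω s →L[ℂ] W).restrictScalars ℝ)
  · simp only [energyEmbed_apply]
    exact ⟨hai, hva.eq_primitive_of_hasInitialValue hT hai (h.initial_one.congr hιv)⟩
  simp only [energyPotential_apply]
  set r₀ := ((energyEmbed hs e)†) u₂ with hr₀
  change IsPrimitive T r₀ _ (energyRhs hs e α b c (fun t => m (q t)) F u v a)
  set r' := energyRhs hs e α b c (fun t => m (q t)) F u v a
  refine ⟨hr'i, ?_⟩
  have hfin := isFiniteMeasure_timeMeasure T
  have hzi : IntegrableOn (fun t => ((energyEmbed hs e)†) (a t) - r₀) (Ioo 0 T) :=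
    hri.sub (integrable_const r₀)
  have key := ae_eq_neg_primitive_of_integral_deriv_smul hT hzi hr'i.neg
    (fun η hη hηc hηT => by
      have hη' : Continuous (deriv η) := hη.continuous_deriv (by simp)
      have hsm : ∀ {η : ℝ → ℝ} {g : ℝ → W}, Continuous η → IntegrableOn g (Ioo 0 T) →
          IntegrableOn (fun t => η t • g t) (Ioo 0 T) := fun {_ g} hη hg => by
        have hg' : IntegrableOn g (Icc 0 T) := by rwa [integrableOn_Icc_iff_integrableOn_Ioo]
        exact (hg'.continuousOn_smul hη.continuousOn isCompact_Icc).mono_set Ioo_subset_Icc_self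
      have i1 := hsm hη' hri
      have i2 := hsm hη' (integrable_const (μ := timeMeasure T) r₀)
      have i3 := hsm hη.continuous hr'i
      have hηint : ∫ t in Ioo 0 T, deriv η t = - η 0 := by
        have hηT0 : η T = 0 := image_eq_zero_of_notMem_tsupport fun h => lt_irrefl T (hηT h)
        rw [← integral_Ioc_eq_integral_Ioo, ← intervalIntegral.integral_of_le hT.le,
          intervalIntegral.integral_deriv_eq_sub
            (fun t _ => (hη.differentiable (by simp)).differentiableAt)
            (hη'.intervalIntegrable _ _), hηT0, zero_sub]
      -- By density, it suffices to test this identity in the energy space against `ψ ∈ C_c^∞(Ω)`.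
      have hD : (∫ t in Ioo 0 T, (deriv η t • ((energyEmbed hs e)†) (a t) + η t • r' t)) +
          η 0 • r₀ = 0 := by
        refine eq_zero_of_inner_ofTest (e := e) _ fun ψ hψ hψΩ => ?_
        have hweak := (weak_iff (v := v) he hm hF hQ hai hui hvi u₂ _).mp (h.weak
          (TestFun.tensor η hη hηc hηT (conjSchwartz ψ) (hasCompactSupport_conjSchwartz hψ)
            ((tsupport_conjSchwartz_subset ψ).trans hψΩ)))
        have hsw : ∀ (x : ℝ) (y : W), innerBilin W (e (x • Htilde.ofTest s ψ hψ hψΩ)) y =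
            inner ℂ (e (Htilde.ofTest s ψ hψ hψΩ)) (x • y) := fun x y => by
          rw [innerBilin_apply, ← Complex.coe_smul x, ← Complex.coe_smul x, map_smul,
            inner_smul_left, inner_smul_right, Complex.conj_ofReal]
        simp only [TestFun.conj_toHtilde_tensor hη hηc hηT hψ hψΩ,
          TestFun.conj_dt_toHtilde_tensor hη hηc hηT hψ hψΩ, hsw, ← inner_add_right] at hweak
        have hI := integral_inner (𝕜 := ℂ) (i1.add i3) (e (Htilde.ofTest s ψ hψ hψΩ))
        simp only [Pi.add_apply] at hI
        rw [inner_add_right, ← hI]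
        exact eq_neg_iff_add_eq_zero.mp hweak
      simp only [smul_sub, Pi.neg_apply, smul_neg]
      rw [integral_sub i1 i2, integral_smul_const, hηint, integral_neg, eq_neg_iff_add_eq_zero,
        ← hD, integral_add i1 i3, neg_smul]
      abel)
  filter_upwards [key] with t ht
  rw [eq_add_of_sub_eq' ht, ← intervalIntegral.integral_neg]
  simp

end Equivalence

/-! ### Well-posedness -/

section WellPosedness

section Abstract

variable {V H : Type*} [NormedAddCommGroup V] [InnerProductSpace ℂ V]
  [NormedAddCommGroup H] [InnerProductSpace ℂ H] [CompleteSpace V] [CompleteSpace H]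
  {J : V →L[ℂ] H} {α b c T : ℝ} {Q : ℝ → V →L[ℝ] H} {F : ℝ → H}

theorem IsPrimitive.sub {X : Type*} [NormedAddCommGroup X] [NormedSpace ℝ X] {p₀ q₀ : X}
    {p p' q q' : ℝ → X} (h : IsPrimitive T p₀ p p') (k : IsPrimitive T q₀ q q') :
    IsPrimitive T (p₀ - q₀) (fun t => p t - q t) (fun t => p' t - q' t) := by
  simpa only [neg_smul, one_smul, ← sub_eq_add_neg] using h.add (k.smul (-1))

/-- Uniqueness of energy solutions: the difference of two of them solves the homogeneous problem. -/
theorem IsEnergySolution.ae_unique {M : ℝ} (hJ : Function.Injective J) (hJd : DenseRange J)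
    (hb : 0 < b) (hM0 : 0 ≤ M) (hQ : AEStronglyMeasurable Q (timeMeasure T))
    (hM : ∀ᵐ t ∂(timeMeasure T), ‖Q t‖ ≤ M) {u₀ v₀ : V} {a₀ : H} {u v u' v' : ℝ → V}
    {a a' : ℝ → H} (hu : IntegrableOn u (Ioo 0 T)) (hu' : IntegrableOn u' (Ioo 0 T))
    (h : IsEnergySolution J α b c T Q F u₀ v₀ a₀ u v a)
    (h' : IsEnergySolution J α b c T Q F u₀ v₀ a₀ u' v' a') : u =ᵐ[timeMeasure T] u' := by
  have hs : IsEnergySolution J α b c T Q 0 0 0 0 (fun t => u t - u' t) (fun t => v t - v' t)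
      (fun t => a t - a' t) := by
    refine ⟨(h.fst.sub h'.fst).congr (sub_self _) EventuallyEq.rfl EventuallyEq.rfl,
      (h.snd.sub h'.snd).congr ?_ (.of_forall fun t => ?_) EventuallyEq.rfl,
      (h.trd.sub h'.trd).congr ?_ (.of_forall fun t => ?_) (.of_forall fun t => ?_)⟩
    · rw [sub_self, map_zero]
    · exact (map_sub J _ _).symm
    · rw [sub_self, map_zero]
    · exact (map_sub (J†) _ _).symm
    · simp only [Pi.zero_apply, map_sub, map_zero, smul_sub]
      abel
  filter_upwards [hs.ae_eq_zero hJ hJd hb hM0 hQ hM (hu.sub hu')] with t ht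
  exact sub_eq_zero.mp ht

end Abstract

variable {E : Type*} [NormedAddCommGroup E] [InnerProductSpace ℝ E] [FiniteDimensional ℝ E]
  [MeasurableSpace E] [BorelSpace E] {s T : ℝ} {Ω : Set E}

/-- The map `L̃²(Ω) → H^{-s}(Ω)`, `h ↦ h|_Ω`. -/
def restrictNegZero (Ω : Set E) (hs : 0 < s) : Htilde Ω 0 →L[ℂ] HsOn Ω (-s) :=
  (vanishingOn Ω (-s)).mkQL ∘L Hs.embed (by linarith) ∘L (Htilde Ω 0).subtypeL

/-- The map `H̃^s(Ω) → H^{-s}(Ω)`, `u ↦ ((-Δ)^s u)|_Ω`. -/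
def restrictFracLap (Ω : Set E) (hs : 0 < s) : Htilde Ω s →L[ℂ] HsOn Ω (-s) :=
  (vanishingOn Ω (-s)).mkQL ∘L fracLap s hs.le (by linarith) ∘L (Htilde Ω s).subtypeL

theorem Hs.pair_sub {r : ℝ} (u v : Hs E r) (ψ : 𝓢(E, ℂ)) :
    (u - v).pair ψ = u.pair ψ - v.pair ψ := by
  simp [Hs.pair]

theorem restrictNeg_eq (hs : 0 < s) (u : Htilde Ω s) :
    restrictNeg hs.le u = restrictNegZero Ω hs (Htilde.embed hs.le u) := by
  refine congrArg (vanishingOn Ω (-s)).mkQ ?_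
  exact (Hs.embed_embed hs.le (neg_nonpos.mpr hs.le) _).symm

variable {W : Type*} [NormedAddCommGroup W] [InnerProductSpace ℂ W] [CompleteSpace W]
  {hs : 0 < s} {e : Htilde Ω s ≃L[ℂ] W}

/-- On `Ω`, the fractional Laplacian inverts the adjoint of the embedding of the energy space. -/
theorem IsEnergyEquiv.restrictFracLap_symm_adjoint (he : IsEnergyEquiv hs e) (h : Htilde Ω 0) :
    restrictFracLap Ω hs (e.symm (((energyEmbed hs e)†) h)) = restrictNegZero Ω hs h := by
  refine (Submodule.Quotient.eq _).mpr fun ψ hψ hψΩ => ?_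
  rw [Hs.pair_sub]
  have h1 := he.pair_fracLap (e.symm (((energyEmbed hs e)†) h)) hψ hψΩ
  have h2 := Hs.pair_embed (neg_nonpos.mpr hs.le) (h : Hs E 0) ψ
  rw [pair_eq_inner_energyEmbed (hs := hs) (e := e) h hψ hψΩ] at h2
  rw [e.apply_symm_apply] at h1
  exact (congrArg₂ (· - ·) h1 h2).trans (sub_self _)

variable {α b c : ℝ} {F a : ℝ → Htilde Ω 0} {u v : ℝ → Htilde Ω s}
  {u₀ u₁ : Htilde Ω s} {u₂ : Htilde Ω 0} {p : ℝ≥0∞} [Fact (1 ≤ p)]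
  {m : Lp ℝ p (volume.restrict Ω) →L[ℝ] Htilde Ω s →L[ℝ] Htilde Ω 0}
  {q : ℝ → Lp ℝ p (volume.restrict Ω)}

theorem exists_norm_apply_le {X Y Z : Type*} [NormedAddCommGroup X] [NormedSpace ℝ X]
    [NormedAddCommGroup Y] [NormedSpace ℝ Y] [NormedAddCommGroup Z] [NormedSpace ℝ Z]
    (m : X →L[ℝ] Y →L[ℝ] Z) : ∃ B : ℝ, 0 ≤ B ∧ ∀ x, ‖m x‖ ≤ B * ‖x‖ :=
  ⟨‖m‖, m.opNorm_nonneg, m.le_opNorm⟩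

theorem exists_norm_potential_le
    (m : Lp ℝ p (volume.restrict Ω) →L[ℝ] Htilde Ω s →L[ℝ] Htilde Ω 0) :
    ∃ B : ℝ, 0 ≤ B ∧ ∀ q, ‖m q‖ ≤ B * ‖q‖ :=
  exists_norm_apply_le m

theorem memLp_potential (hq : MemLp q ∞ (timeMeasure T)) (hu : MemLp u ∞ (timeMeasure T)) :
    MemLp (fun t => m (q t) (u t)) ∞ (timeMeasure T) := by
  obtain ⟨B, hB0, hB⟩ := exists_norm_potential_le m
  refine memLp_top_of_bound (C := B * (eLpNormEssSup q (timeMeasure T)).toReal *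
    (eLpNormEssSup u (timeMeasure T)).toReal) (aestronglyMeasurable_clm_apply
    (m.continuous.comp_aestronglyMeasurable hq.1) hu.1) ?_
  have hb : ∀ {X : Type _} [NormedAddCommGroup X] {g : ℝ → X}, MemLp g ∞ (timeMeasure T) →
      ∀ᵐ t ∂(timeMeasure T), ‖g t‖ ≤ (eLpNormEssSup g (timeMeasure T)).toReal :=
    fun {_ _ g} hg => by
    filter_upwards [ae_le_eLpNormEssSup (f := g)] with t ht
    rw [← toReal_enorm]
    exact ENNReal.toReal_mono (by simpa using hg.2.ne) ht
  filter_upwards [hb hq, hb hu] with t h1 h2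
  refine ((m (q t)).le_of_opNorm_le (hB _) _).trans ?_
  gcongr

/-- Energy solutions belong to `H³(0,T;H^{-s}(Ω))`. -/
theorem IsEnergySolution.memW_three (he : IsEnergyEquiv hs e) (hT : 0 < T)
    (hF : MemLp F 2 (timeMeasure T)) (hQ : MemLp (fun t => m (q t) (u t)) 2 (timeMeasure T))
    (hu : Continuous u) (hv : Continuous v) (ha : Continuous a)
    (h : IsEnergySolution (energyEmbed hs e) α b c T (fun t => energyPotential e (m (q t))) F
      (e u₀) (e u₁) u₂ (fun t => e (u t)) (fun t => e (v t)) a) :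
    MemW T 3 2 (fun t => restrictNeg hs.le (u t)) := by
  set κ : Htilde Ω 0 →L[ℝ] HsOn Ω (-s) := (restrictNegZero Ω hs).restrictScalars ℝ
  have hκ : Continuous κ := κ.continuous
  have hι : Continuous (Htilde.embed (Ω := Ω) hs.le) := (Htilde.embed hs.le).continuous
  simp only [restrictNeg_eq hs]
  have h3 := (h.trd.hasTimeDeriv hT.le).clm
    ((restrictFracLap Ω hs ∘L (e.symm : W →L[ℂ] Htilde Ω s)).restrictScalars ℝ)
  have e1 : ∀ h : Htilde Ω 0, (restrictFracLap Ω hs ∘L (e.symm : W →L[ℂ] Htilde Ω s))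
      (((energyEmbed hs e)†) h) = κ h := fun h => he.restrictFracLap_symm_adjoint h
  have e2 : ∀ u : Htilde Ω s, (restrictFracLap Ω hs ∘L (e.symm : W →L[ℂ] Htilde Ω s)) (e u) =
      restrictFracLap Ω hs u := fun u => by simp
  simp only [ContinuousLinearMap.coe_restrictScalars', map_sub, e1,
    ContinuousLinearMap.map_smul_of_tower, e2, energyPotential_apply] at h3
  refine ⟨memLp_timeMeasure_of_continuous (hκ.comp (hι.comp hu)) _, _,
    (h.hasTimeDeriv_embed hT.le).clm κ,
    memLp_timeMeasure_of_continuous (hκ.comp (hι.comp hv)) _, _,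
    (h.isPrimitive_velocity.hasTimeDeriv hT.le).clm κ,
    memLp_timeMeasure_of_continuous (hκ.comp ha) _, _, h3, ?_⟩
  have hΛ : Continuous (restrictFracLap Ω hs) := (restrictFracLap Ω hs).continuous
  exact ((((κ.comp_memLp' hF).sub (κ.comp_memLp' hQ)).sub
    (memLp_timeMeasure_of_continuous ((hκ.comp ha).const_smul α) _)).sub
    (memLp_timeMeasure_of_continuous ((hΛ.comp hv).const_smul b) _)).sub
    (memLp_timeMeasure_of_continuous ((hΛ.comp hu).const_smul c) _)

/-- The `L¹(0,T)` norm is controlled by the `L²(0,T)` norm. -/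
theorem exists_ofReal_integral_norm_le (T : ℝ) : ∃ K : ℝ≥0, ∀ {X : Type _} [NormedAddCommGroup X]
    {F : ℝ → X}, MemLp F 2 (timeMeasure T) →
      ENNReal.ofReal (∫ t in Ioo 0 T, ‖F t‖) ≤ K * eLpNorm F 2 (timeMeasure T) := by
  have hfin := isFiniteMeasure_timeMeasure T
  refine ⟨((timeMeasure T) univ ^ (1 / (1 : ℝ≥0∞).toReal - 1 / (2 : ℝ≥0∞).toReal)).toNNReal,
    fun {X _ F} hF => ?_⟩
  rw [ENNReal.coe_toNNReal (ENNReal.rpow_ne_top_of_nonneg (by norm_num) (measure_ne_top _ _)),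
    mul_comm, ofReal_integral_norm_eq_lintegral_enorm (hF.integrable (by norm_num)),
    ← eLpNorm_one_eq_lintegral_enorm]
  exact eLpNorm_le_eLpNorm_mul_rpow_measure_univ (by norm_num) hF.1

/-- Well-posedness, on a Euclidean space `E` of positive dimension. -/
theorem exists_weakSolution (hn : 0 < Module.finrank ℝ E) (hΩ : Bornology.IsBounded Ω)
    (hT : 0 < T) (hs : 0 < s) (hp : 2 ≤ p)
    (hp_sub : 2 * s < Module.finrank ℝ E → ENNReal.ofReal (Module.finrank ℝ E / s) ≤ p)
    (hp_crit : 2 * s = Module.finrank ℝ E → 2 < p) (α c : ℝ) (hb : 0 < b) (M : ℝ≥0) :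
    ∃ C : ℝ≥0, 0 < C ∧
      ∀ q : ℝ → Lp ℝ p (volume.restrict Ω), MemLp q ∞ (timeMeasure T) →
        eLpNorm q ∞ (timeMeasure T) ≤ M →
      ∀ (u₀ u₁ : Htilde Ω s) (u₂ : Htilde Ω 0) (F : ℝ → Htilde Ω 0), MemLp F 2 (timeMeasure T) →
      ∃ u : ℝ → Htilde Ω s, IsWeakSolution Ω T hs α b c q u₀ u₁ u₂ F u ∧
        MemW T 3 2 (fun t => restrictNeg hs.le (u t)) ∧
        eLpNorm (timeDeriv T (timeDeriv T fun t => Htilde.embed hs.le (u t))) ∞ (timeMeasure T)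
          + (eLpNorm (fun t => halfLap hs (u t)) ∞ (timeMeasure T)
            + eLpNorm (fun t => halfLap hs (timeDeriv T u t)) ∞ (timeMeasure T))
          ≤ C * (‖halfLap hs u₀‖ₑ + ‖halfLap hs u₁‖ₑ + ‖u₂‖ₑ + eLpNorm F 2 (timeMeasure T)) ∧
        ∀ v : ℝ → Htilde Ω s, IsWeakSolution Ω T hs α b c q u₀ u₁ u₂ F v →
          v =ᵐ[timeMeasure T] u := by
  have hfin := isFiniteMeasure_timeMeasure T
  obtain ⟨hW, e, he⟩ := exists_isEnergyEquiv (Ω := Ω) hn hΩ hs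
  obtain ⟨m, hm⟩ := exists_potentialOperator hn hΩ hs hp hp_sub hp_crit
  have hJ := energyEmbed_injective (hs := hs) (e := e)
  have hJd := denseRange_energyEmbed (hs := hs) (e := e)
  set L : (halfLapCLM Ω hs).range →L[ℝ] Htilde Ω s :=
    (e.symm : (halfLapCLM Ω hs).range →L[ℂ] Htilde Ω s).restrictScalars ℝ with hL
  obtain ⟨B, hB0, hB⟩ := exists_norm_potential_le m
  have hM0 : 0 ≤ B * M * ‖L‖ := by positivity
  obtain ⟨C, hC0, hC⟩ := exists_energySolution hJ hJd hb α c hM0 hT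
  obtain ⟨K, hK⟩ := exists_ofReal_integral_norm_le T
  -- Each of the three norms on the left is at most `C (1 + K)` times the right-hand side; the
  -- summand one makes the constant positive.
  refine ⟨3 * (C.toNNReal * (1 + K)) + 1, by positivity, ?_⟩
  intro q hq hqM u₀ u₁ u₂ F hF
  have hFi : IntegrableOn F (Ioo 0 T) := MemLp.integrableOn_Ioo (by norm_num) hF
  have hQm : AEStronglyMeasurable (fun t => energyPotential e (m (q t))) (timeMeasure T) :=
    (m.continuous.clm_comp continuous_const).comp_aestronglyMeasurable hq.1
  have hQM : ∀ᵐ t ∂(timeMeasure T), ‖energyPotential e (m (q t))‖ ≤ B * M * ‖L‖ := by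
    rw [eLpNorm_exponent_top] at hqM
    filter_upwards [ae_le_eLpNormEssSup (f := q)] with t ht
    have h1 : ‖q t‖ ≤ M := by
      have := ht.trans hqM
      rwa [← ofReal_norm, ENNReal.ofReal_le_iff_le_toReal ENNReal.coe_ne_top,
        ENNReal.coe_toReal] at this
    refine (ContinuousLinearMap.opNorm_comp_le _ _).trans ?_
    exact mul_le_mul_of_nonneg_right ((hB _).trans (by gcongr))
      L.opNorm_nonneg
  obtain ⟨uW, vW, a, huc, hvc, hac, hsol, hbd⟩ := hC _ hQm hQM (e u₀) (e u₁) u₂ F hFi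
  obtain ⟨u, rfl⟩ : ∃ u : ℝ → Htilde Ω s, uW = fun t => e (u t) :=
    ⟨fun t => e.symm (uW t), by simp⟩
  obtain ⟨v, rfl⟩ : ∃ v : ℝ → Htilde Ω s, vW = fun t => e (v t) :=
    ⟨fun t => e.symm (vW t), by simp⟩
  have hu : Continuous u := (e.symm.continuous.comp huc).congr fun t => e.symm_apply_apply _
  have hv : Continuous v := (e.symm.continuous.comp hvc).congr fun t => e.symm_apply_apply _
  have hQu : ∀ {u : ℝ → Htilde Ω s}, MemLp u ∞ (timeMeasure T) →
      MemLp (fun t => m (q t) (u t)) ∞ (timeMeasure T) := fun h => memLp_potential hq h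
  have hQ := hQu (memLp_timeMeasure_of_continuous hu _)
  refine ⟨u, hsol.isWeakSolution he hm hT hFi (MemLp.integrableOn_Ioo le_top hQ) hu hv hac,
    hsol.memW_three he hT hF (hQ.mono_exponent le_top) hu hv hac, ?_, fun w hw => ?_⟩
  · set S : ℝ≥0∞ := ‖halfLap hs u₀‖ₑ + ‖halfLap hs u₁‖ₑ + ‖u₂‖ₑ + eLpNorm F 2 (timeMeasure T)
      with hS
    have hSle : ENNReal.ofReal (C * (‖e u₀‖ + ‖e u₁‖ + ‖u₂‖ + ∫ τ in Ioo 0 T, ‖F τ‖)) ≤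
        (C.toNNReal * (1 + K) : ℝ≥0) * S := by
      have hI : 0 ≤ ∫ τ in Ioo 0 T, ‖F τ‖ := integral_nonneg fun _ => norm_nonneg _
      rw [ENNReal.ofReal_mul hC0, ENNReal.ofReal_add (by positivity) hI,
        ENNReal.ofReal_add (by positivity) (norm_nonneg _),
        ENNReal.ofReal_add (norm_nonneg _) (norm_nonneg _), he.norm_eq, he.norm_eq,
        ofReal_norm, ofReal_norm, ofReal_norm, ENNReal.coe_mul, mul_assoc]
      refine mul_le_mul' le_rfl ?_
      rw [ENNReal.coe_add, ENNReal.coe_one, add_mul, one_mul]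
      calc _ ≤ (‖halfLap hs u₀‖ₑ + ‖halfLap hs u₁‖ₑ + ‖u₂‖ₑ) +
            K * eLpNorm F 2 (timeMeasure T) := by gcongr; exact hK hF
        _ ≤ S + K * S := by
          gcongr
          · exact le_self_add
          · exact le_add_self
    have hae : ∀ {X : Type _} [NormedAddCommGroup X] {g : ℝ → X},
        (∀ᵐ t ∂(timeMeasure T),
          ‖g t‖ ≤ C * (‖e u₀‖ + ‖e u₁‖ + ‖u₂‖ + ∫ τ in Ioo 0 T, ‖F τ‖)) →
        eLpNorm g ∞ (timeMeasure T) ≤ (C.toNNReal * (1 + K) : ℝ≥0) * S := fun hg => by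
      rw [eLpNorm_exponent_top]
      exact (eLpNormEssSup_le_of_ae_bound hg).trans hSle
    have hmem : ∀ᵐ t ∂(timeMeasure T), t ∈ Icc 0 T :=
      (ae_restrict_mem measurableSet_Ioo).mono fun t ht => Ioo_subset_Icc_self ht
    have k1 := hae (g := timeDeriv T (timeDeriv T fun t => Htilde.embed hs.le (u t))) (by
      filter_upwards [hmem, hsol.timeDeriv_timeDeriv_ae_eq hT.le] with t ht h1
      rw [h1]
      exact (hbd t ht).2.2)
    have k2 := hae (g := fun t => halfLap hs (u t)) (by
      filter_upwards [hmem] with t ht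
      rw [← he.norm_eq]
      exact (hbd t ht).1)
    have k3 := hae (g := fun t => halfLap hs (timeDeriv T u t)) (by
      filter_upwards [hmem, hsol.timeDeriv_ae_eq hT.le] with t ht h1
      rw [h1, ← he.norm_eq]
      exact (hbd t ht).2.1)
    calc _ ≤ (C.toNNReal * (1 + K) : ℝ≥0) * S + ((C.toNNReal * (1 + K) : ℝ≥0) * S +
          (C.toNNReal * (1 + K) : ℝ≥0) * S) := by gcongr
      _ = (3 * (C.toNNReal * (1 + K)) : ℝ≥0) * S := by
        push_cast
        ring
      _ ≤ _ := by
        gcongr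
        exact le_self_add
  · have hwi : IntegrableOn (fun t => e (w t)) (Ioo 0 T) :=
      (e : Htilde Ω s →L[ℂ] (halfLapCLM Ω hs).range).integrable_comp
        (MemLp.integrableOn_Ioo le_top hw.memW_one.1)
    have hw' := hw.isEnergySolution he hm hT hFi
      (MemLp.integrableOn_Ioo le_top (hQu hw.memW_one.1))
    filter_upwards [hw'.ae_unique hJ hJd hb hM0 hQm hQM hwi (integrableOn_Ioo_of_continuous huc)
      hsol] with t ht
    exact e.injective ht

end WellPosedness

end MGT

end

theorem theorem3p4 (n : ℕ) (hn : 1 ≤ n) (Ω : Set (EuclideanSpace ℝ (Fin n)))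
    (hΩo : IsOpen Ω) (hΩb : Bornology.IsBounded Ω)
    (T : ℝ) (hT : 0 < T) (s : ℝ) (hs : 0 < s)
    (p : ℝ≥0∞) [Fact (1 ≤ p)] (hp : 2 ≤ p)
    (hp_sub : 2 * s < n → ENNReal.ofReal (n / s) ≤ p) (hp_crit : 2 * s = n → 2 < p)
    (α b c : ℝ) (hb : 0 < b) (M : ℝ≥0) :
    ∃ C : ℝ≥0, 0 < C ∧
      ∀ q : ℝ → Lp ℝ p (volume.restrict Ω), MemLp q ∞ (MGT.timeMeasure T) →
        eLpNorm q ∞ (MGT.timeMeasure T) ≤ M →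
      ∀ (u₀ u₁ : MGT.Htilde Ω s) (u₂ : MGT.Htilde Ω 0) (F : ℝ → MGT.Htilde Ω 0),
        MemLp F 2 (MGT.timeMeasure T) →
      ∃ u : ℝ → MGT.Htilde Ω s,
        -- `u` is a weak solution in `W^{1,∞}(0,T;H̃^s(Ω)) ∩ W^{2,∞}(0,T;L̃²(Ω))`
        MGT.IsWeakSolution Ω T hs α b c q u₀ u₁ u₂ F u ∧
        -- `u ∈ H³(0,T;H^{-s}(Ω))`
        MGT.MemW T 3 2 (fun t => MGT.restrictNeg hs.le (u t)) ∧
        -- the energy estimate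
        eLpNorm (MGT.timeDeriv T (MGT.timeDeriv T fun t => MGT.Htilde.embed hs.le (u t)))
            ∞ (MGT.timeMeasure T)
          + (eLpNorm (fun t => MGT.halfLap hs (u t)) ∞ (MGT.timeMeasure T)
            + eLpNorm (fun t => MGT.halfLap hs (MGT.timeDeriv T u t)) ∞ (MGT.timeMeasure T))
          ≤ C * (‖MGT.halfLap hs u₀‖ₑ + ‖MGT.halfLap hs u₁‖ₑ + ‖u₂‖ₑ
            + eLpNorm F 2 (MGT.timeMeasure T)) ∧
        -- uniqueness
        ∀ v : ℝ → MGT.Htilde Ω s, MGT.IsWeakSolution Ω T hs α b c q u₀ u₁ u₂ F v →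
          v =ᵐ[MGT.timeMeasure T] u := by
  have hfr : Module.finrank ℝ (EuclideanSpace ℝ (Fin n)) = n := finrank_euclideanSpace_fin
  exact MGT.exists_weakSolution (by rw [hfr]; exact hn) hΩb hT hs hp (by rwa [hfr]) (by rwa [hfr])
    α c hb M
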